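/- Let $q\ge 2$, $\theta_k=e^{2\pi i k/q}$, $0\le\alpha<1$. For each $d$ let $V^{(d)}$ be an exchangeable random vector in $(\mathbb Z/q)^d$, let $(X_t)$ be the random walk on $(\mathbb Z/q)^d$ with independent increments distributed as $V^{(d)}$, and let $G(x,y;\alpha)=\sum_{t\ge0}\alpha^t\,\mathbb P(X_t=y\mid X_0=x)$. A count vector is $m\in\mathbb N^{q}$ with $\sum_{j=0}^{q-1} m[j]=d$; its group is the set of the $\binom dm=d!/\prod_j m[j]!$ points with $m[j]$ entries equal to $j$ for all $j$. The grouped Green function $G(m,n;\alpha)$ is the mean of $G(x,y;\alpha)$ over $x$ in the group of $m$ and $y$ in the group of $n$. Put $$S_d(m,n)=d^{\,q-1}\binom dm\binom dn q^{-d}(1-\alpha)G(m,n;\alpha),\qquad \mathfrak p(m;d)=\binom dm q^{-d}.$$ For $l\in\mathbb N^{q-1}$, $|l|\le d$, let $\kappa^{(d)}_l$ be the common value of $\mathbb E\big[\theta_1^{V^{(d)}\cdot r}\big]$ over the $r\in(\mathbb Z/q)^d$ with $l[k]$ entries equal to $k$ for $1\le k\le q-1$. Assume that $\kappa^{(d)}_l\to\kappa_l$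 as $d\to\infty$, for every $l$ (if the $V^{(d)}$ are the initial segments of one infinite exchangeable sequence, then $\kappa^{(d)}_l=\kappa_l$ does not depend on $d$). Let $h_l=(d-|l|)!\prod_k l[k]!/d!$, and let $Q_l(m)$ be the coefficient of $w^l$ in $\prod_{j=0}^{q-1}\big(1+\sum_{k=1}^{q-1}w_k\theta_k^j\big)^{m[j]}$. For $\mathfrak m_+=(\mathfrak m[1],\dots,\mathfrak m[q-1])\in\mathbb R^{q-1}$ put $\mathfrak m[0]=-\sum_{k\ge1}\mathfrak m[k]$, let $Q_l(\mathfrak m;\infty)$ be the coefficient of $w^l$ in $$\exp\Big\{-\tfrac1{2q}\sum_{j=0}^{q-1}\Big(\sum_{k=1}^{q-1}w_k\theta_k^j\Big)^2+\sum_{j=0}^{q-1}\mathfrak m[j]\sum_{k=1}^{q-1}w_k\theta_k^j\Big\},$$ and let $\varphi(\mathfrak m_+)=\dfrac{q^{q/2}}{(2\pi)^{(q-1)/2}}\exp\Big\{-\dfrac q2\sum_{a,b=1}^{q-1}(\delta_{ab}+1)\mathfrak m[a]\mathfrak m[b]\Big\}$. Then, as $d\to\infty$, with $m=d/q+\sqrt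 d\,\mathfrak m$ and $n=d/q+\sqrt d\,\mathfrak n$, the function $S_d$ converges to $$\varphi(\mathfrak m_+)\varphi(\mathfrak n_+)\Big\{1+\sum_{l\ne0}\frac{\prod_{j=1}^{q-1}l[j]!}{1+\frac{\alpha}{1-\alpha}(1-\kappa_l)}\,Q_l(\mathfrak m;\infty)\overline{Q_l(\mathfrak n;\infty)}\Big\},$$ term by term and weakly, in the following sense. (1) For every $d$ and all count vectors $m,n$, $$S_d(m,n)=\sum_{|l|\le d}T_{d,l}(m,n),\quad T_{d,l}(m,n)=d^{\,q-1}\mathfrak p(m;d)\mathfrak p(n;d)\,\frac{h_l}{1+\frac\alpha{1-\alpha}(1-\kappa^{(d)}_l)}\,Q_l(m)\overline{Q_l(n)} .$$ (2) If $m^{(d)},n^{(d)}$ are count vectors with $(m^{(d)}-d/q)/\sqrt d\to\mathfrak m$ and $(n^{(d)}-d/q)/\sqrt d\to\mathfrak n$, then for every $l$ $$T_{d,l}(m^{(d)},n^{(d)})\to\varphi(\mathfrak m_+)\varphi(\mathfrak n_+)\,\frac{\prod_j l[j]!}{1+\frac\alpha{1-\alpha}(1-\kappa_l)}\,Q_l(\mathfrak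 m;\infty)\overline{Q_l(\mathfrak n;\infty)} .$$ (3) There is a probability measure $\Gamma$ on $\mathbb R^{q-1}\times\mathbb R^{q-1}$ such that for every bounded continuous $F$ $$d^{-(q-1)}\sum_{m,n}F(\mathfrak m_+,\mathfrak n_+)\,S_d(m,n)\to\int F\,d\Gamma ,$$ where $m,n$ run over the count vectors and $\mathfrak m=(m-d/q)/\sqrt d$, $\mathfrak n=(n-d/q)/\sqrt d$ (so that $d^{-(q-1)}$ is the cell volume of the lattice of the points $(\mathfrak m_+,\mathfrak n_+)$), and $\Gamma$ has the displayed series as its kernel: for all complex $f,g\in L^2(\varphi(\mathfrak m_+)\,d\mathfrak m_+)$ the function $f(\mathfrak m_+)g(\mathfrak n_+)$ is $\Gamma$-integrable and $$\int f(\mathfrak m_+)g(\mathfrak n_+)\,d\Gamma=\sum_{l\in\mathbb N^{q-1}}\frac{\prod_j l[j]!}{1+\frac\alpha{1-\alpha}(1-\kappa_l)}\int f\,Q_l(\cdot\,;\infty)\,\varphi\,d\mathfrak m_+\int g\,\overline{Q_l(\cdot\,;\infty)}\,\varphi\,d\mathfrak n_+ ,$$ the series converging unconditionally (the term $l=0$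 has coefficient $1$). -/

import Mathlib

open Filter Topology MeasureTheory
open scoped BoundedContinuousFunction

noncomputable section

namespace GreenLimit

/-- The index set `{1, …, q - 1}` of the nonzero types. -/
abbrev NZ (q : ℕ) : Type := {k : ZMod q // k ≠ 0}

/-- `θ_k ^ j = exp (2 π i k j / q)`. -/
def theta {q : ℕ} (k j : ZMod q) : ℂ :=
  Complex.exp (2 * Real.pi * Complex.I * (k.val * j.val : ℕ) / (q : ℂ))

/-- The number of entries of `x` that are equal to `j`. -/
def count {q d : ℕ} (x : Fin d → ZMod q) (j : ZMod q) : ℕ :=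
  (Finset.univ.filter fun i => x i = j).card

/-- The law of a random vector `V` in `(ℤ/q)^d` is exchangeable. -/
def Exchangeable {q d : ℕ} (ν : PMF (Fin d → ZMod q)) : Prop :=
  ∀ (σ : Equiv.Perm (Fin d)) (v : Fin d → ZMod q), ν (fun i => v (σ i)) = ν v

section Walk

variable {q : ℕ} [NeZero q] {d : ℕ}

/-- The transition matrix of the random walk `X_{t+1} = X_t + Z_t mod q` whose independent increments
have law `ν`. -/
def transition (ν : PMF (Fin d → ZMod q)) : Matrix (Fin d → ZMod q) (Fin d → ZMod q) ℝ :=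
  Matrix.of fun x y => (ν (y - x)).toReal

/-- The Green function `G(x, y; α) = ∑_{t ≥ 0} α ^ t P(X_t = y | X_0 = x)` of the walk which survives
each transition with probability `α`. -/
def green (α : ℝ) (ν : PMF (Fin d → ZMod q)) (x y : Fin d → ZMod q) : ℝ :=
  ∑' t : ℕ, α ^ t * (transition ν ^ t) x y

/-- The points of `(ℤ/q)^d` which have `m j` entries equal to `j`, for all `j`. -/
def group (d : ℕ) (m : ZMod q → ℕ) : Finset (Fin d → ZMod q) :=
  Finset.univ.filter fun x => ∀ j, count x j = m j

/-- The grouped Green function at the count vectors `m`, `n`: the common value, over `x` in the group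
of `m`, of the mean of `G(x, y; α)` over `y` in the group of `n`
(written as a mean over both `x` and `y`). -/
def groupedGreen (α : ℝ) (ν : PMF (Fin d → ZMod q)) (m n : ZMod q → ℕ) : ℝ :=
  (∑ x ∈ group d m, ∑ y ∈ group d n, green α ν x y)
    / ((Nat.multinomial Finset.univ m : ℝ) * (Nat.multinomial Finset.univ n : ℝ))

/-- The scaled function `d^(q-1) (d choose m) (d choose n) q^(-d) (1 - α) G(m, n; α)`. -/
def scaledGreen (α : ℝ) (ν : PMF (Fin d → ZMod q)) (m n : ZMod q → ℕ) : ℝ :=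
  (d : ℝ) ^ (q - 1) * (Nat.multinomial Finset.univ m : ℝ) * (Nat.multinomial Finset.univ n : ℝ)
    / (q : ℝ) ^ d * ((1 - α) * groupedGreen α ν m n)

/-- The eigenvalue `ρ_r = E[θ_1 ^ (V · r)]` of the walk. -/
def rho (ν : PMF (Fin d → ZMod q)) (r : Fin d → ZMod q) : ℂ :=
  ∑ v : Fin d → ZMod q, ((ν v).toReal : ℂ) * ∏ i, theta (r i) (v i)

/-- The indices `r` which have `l k` entries equal to `k`, for all `k ≠ 0`. -/
def indexGroup (d : ℕ) (l : NZ q →₀ ℕ) : Finset (Fin d → ZMod q) :=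
  Finset.univ.filter fun r => ∀ k : NZ q, count r k.1 = l k

/-- The grouped eigenvalue `κ_l` (for `|l| ≤ d`): the value of `ρ_r` on the indices `r` with `l k`
entries equal to `k`, for `k ≠ 0`; under exchangeability this value is the same for all such `r`, and
it is written here as their mean. -/
def kappa (ν : PMF (Fin d → ZMod q)) (l : NZ q →₀ ℕ) : ℂ :=
  (∑ r ∈ indexGroup d l, rho ν r) / ((indexGroup d l).card : ℂ)

end Walk

section Polynomials

variable {q : ℕ} [NeZero q]

/-- The multivariate Krawtchouk polynomial `Q_l(m)`: the coefficient of `w ^ l` in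
`∏_j (1 + ∑_{k ≠ 0} w_k θ_k ^ j) ^ (m j)`. -/
def krawtchouk (l : NZ q →₀ ℕ) (m : ZMod q → ℕ) : ℂ :=
  MvPolynomial.coeff l
    (∏ j : ZMod q, (1 + ∑ k : NZ q, MvPolynomial.C (theta k.1 j) * MvPolynomial.X k) ^ (m j))

/-- The factor `h_l = (d - |l|)! ∏_k (l k)! / d!`, for `|l| ≤ d`. -/
def hConst (d : ℕ) (l : NZ q →₀ ℕ) : ℝ :=
  ((d - ∑ k, l k).factorial : ℝ) * (∏ k, ((l k).factorial : ℝ)) / (d.factorial : ℝ)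

/-- The uniform multinomial probability `(d choose m) q^(-d)`. -/
def multinomialProb (d : ℕ) (m : ZMod q → ℕ) : ℝ :=
  (Nat.multinomial Finset.univ m : ℝ) / (q : ℝ) ^ d

/-- The full vector `(𝔪[0], …, 𝔪[q-1])` of sum zero which belongs to `𝔪₊ = (𝔪[1], …, 𝔪[q-1])`. -/
def full (mp : NZ q → ℝ) (j : ZMod q) : ℝ :=
  if h : j ≠ 0 then mp ⟨j, h⟩ else - ∑ k, mp k

/-- The exponent `-(1/(2q)) ∑_j (∑_k w_k θ_k^j)² + ∑_j 𝔪[j] ∑_k w_k θ_k^j` of the limit generating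
function, a polynomial in `w` without constant term. -/
def limitExponent (mp : NZ q → ℝ) : MvPolynomial (NZ q) ℂ :=
  MvPolynomial.C (-(1 / (2 * (q : ℂ)))) *
      ∑ j : ZMod q, (∑ k : NZ q, MvPolynomial.C (theta k.1 j) * MvPolynomial.X k) ^ 2
    + ∑ j : ZMod q, MvPolynomial.C ((full mp j : ℝ) : ℂ) *
        ∑ k : NZ q, MvPolynomial.C (theta k.1 j) * MvPolynomial.X k

/-- The limit polynomial `Q_l(𝔪; ∞)`: the coefficient of `w ^ l` in the exponential of
`limitExponent`. As the exponent has no constant term, its powers of order `> |l|` do not contribute,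
so that the exponential series is cut off at `|l|`. -/
def limitPoly (l : NZ q →₀ ℕ) (mp : NZ q → ℝ) : ℂ :=
  ∑ s ∈ Finset.range (∑ k, l k + 1),
    MvPolynomial.coeff l (limitExponent mp ^ s) / (s.factorial : ℂ)

/-- The density `φ(𝔪₊; q)` of `𝔐₊` on `ℝ^(q-1)`. -/
def phi (mp : NZ q → ℝ) : ℝ :=
  (q : ℝ) ^ ((q : ℝ) / 2) / (2 * Real.pi) ^ (((q : ℝ) - 1) / 2)
    * Real.exp (-((q : ℝ) / 2) *
        ∑ a : NZ q, ∑ b : NZ q, ((if a = b then (1 : ℝ) else 0) + 1) * mp a * mp b)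

/-- The normal law `φ(𝔪₊; q) d𝔪₊` on `ℝ^(q-1)`. -/
def gauss (q : ℕ) [NeZero q] : Measure (NZ q → ℝ) :=
  volume.withDensity fun mp => ENNReal.ofReal (phi mp)

/-- The point `𝔪₊` with `m = d / q + √d 𝔪`. -/
def scaledPoint (d : ℕ) (m : ZMod q → ℕ) : NZ q → ℝ :=
  fun k => ((m k.1 : ℝ) - (d : ℝ) / (q : ℝ)) / Real.sqrt d

/-- The count vectors: the vectors of `q` natural numbers with sum `d`. -/
def countVectors (q : ℕ) [NeZero q] (d : ℕ) : Finset (ZMod q → ℕ) :=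
  Finset.piAntidiag Finset.univ d

/-- The indices `l` of nonnegative integers with `|l| ≤ d`. -/
def indices (q : ℕ) [NeZero q] (d : ℕ) : Finset (NZ q →₀ ℕ) :=
  (Finset.range (d + 1)).biUnion fun s => Finset.finsuppAntidiag Finset.univ s

/-- The killing factor `1 / (1 + (α / (1 - α)) (1 - κ))`. -/
def killed (α : ℝ) (κ : ℂ) : ℂ :=
  1 / (1 + ((α / (1 - α) : ℝ) : ℂ) * (1 - κ))

/-- The coefficient `(∏_j l[j]!) / (1 + (α / (1 - α)) (1 - κ_l))` of the limit series. -/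
def limitCoeff (α : ℝ) (κ : (NZ q →₀ ℕ) → ℂ) (l : NZ q →₀ ℕ) : ℂ :=
  (∏ k, ((l k).factorial : ℂ)) * killed α (κ l)

/-- The `l`-th term of the expansion of `scaledGreen` at `m`, `n` in Krawtchouk polynomials. -/
def term {d : ℕ} (α : ℝ) (ν : PMF (Fin d → ZMod q)) (l : NZ q →₀ ℕ) (m n : ZMod q → ℕ) : ℂ :=
  (((d : ℝ) ^ (q - 1) * multinomialProb d m * multinomialProb d n : ℝ) : ℂ)
    * ((hConst d l : ℂ) * killed α (kappa ν l)
      * krawtchouk l m * (starRingEnd ℂ) (krawtchouk l n))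

/-- The `l`-th term of the limit series at `𝔪`, `𝔫`. -/
def limitTerm (α : ℝ) (κ : (NZ q →₀ ℕ) → ℂ) (l : NZ q →₀ ℕ) (mp np : NZ q → ℝ) : ℂ :=
  ((phi mp * phi np : ℝ) : ℂ)
    * (limitCoeff α κ l * limitPoly l mp * (starRingEnd ℂ) (limitPoly l np))

end Polynomials

end GreenLimit

end

/-! The characters of `(ℤ/q)^d` diagonalize the walk, so `(1 - α) G` is a sum over frequencies `r`
with weights `(1 - α) / (1 - α ρ_r)`, which is the killing factor at `ρ_r`. By exchangeability `ρ_r`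
depends only on the type `l` of `r`. Averaged over a group, a character of type `l` becomes `h_l
Q_l`. Collecting the frequencies by type gives the finite Krawtchouk expansion (`scaledGreen_eq`).

For the termwise limit, `d^(q-1)` is split evenly between the two multinomial probabilities, which
converge by Stirling's formula (`tendsto_multinomialProb`). The factor `h_l d^|l|` tends to `∏ l!`,
and `d^(-|l|/2) Q_l(m)` tends to the limit polynomial because the generating functions have
converging logarithmic derivatives (`tendsto_krawtchouk`).

For the weak limit, `d^(-(q-1)) S_d` is the weight function of a probability law: it is nonnegative
since the Green function is, and its mass is its Fourier transform at zero. On the count vectors an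
exponential function is a product over the types, so its Krawtchouk transform is explicit
(`sum_multinomialProb_mul_krawtchouk`). Hence the transform of the law is a series over `l` whose
terms converge and are dominated, uniformly in `d`, by a multivariate exponential series
(`norm_transformTerm_le`). The limit is continuous at zero, and Lévy's theorem supplies `Γ`
(`exists_weak_limit`).

It remains to identify the kernel of `Γ`. Putting one frequency equal to zero shows that both
marginals of `Γ` are the normal law, so `f, g ↦ ∫ f(𝔪₊) g(𝔫₊) dΓ` is a bounded form on `L²`. The
trigonometric transforms of the limit polynomials (`integral_trig_mul_limitPoly`) show that this
form is diagonal in them when tested on trigonometric functions. The same computation without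
killing gives Parseval's identity on these functions for the polynomials `√(∏ l!) Q_l(·; ∞)`.
Trigonometric functions span a dense subspace, so Parseval yields Bessel's inequality everywhere. As
the killing factors are at most one in norm, the series is then a bounded form too, and the two
forms agree (`hasSum_inner_of_dense_span`). Orthogonality of the limit polynomials is never needed.
-/

noncomputable section

namespace GreenLimit

/-! ### Characters and the spectral form of the Green function -/

section Characters

variable {q : ℕ} [NeZero q] {d : ℕ}

/-- The representatives `k.val`, `j.val` enter only modulo `q`. All further properties of `theta`
come from those of the standard additive character. -/
lemma theta_eq (k j : ZMod q) : theta k j = ZMod.stdAddChar (k * j) := by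
  have h : k * j = (((k.val * j.val : ℕ) : ℤ) : ZMod q) := by simp
  rw [h, ZMod.stdAddChar_coe, theta]
  simp

lemma theta_comm (k j : ZMod q) : theta k j = theta j k := by
  rw [theta_eq, theta_eq, mul_comm]

@[simp] lemma theta_zero_left (j : ZMod q) : theta 0 j = 1 := by simp [theta_eq]

lemma theta_add_right (k i j : ZMod q) : theta k (i + j) = theta k i * theta k j := by
  simp [theta_eq, mul_add, AddChar.map_add_eq_mul]

lemma norm_theta (k j : ZMod q) : ‖theta k j‖ = 1 := by
  rw [theta_eq, ZMod.stdAddChar_apply, Circle.norm_coe]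

lemma conj_theta (k j : ZMod q) : (starRingEnd ℂ) (theta k j) = theta k (-j) := by
  rw [theta_eq, theta_eq, mul_neg, ZMod.stdAddChar_apply, ZMod.stdAddChar_apply,
    AddChar.map_neg_eq_inv, Circle.coe_inv_eq_conj]

lemma sum_theta (k : ZMod q) : ∑ j, theta k j = if k = 0 then (q : ℂ) else 0 := by
  simp_rw [theta_eq]
  have := AddChar.sum_mulShift (R := ZMod q) (R' := ℂ) k (ZMod.isPrimitive_stdAddChar q)
  simp_rw [mul_comm k]
  rw [this]
  simp [ZMod.card]

/-- The character `x ↦ θ_1 ^ (x · r)` of `(ℤ/q)^d`. -/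
def chi (r x : Fin d → ZMod q) : ℂ := ∏ i, theta (r i) (x i)

lemma rho_eq_sum_chi (ν : PMF (Fin d → ZMod q)) (r : Fin d → ZMod q) :
    rho ν r = ∑ v, ((ν v).toReal : ℂ) * chi r v := rfl

lemma chi_add (r x y : Fin d → ZMod q) : chi r (x + y) = chi r x * chi r y := by
  simp [chi, theta_add_right, Finset.prod_mul_distrib]

lemma conj_chi (r x : Fin d → ZMod q) : (starRingEnd ℂ) (chi r x) = chi r (-x) := by
  simp [chi, conj_theta]

lemma norm_chi (r x : Fin d → ZMod q) : ‖chi r x‖ = 1 := by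
  simp [chi, norm_theta]

lemma sum_chi (x : Fin d → ZMod q) :
    ∑ r : Fin d → ZMod q, chi r x = if x = 0 then (q : ℂ) ^ d else 0 := by
  simp_rw [chi, theta_comm _ (x _)]
  rw [← Fintype.piFinset_univ, ← Finset.prod_univ_sum (fun _ => Finset.univ) fun i j => theta (x i) j]
  simp_rw [sum_theta]
  split_ifs with h
  · subst h; simp
  · obtain ⟨i, hi⟩ := Function.ne_iff.1 h
    exact Finset.prod_eq_zero (Finset.mem_univ i) (if_neg hi)

lemma sum_toReal (ν : PMF (Fin d → ZMod q)) : ∑ v, (ν v).toReal = 1 := by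
  rw [← ENNReal.toReal_sum fun v _ => ν.apply_ne_top v, ← tsum_fintype (L := SummationFilter.unconditional _) (fun v => ν v), ν.tsum_coe]
  simp

lemma norm_rho_le (ν : PMF (Fin d → ZMod q)) (r : Fin d → ZMod q) : ‖rho ν r‖ ≤ 1 := by
  rw [rho_eq_sum_chi]
  refine (norm_sum_le _ _).trans ?_
  simp [norm_chi, sum_toReal]

/-- Characters are eigenvectors of the transition matrix. -/
lemma sum_transition_mul_chi (ν : PMF (Fin d → ZMod q)) (r x : Fin d → ZMod q) :
    ∑ y, (transition ν x y : ℂ) * chi r y = rho ν r * chi r x := by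
  rw [rho_eq_sum_chi, Finset.sum_mul, ← Equiv.sum_comp (Equiv.addLeft x)]
  refine Finset.sum_congr rfl fun v _ => ?_
  simp only [transition, Matrix.of_apply, Equiv.coe_addLeft, add_sub_cancel_left, chi_add]
  ring

/-- The spectral representation of the powers of the transition matrix. -/
lemma transition_pow (ν : PMF (Fin d → ZMod q)) (t : ℕ) (x y : Fin d → ZMod q) :
    (((transition ν ^ t) x y : ℝ) : ℂ)
      = ((q : ℂ) ^ d)⁻¹ * ∑ r, rho ν r ^ t * (chi r x * (starRingEnd ℂ) (chi r y)) := by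
  have hq : ((q : ℂ) ^ d) ≠ 0 := pow_ne_zero _ (Nat.cast_ne_zero.2 (NeZero.ne q))
  induction t generalizing x with
  | zero =>
    -- The case `t = 0` is the orthogonality relation of the characters.
    simp only [pow_zero, one_mul, conj_chi, ← chi_add, ← sub_eq_add_neg, sum_chi]
    rw [Matrix.one_apply]
    simp only [sub_eq_zero]
    split_ifs <;> simp [hq]
  | succ t ih =>
    rw [pow_succ', Matrix.mul_apply]
    push_cast
    simp_rw [ih]
    rw [Finset.mul_sum]
    simp_rw [Finset.mul_sum]
    rw [Finset.sum_comm]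
    refine Finset.sum_congr rfl fun r _ => ?_
    have := sum_transition_mul_chi ν r x
    calc _ = ((q : ℂ) ^ d)⁻¹ * (rho ν r ^ t * (starRingEnd ℂ) (chi r y))
          * ∑ z, (transition ν x z : ℂ) * chi r z := by
            rw [Finset.mul_sum]; exact Finset.sum_congr rfl fun z _ => by ring
      _ = _ := by rw [this]; ring

lemma transition_pow_nonneg (ν : PMF (Fin d → ZMod q)) (t : ℕ) (x y : Fin d → ZMod q) :
    0 ≤ (transition ν ^ t) x y := by
  induction t generalizing x with
  | zero => rw [pow_zero, Matrix.one_apply]; split_ifs <;> simp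
  | succ t ih =>
    rw [pow_succ', Matrix.mul_apply]
    exact Finset.sum_nonneg fun z _ => mul_nonneg ENNReal.toReal_nonneg (ih z)

lemma green_nonneg {α : ℝ} (hα : 0 ≤ α) (ν : PMF (Fin d → ZMod q)) (x y : Fin d → ZMod q) :
    0 ≤ green α ν x y :=
  tsum_nonneg fun t => mul_nonneg (pow_nonneg hα t) (transition_pow_nonneg ν t x y)

/-- In the spectral form each frequency contributes a geometric series of ratio `α ρ_r`, and `‖α
ρ_r‖ ≤ α < 1`; there are finitely many frequencies. -/
lemma ofReal_green {α : ℝ} (hα0 : 0 ≤ α) (hα1 : α < 1) (ν : PMF (Fin d → ZMod q))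
    (x y : Fin d → ZMod q) :
    ((green α ν x y : ℝ) : ℂ) = ((q : ℂ) ^ d)⁻¹ *
      ∑ r, (1 - (α : ℂ) * rho ν r)⁻¹ * (chi r x * (starRingEnd ℂ) (chi r y)) := by
  have h (r : Fin d → ZMod q) : HasSum (fun t : ℕ => ((α : ℂ) * rho ν r) ^ t)
      (1 - (α : ℂ) * rho ν r)⁻¹ := by
    refine hasSum_geometric_of_norm_lt_one ?_
    rw [norm_mul, Complex.norm_real, Real.norm_of_nonneg hα0]
    nlinarith [norm_rho_le ν r, norm_nonneg (rho ν r)]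
  have h2 : HasSum (fun t : ℕ => ((q : ℂ) ^ d)⁻¹ *
      ∑ r, ((α : ℂ) * rho ν r) ^ t * (chi r x * (starRingEnd ℂ) (chi r y)))
      (((q : ℂ) ^ d)⁻¹ *
      ∑ r, (1 - (α : ℂ) * rho ν r)⁻¹ * (chi r x * (starRingEnd ℂ) (chi r y))) :=
    (hasSum_sum fun r _ => (h r).mul_right _).mul_left _
  rw [← h2.tsum_eq, green, Complex.ofReal_tsum]
  refine tsum_congr fun t => ?_
  push_cast
  rw [transition_pow, Finset.mul_sum, Finset.mul_sum, Finset.mul_sum]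
  exact Finset.sum_congr rfl fun r _ => by ring

end Characters

/-! ### Grouping by type and the Krawtchouk expansion -/

section Types

variable {q : ℕ} [NeZero q] {d : ℕ}

omit [NeZero q] in
/-- Two vectors with the same counts are permutations of each other. -/
lemma exists_perm_of_count_eq {x y : Fin d → ZMod q} (h : ∀ j, count x j = count y j) :
    ∃ σ : Equiv.Perm (Fin d), ∀ i, x (σ i) = y i := by
  have e (j : ZMod q) : Nonempty ({i // y i = j} ≃ {i // x i = j}) := by
    refine Fintype.card_eq.1 ?_
    rw [Fintype.card_subtype, Fintype.card_subtype]
    exact (h j).symm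
  replace e := fun j => (e j).some
  -- The bijections between the fibres over each value are glued along the partitions of the
  -- coordinates into fibres.
  refine ⟨(Equiv.sigmaFiberEquiv y).symm.trans
    ((Equiv.sigmaCongrRight e).trans (Equiv.sigmaFiberEquiv x)), fun i => ?_⟩
  simp only [Equiv.trans_apply]
  exact (e (y i) ⟨i, rfl⟩).2

omit [NeZero q] in
lemma count_comp_perm (x : Fin d → ZMod q) (σ : Equiv.Perm (Fin d)) (j : ZMod q) :
    count (fun i => x (σ i)) j = count x j := by
  unfold count
  refine Finset.card_bij (fun i _ => σ i) (by simp) (by simp) fun i hi => ⟨σ.symm i, ?_⟩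
  simpa using hi

lemma sum_count (x : Fin d → ZMod q) : ∑ j, count x j = d := by
  have := Finset.card_eq_sum_card_fiberwise (s := Finset.univ) (t := Finset.univ) (f := x)
    (fun _ _ => by simp)
  simpa [count] using this.symm

lemma prod_count {R : Type*} [CommMonoid R] (f : ZMod q → R) (x : Fin d → ZMod q) :
    ∏ i, f (x i) = ∏ j, f j ^ count x j := by
  rw [← Finset.prod_fiberwise_of_maps_to (s := Finset.univ) (t := Finset.univ) (g := x)
    (fun _ _ => by simp)]
  refine Finset.prod_congr rfl fun j _ => ?_
  rw [count, ← Finset.prod_const]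
  exact Finset.prod_congr rfl fun i hi => by rw [(Finset.mem_filter.1 hi).2]

omit [NeZero q] in
lemma chi_comp_perm (r x : Fin d → ZMod q) (σ : Equiv.Perm (Fin d)) :
    chi (fun i => r (σ i)) (fun i => x (σ i)) = chi r x :=
  Equiv.prod_comp σ fun i => theta (r i) (x i)

lemma sum_group_chi_comp_perm (m : ZMod q → ℕ) (r : Fin d → ZMod q) (σ : Equiv.Perm (Fin d)) :
    ∑ x ∈ group d m, chi (fun i => r (σ i)) x = ∑ x ∈ group d m, chi r x := by
  symm
  refine Finset.sum_bij (fun x _ => fun i => x (σ i)) ?_ ?_ ?_ ?_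
  · intro x hx
    simpa [group, count_comp_perm] using hx
  · intro x _ y _ h
    funext i
    simpa using congrFun h (σ.symm i)
  · intro y hy
    refine ⟨fun i => y (σ.symm i), ?_, by simp⟩
    simpa [group, count_comp_perm] using hy
  · intro x _
    exact (chi_comp_perm r x σ).symm

lemma rho_comp_perm {ν : PMF (Fin d → ZMod q)} (hν : Exchangeable ν) (r : Fin d → ZMod q)
    (σ : Equiv.Perm (Fin d)) : rho ν (fun i => r (σ i)) = rho ν r := by
  rw [rho_eq_sum_chi, rho_eq_sum_chi, ← (Equiv.arrowCongr σ.symm (Equiv.refl _)).sum_comp]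
  refine Finset.sum_congr rfl fun v _ => ?_
  have : (Equiv.arrowCongr σ.symm (Equiv.refl (ZMod q))) v = fun i => v (σ i) := by
    funext i; simp [Equiv.arrowCongr]
  rw [this, hν, chi_comp_perm]

/-- The count vector on `ℤ/q` of total mass `d` which extends `l`. -/
def extend (d : ℕ) (l : NZ q →₀ ℕ) (j : ZMod q) : ℕ :=
  if h : j ≠ 0 then l ⟨j, h⟩ else d - ∑ k, l k

lemma sum_zmod {M : Type*} [AddCommMonoid M] (f : ZMod q → M) :
    ∑ j, f j = f 0 + ∑ k : NZ q, f k.1 := by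
  classical
  rw [← Finset.add_sum_erase _ _ (Finset.mem_univ 0)]
  congr 1
  rw [← Finset.sum_subtype (Finset.univ.erase (0 : ZMod q)) (p := fun k => k ≠ 0) (by simp) f]

lemma prod_zmod {M : Type*} [CommMonoid M] (f : ZMod q → M) :
    ∏ j, f j = f 0 * ∏ k : NZ q, f k.1 := by
  classical
  rw [← Finset.mul_prod_erase _ _ (Finset.mem_univ 0)]
  congr 1
  rw [← Finset.prod_subtype (Finset.univ.erase (0 : ZMod q)) (p := fun k => k ≠ 0) (by simp) f]

lemma extend_zero (d : ℕ) (l : NZ q →₀ ℕ) : extend d l 0 = d - ∑ k, l k := by simp [extend]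

lemma extend_coe (d : ℕ) (l : NZ q →₀ ℕ) (k : NZ q) : extend d l k.1 = l k := by
  simp [extend, k.2]

lemma sum_extend {l : NZ q →₀ ℕ} (h : ∑ k, l k ≤ d) : ∑ j, extend d l j = d := by
  rw [sum_zmod, extend_zero]
  simp_rw [extend_coe]
  omega

lemma mem_indices {l : NZ q →₀ ℕ} : l ∈ indices q d ↔ ∑ k, l k ≤ d := by
  simp [indices, Finset.mem_finsuppAntidiag]

/-- The number of zero entries is forced by the total `d`, so prescribing the nonzero types
prescribes the whole count vector. -/
lemma indexGroup_eq_group {l : NZ q →₀ ℕ} (h : ∑ k, l k ≤ d) :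
    indexGroup d l = group d (extend d l) := by
  ext r
  simp only [indexGroup, group, Finset.mem_filter, Finset.mem_univ, true_and]
  refine ⟨fun hr j => ?_, fun hr k => by rw [hr, extend_coe]⟩
  by_cases hj : j = 0
  · subst hj
    have := sum_count r
    rw [sum_zmod] at this
    simp_rw [hr] at this
    rw [extend_zero]
    omega
  · have := hr ⟨j, hj⟩
    simpa [extend, hj] using this

lemma indexGroup_eq_empty {l : NZ q →₀ ℕ} (h : ¬ ∑ k, l k ≤ d) : indexGroup d l = ∅ := by
  refine Finset.eq_empty_of_forall_notMem fun r hr => h ?_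
  simp only [indexGroup, Finset.mem_filter, Finset.mem_univ, true_and] at hr
  have := sum_count r
  rw [sum_zmod] at this
  simp_rw [hr] at this
  omega

lemma sum_prod_pi_eq {R : Type*} [CommRing R] (f : ZMod q → R) :
    (∑ j, f j) ^ d = ∑ x : Fin d → ZMod q, ∏ i, f (x i) := by
  rw [← Fintype.piFinset_univ, ← Finset.prod_univ_sum (fun _ => Finset.univ) fun _ j => f j]
  simp

/-- The group of `m` has `(d choose m)` elements. -/
lemma card_group {m : ZMod q → ℕ} (hm : ∑ j, m j = d) :
    (group d m).card = Nat.multinomial Finset.univ m := by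
  classical
  -- Both sides of the claim are the coefficient of the same monomial in `(∑ X_j)^d`, expanded once
  -- over points and once over count vectors.
  have h1 := sum_prod_pi_eq (d := d) (fun j : ZMod q => (MvPolynomial.X j : MvPolynomial (ZMod q) ℤ))
  have h2 := Finset.sum_pow_eq_sum_piAntidiag Finset.univ
    (fun j : ZMod q => (MvPolynomial.X j : MvPolynomial (ZMod q) ℤ)) d
  rw [h2] at h1
  have key (f : ZMod q → ℕ) : (∏ j, (MvPolynomial.X j : MvPolynomial (ZMod q) ℤ) ^ f j)
      = MvPolynomial.monomial (Finsupp.equivFunOnFinite.symm f) 1 := by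
    rw [MvPolynomial.monomial_eq]
    simp [Finsupp.prod_fintype]
  simp_rw [prod_count, key] at h1
  have h3 := congrArg (MvPolynomial.coeff (Finsupp.equivFunOnFinite.symm m)) h1
  simp only [MvPolynomial.coeff_sum, MvPolynomial.coeff_monomial, EmbeddingLike.apply_eq_iff_eq,
    ← MvPolynomial.C_eq_coe_nat, MvPolynomial.coeff_C_mul] at h3
  rw [Finset.sum_eq_single_of_mem m (by simp [hm]) (by intro b _ hb; simp [hb])] at h3
  simp only [if_true, mul_one, Finset.sum_boole] at h3
  have h4 : (group d m) = Finset.univ.filter fun x => count x = m := by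
    ext x; simp [group, funext_iff]
  rw [h4]
  exact_mod_cast h3.symm

lemma hConst_pos (d : ℕ) (l : NZ q →₀ ℕ) : 0 < hConst d l := by
  unfold hConst; positivity

lemma multinomial_extend {l : NZ q →₀ ℕ} (h : ∑ k, l k ≤ d) :
    (Nat.multinomial Finset.univ (extend d l) : ℝ) = (hConst d l)⁻¹ := by
  have h1 := Nat.multinomial_spec Finset.univ (extend d l)
  rw [sum_extend h, prod_zmod, extend_zero] at h1
  simp_rw [extend_coe] at h1
  have h2 : (((d - ∑ k, l k).factorial : ℝ) * ∏ k, ((l k).factorial : ℝ))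
      * (Nat.multinomial Finset.univ (extend d l) : ℝ) = d.factorial := by exact_mod_cast h1
  have h3 : (((d - ∑ k, l k).factorial : ℝ) * ∏ k, ((l k).factorial : ℝ)) ≠ 0 := by positivity
  rw [hConst, inv_div, eq_div_iff h3, ← h2]
  ring

lemma card_indexGroup {l : NZ q →₀ ℕ} (h : ∑ k, l k ≤ d) :
    ((indexGroup d l).card : ℝ) = (hConst d l)⁻¹ := by
  rw [indexGroup_eq_group h, card_group (sum_extend h), multinomial_extend h]

/-- The monomial variables, with the variable of the type `0` put equal to `1`. -/
def dehom (q : ℕ) (j : ZMod q) : MvPolynomial (NZ q) ℂ :=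
  if h : j ≠ 0 then MvPolynomial.X ⟨j, h⟩ else 1

omit [NeZero q] in
lemma dehom_zero : dehom q 0 = 1 := by simp [dehom]

omit [NeZero q] in
lemma dehom_coe (k : NZ q) : dehom q k.1 = MvPolynomial.X k := by simp [dehom, k.2]

/-- The type of `r`, as a multi-index. -/
def typeOf (r : Fin d → ZMod q) : NZ q →₀ ℕ := Finsupp.equivFunOnFinite.symm fun k => count r k.1

lemma prod_dehom (r : Fin d → ZMod q) :
    ∏ i, dehom q (r i) = MvPolynomial.monomial (typeOf r) 1 := by
  rw [prod_count, prod_zmod, dehom_zero, one_pow, one_mul, MvPolynomial.monomial_eq]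
  simp [dehom_coe, typeOf, Finsupp.prod_fintype]

lemma mem_indexGroup {l : NZ q →₀ ℕ} {r : Fin d → ZMod q} :
    r ∈ indexGroup d l ↔ typeOf r = l := by
  simp [indexGroup, typeOf, Finsupp.ext_iff]

/-- The Krawtchouk polynomial is the elementary symmetric sum of the characters. -/
lemma krawtchouk_eq_sum_chi (l : NZ q →₀ ℕ) {m : ZMod q → ℕ} {x : Fin d → ZMod q}
    (hx : x ∈ group d m) : krawtchouk l m = ∑ r ∈ indexGroup d l, chi r x := by
  classical
  simp only [group, Finset.mem_filter, Finset.mem_univ, true_and] at hx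
  -- The constant `1` is the summand of the type `0` with variable `1`. Expanding the product of `d`
  -- such sums then ranges over all frequencies `r`, and the monomial records the type of `r`.
  have h1 (j : ZMod q) : (1 + ∑ k : NZ q, MvPolynomial.C (theta k.1 j) * MvPolynomial.X k)
      = ∑ k : ZMod q, MvPolynomial.C (theta k j) * dehom q k := by
    rw [sum_zmod, dehom_zero]
    simp [dehom_coe]
  rw [krawtchouk]
  simp_rw [h1, ← hx, ← prod_count (fun j => ∑ k : ZMod q, MvPolynomial.C (theta k j) * dehom q k)]
  rw [Finset.prod_univ_sum, Fintype.piFinset_univ]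
  simp_rw [Finset.prod_mul_distrib, prod_dehom, ← map_prod]
  simp only [MvPolynomial.coeff_sum, MvPolynomial.coeff_C_mul, MvPolynomial.coeff_monomial]
  rw [indexGroup, Finset.sum_filter]
  refine Finset.sum_congr rfl fun r _ => ?_
  have : typeOf r = l ↔ ∀ k : NZ q, count r k.1 = l k := by simp [typeOf, Finsupp.ext_iff]
  simp only [this, mul_ite, mul_one, mul_zero, chi]

lemma eq_comp_perm_of_mem_indexGroup {l : NZ q →₀ ℕ} {r s : Fin d → ZMod q}
    (hr : r ∈ indexGroup d l) (hs : s ∈ indexGroup d l) :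
    ∃ σ : Equiv.Perm (Fin d), s = fun i => r (σ i) := by
  by_cases h : ∑ k, l k ≤ d
  · rw [indexGroup_eq_group h] at hr hs
    simp only [group, Finset.mem_filter, Finset.mem_univ, true_and] at hr hs
    obtain ⟨σ, hσ⟩ := exists_perm_of_count_eq (x := r) (y := s) fun j => by rw [hr, hs]
    exact ⟨σ, funext fun i => (hσ i).symm⟩
  · rw [indexGroup_eq_empty h] at hr
    simp at hr

lemma rho_eq_kappa {ν : PMF (Fin d → ZMod q)} (hν : Exchangeable ν) {l : NZ q →₀ ℕ}
    {r : Fin d → ZMod q} (hr : r ∈ indexGroup d l) : rho ν r = kappa ν l := by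
  have h (s) (hs : s ∈ indexGroup d l) : rho ν s = rho ν r := by
    obtain ⟨σ, rfl⟩ := eq_comp_perm_of_mem_indexGroup hr hs
    exact rho_comp_perm hν r σ
  have hc : ((indexGroup d l).card : ℂ) ≠ 0 :=
    Nat.cast_ne_zero.2 (Finset.card_ne_zero_of_mem hr)
  rw [kappa, Finset.sum_congr rfl h, Finset.sum_const, nsmul_eq_mul, mul_div_cancel_left₀ _ hc]

/-- Double counting over the frequencies of type `l` and the points of the group: summed over the
frequencies first, each point gives `Q_l(m)`; summed over the points first, each of the `h_l⁻¹`
frequencies gives the same value. -/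
lemma sum_group_chi {l : NZ q →₀ ℕ} {r : Fin d → ZMod q} (hr : r ∈ indexGroup d l)
    {m : ZMod q → ℕ} (hm : ∑ j, m j = d) :
    ∑ x ∈ group d m, chi r x
      = (hConst d l : ℂ) * (Nat.multinomial Finset.univ m : ℂ) * krawtchouk l m := by
  have hl : ∑ k, l k ≤ d := by
    by_contra h
    rw [indexGroup_eq_empty h] at hr
    simp at hr
  have h (s) (hs : s ∈ indexGroup d l) :
      ∑ x ∈ group d m, chi s x = ∑ x ∈ group d m, chi r x := by
    obtain ⟨σ, rfl⟩ := eq_comp_perm_of_mem_indexGroup hr hs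
    exact sum_group_chi_comp_perm m r σ
  have h1 : ∑ s ∈ indexGroup d l, ∑ x ∈ group d m, chi s x
      = ((indexGroup d l).card : ℂ) * ∑ x ∈ group d m, chi r x := by
    rw [Finset.sum_congr rfl h, Finset.sum_const, nsmul_eq_mul]
  rw [Finset.sum_comm, Finset.sum_congr rfl fun x hx => (krawtchouk_eq_sum_chi l hx).symm,
    Finset.sum_const, nsmul_eq_mul, card_group hm] at h1
  have h2 : ((indexGroup d l).card : ℂ) = (hConst d l : ℂ)⁻¹ := by
    exact_mod_cast congrArg ((↑) : ℝ → ℂ) (card_indexGroup hl)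
  have h3 : (hConst d l : ℂ) ≠ 0 := Complex.ofReal_ne_zero.2 (hConst_pos d l).ne'
  rw [h2] at h1
  rw [mul_assoc, h1, mul_inv_cancel_left₀ h3]

lemma sum_eq_sum_indices (f : (Fin d → ZMod q) → ℂ) :
    ∑ r, f r = ∑ l ∈ indices q d, ∑ r ∈ indexGroup d l, f r := by
  classical
  rw [← Finset.sum_fiberwise_of_maps_to (s := Finset.univ) (t := indices q d) (g := typeOf)]
  · refine Finset.sum_congr rfl fun l _ => Finset.sum_congr ?_ fun _ _ => rfl
    ext r
    simp [mem_indexGroup]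
  · intro r _
    rw [mem_indices]
    have := sum_count r
    rw [sum_zmod] at this
    simp only [typeOf, Finsupp.equivFunOnFinite_symm_apply_apply]
    omega

/-- The right-hand side is the form in which the geometric series delivers the weight. -/
lemma killed_eq {α : ℝ} (hα1 : α < 1) (κ : ℂ) :
    killed α κ = (1 - (α : ℂ)) * (1 - (α : ℂ) * κ)⁻¹ := by
  have h : (1 - (α : ℂ)) ≠ 0 := by
    rw [← Complex.ofReal_one, ← Complex.ofReal_sub]
    exact Complex.ofReal_ne_zero.2 (by linarith)
  have h2 : 1 + ((α / (1 - α) : ℝ) : ℂ) * (1 - κ) = (1 - (α : ℂ) * κ) / (1 - (α : ℂ)) := by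
    push_cast
    field_simp
    ring
  rw [killed, h2, one_div, inv_div, div_eq_mul_inv]

/-- The Krawtchouk expansion of the scaled Green function. -/
lemma scaledGreen_eq {α : ℝ} (hα0 : 0 ≤ α) (hα1 : α < 1) {ν : PMF (Fin d → ZMod q)}
    (hν : Exchangeable ν) {m n : ZMod q → ℕ} (hm : ∑ j, m j = d) (hn : ∑ j, n j = d) :
    ((scaledGreen α ν m n : ℝ) : ℂ) = ∑ l ∈ indices q d, term α ν l m n := by
  have hm0 : (Nat.multinomial Finset.univ m : ℂ) ≠ 0 :=
    Nat.cast_ne_zero.2 (Nat.multinomial_pos _ _).ne'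
  have hn0 : (Nat.multinomial Finset.univ n : ℂ) ≠ 0 :=
    Nat.cast_ne_zero.2 (Nat.multinomial_pos _ _).ne'
  have hq : ((q : ℂ) ^ d) ≠ 0 := pow_ne_zero _ (Nat.cast_ne_zero.2 (NeZero.ne q))
  have h1 : ((∑ x ∈ group d m, ∑ y ∈ group d n, green α ν x y : ℝ) : ℂ)
      = ((q : ℂ) ^ d)⁻¹ * ∑ r, (1 - (α : ℂ) * rho ν r)⁻¹ * ((∑ x ∈ group d m, chi r x)
        * (starRingEnd ℂ) (∑ y ∈ group d n, chi r y)) := by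
    push_cast
    simp_rw [ofReal_green hα0 hα1, ← Finset.mul_sum]
    congr 1
    simp_rw [Finset.sum_comm (s := group d n) (t := Finset.univ)]
    rw [Finset.sum_comm]
    refine Finset.sum_congr rfl fun r _ => ?_
    rw [map_sum, Finset.sum_mul_sum, Finset.mul_sum]
    simp_rw [Finset.mul_sum]
  have h2 : (∑ r, (1 - (α : ℂ) * rho ν r)⁻¹ * ((∑ x ∈ group d m, chi r x)
        * (starRingEnd ℂ) (∑ y ∈ group d n, chi r y)))
      = ∑ l ∈ indices q d, (Nat.multinomial Finset.univ m : ℂ) * (Nat.multinomial Finset.univ n : ℂ)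
        * ((1 - (α : ℂ) * kappa ν l)⁻¹ * (hConst d l : ℂ)
          * (krawtchouk l m * (starRingEnd ℂ) (krawtchouk l n))) := by
    rw [sum_eq_sum_indices]
    refine Finset.sum_congr rfl fun l hl => ?_
    have h3 : (hConst d l : ℂ) ≠ 0 := Complex.ofReal_ne_zero.2 (hConst_pos d l).ne'
    have h4 : ((indexGroup d l).card : ℂ) = (hConst d l : ℂ)⁻¹ := by
      exact_mod_cast congrArg ((↑) : ℝ → ℂ) (card_indexGroup (mem_indices.1 hl))
    -- On one type the summand is constant. The two group sums carry `h_l` each, and the number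
    -- `h_l⁻¹` of frequencies cancels one of them.
    rw [Finset.sum_congr rfl fun r hr => by
      rw [rho_eq_kappa hν hr, sum_group_chi hr hm, sum_group_chi hr hn], Finset.sum_const,
      nsmul_eq_mul, h4]
    simp only [map_mul, Complex.conj_ofReal, map_natCast]
    field_simp
  rw [scaledGreen, groupedGreen]
  simp only [Complex.ofReal_mul, Complex.ofReal_div, h1, h2]
  rw [Finset.mul_sum, Finset.sum_div, Finset.mul_sum, Finset.mul_sum]
  refine Finset.sum_congr rfl fun l _ => ?_
  rw [term, killed_eq hα1, multinomialProb, multinomialProb]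
  push_cast
  field_simp

end Types

/-! ### Local limit theorem for the uniform multinomial law -/

section LocalLimit

/-- With `log (1 + y) = y - y² / 2 + E` and `|E| ≤ |y|³ / (1 - |y|) ≤ 2 |y|³`, the remainder after
multiplication by `1 + y` is `(1 + y) E - y³ / 2`. -/
lemma abs_mul_log_sub_le {y : ℝ} (hy : |y| ≤ 1 / 2) :
    |(1 + y) * Real.log (1 + y) - y - y ^ 2 / 2| ≤ 4 * |y| ^ 3 := by
  have h := Real.abs_log_sub_add_sum_range_le (x := -y) (by rw [abs_neg]; linarith) 2
  simp only [Finset.sum_range_succ, Finset.sum_range_zero, abs_neg, sub_neg_eq_add] at h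
  norm_num at h
  have h1 : |y| ^ 3 / (1 - |y|) ≤ 2 * |y| ^ 3 := by
    rw [div_le_iff₀ (by linarith)]
    nlinarith [pow_nonneg (abs_nonneg y) 3]
  set E := -y + y ^ 2 / 2 + Real.log (1 + y) with hE
  have h2 : (1 + y) * Real.log (1 + y) - y - y ^ 2 / 2 = (1 + y) * E - y ^ 3 / 2 := by
    rw [hE]; ring
  rw [h2]
  have h3 : |E| ≤ 2 * |y| ^ 3 := h.trans h1
  have h4 : |1 + y| ≤ 3 / 2 := by
    rw [abs_le] at hy ⊢; constructor <;> linarith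
  calc |(1 + y) * E - y ^ 3 / 2| ≤ |(1 + y) * E| + |y ^ 3 / 2| := abs_sub _ _
    _ = |1 + y| * |E| + |y| ^ 3 / 2 := by rw [abs_mul, abs_div, abs_pow]; norm_num
    _ ≤ 3 / 2 * (2 * |y| ^ 3) + |y| ^ 3 / 2 := by gcongr
    _ ≤ 4 * |y| ^ 3 := by nlinarith [pow_nonneg (abs_nonneg y) 3]

lemma tendsto_sqrt_natCast : Tendsto (fun d : ℕ => Real.sqrt d) atTop atTop :=
  Real.tendsto_sqrt_atTop.comp tendsto_natCast_atTop_atTop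

lemma tendsto_inv_sqrt_natCast : Tendsto (fun d : ℕ => (Real.sqrt d)⁻¹) atTop (𝓝 0) :=
  tendsto_inv_atTop_zero.comp tendsto_sqrt_natCast

/-- The second-order expansion of the entropy at the uniform distribution. -/
lemma tendsto_entropy {c : ℝ} (hc : 0 < c) {a : ℕ → ℝ} {x : ℝ} (ha : Tendsto a atTop (𝓝 x)) :
    Tendsto (fun d : ℕ => (d / c) * ((1 + c * a d / Real.sqrt d) *
      Real.log (1 + c * a d / Real.sqrt d) - c * a d / Real.sqrt d)) atTop (𝓝 (c / 2 * x ^ 2)) := by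
  have hy : Tendsto (fun d : ℕ => c * a d / Real.sqrt d) atTop (𝓝 0) := by
    simpa [div_eq_mul_inv] using (ha.const_mul c).mul tendsto_inv_sqrt_natCast
  have h1 : Tendsto (fun d : ℕ => c / 2 * a d ^ 2) atTop (𝓝 (c / 2 * x ^ 2)) :=
    (ha.pow 2).const_mul _
  have h2 : Tendsto (fun d : ℕ => 4 * c ^ 2 * |a d| ^ 3 * (Real.sqrt d)⁻¹) atTop (𝓝 0) := by
    simpa using ((ha.abs.pow 3).const_mul (4 * c ^ 2)).mul tendsto_inv_sqrt_natCast
  have h3 : Tendsto (fun d : ℕ => (d / c) * ((1 + c * a d / Real.sqrt d) *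
      Real.log (1 + c * a d / Real.sqrt d) - c * a d / Real.sqrt d) - c / 2 * a d ^ 2)
      atTop (𝓝 0) := by
    refine squeeze_zero_norm' ?_ h2
    have h4 : ∀ᶠ d : ℕ in atTop, |c * a d / Real.sqrt d| ≤ 1 / 2 := by
      have := hy.abs
      rw [abs_zero] at this
      exact (this.eventually_lt_const (by norm_num : (0 : ℝ) < 1 / 2)).mono fun _ h => h.le
    filter_upwards [h4, eventually_gt_atTop 0] with d hd hd0
    have hd0' : (0 : ℝ) < d := Nat.cast_pos.2 hd0
    have hs : 0 < Real.sqrt d := Real.sqrt_pos.2 hd0'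
    have hsq : (d : ℝ) = Real.sqrt d ^ 2 := (Real.sq_sqrt hd0'.le).symm
    have h5 := abs_mul_log_sub_le hd
    set y := c * a d / Real.sqrt d with hyd
    have h6 : c / 2 * a d ^ 2 = (d / c) * (y ^ 2 / 2) := by
      rw [hyd]; nth_rewrite 1 [hsq]; field_simp
    rw [h6, ← mul_sub, Real.norm_eq_abs, abs_mul, abs_of_pos (by positivity)]
    calc (d / c) * |(1 + y) * Real.log (1 + y) - y - y ^ 2 / 2|
        ≤ (d / c) * (4 * |y| ^ 3) := by gcongr
      _ = 4 * c ^ 2 * |a d| ^ 3 * (Real.sqrt d)⁻¹ := by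
        rw [hyd, abs_div, abs_mul, abs_of_pos hc, abs_of_pos hs]
        nth_rewrite 1 [hsq]
        field_simp
  simpa using h3.add h1

variable {q : ℕ} [NeZero q]

lemma factorial_eq_stirling {n : ℕ} (hn : n ≠ 0) : (n.factorial : ℝ)
    = Stirling.stirlingSeq n * (Real.sqrt 2 * Real.sqrt n) * (n / Real.exp 1) ^ n := by
  have h0 : (0 : ℝ) < n := Nat.cast_pos.2 (Nat.pos_of_ne_zero hn)
  have : Real.sqrt (2 * n) = Real.sqrt 2 * Real.sqrt n := Real.sqrt_mul (by norm_num) _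
  rw [Stirling.stirlingSeq, this]
  have h1 : 0 < Real.sqrt n := Real.sqrt_pos.2 h0
  field_simp

/-- The scaled full count vector. -/
def scaledFull (d : ℕ) (m : ZMod q → ℕ) (j : ZMod q) : ℝ :=
  ((m j : ℝ) - (d : ℝ) / (q : ℝ)) / Real.sqrt d

lemma sum_scaledFull {d : ℕ} {m : ZMod q → ℕ} (hm : ∑ j, m j = d) :
    ∑ j, scaledFull d m j = 0 := by
  have hq : (q : ℝ) ≠ 0 := Nat.cast_ne_zero.2 (NeZero.ne q)
  have : ∑ j, (m j : ℝ) = d := by exact_mod_cast hm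
  simp only [scaledFull]
  rw [← Finset.sum_div, Finset.sum_sub_distrib, this]
  simp [ZMod.card]
  left
  field_simp
  simp

lemma full_scaledPoint {d : ℕ} {m : ZMod q → ℕ} (hm : ∑ j, m j = d) (j : ZMod q) :
    full (scaledPoint d m) j = scaledFull d m j := by
  by_cases hj : j = 0
  · subst hj
    have := sum_scaledFull hm
    rw [sum_zmod] at this
    simp only [full, ne_eq, not_true_eq_false, dite_false]
    have h2 : ∑ k, scaledPoint d m k = ∑ k : NZ q, scaledFull d m k.1 := rfl
    rw [h2]
    linarith
  · simp [full, hj, scaledPoint, scaledFull]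

lemma continuous_full (j : ZMod q) : Continuous fun mp : NZ q → ℝ => full mp j := by
  unfold full
  split_ifs <;> fun_prop

/-- The quadratic form in the exponent is the squared length of the full vector of sum zero. The
constant is arranged in powers of square roots, as Stirling's formula produces it. -/
lemma phi_eq (mp : NZ q → ℝ) : phi mp
    = Real.sqrt (2 * Real.pi) / Real.sqrt (2 * Real.pi) ^ q * Real.sqrt q ^ q
      * Real.exp (-((q : ℝ) / 2) * ∑ j, full mp j ^ 2) := by
  have hpi : 0 < 2 * Real.pi := by positivity
  have h1 : (q : ℝ) ^ ((q : ℝ) / 2) = Real.sqrt q ^ q := by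
    rw [Real.sqrt_eq_rpow, ← Real.rpow_natCast, ← Real.rpow_mul (by positivity)]
    congr 1; ring
  have h2 : (2 * Real.pi) ^ (((q : ℝ) - 1) / 2)
      = Real.sqrt (2 * Real.pi) ^ q / Real.sqrt (2 * Real.pi) := by
    rw [Real.sqrt_eq_rpow, ← Real.rpow_natCast, ← Real.rpow_mul (by positivity),
      ← Real.rpow_sub hpi]
    congr 1; ring
  have h3 : ∑ a : NZ q, ∑ b : NZ q, ((if a = b then (1 : ℝ) else 0) + 1) * mp a * mp b
      = ∑ j, full mp j ^ 2 := by
    rw [sum_zmod]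
    have h (k : NZ q) : full mp k.1 = mp k := by simp [full, k.2]
    have h0 : full mp 0 = - ∑ k, mp k := by simp [full]
    simp_rw [h, h0, neg_sq, sq, Finset.sum_mul_sum, add_mul, one_mul, Finset.sum_add_distrib,
      ite_mul, one_mul, zero_mul]
    simp [add_comm]
  rw [phi, h1, h2, h3]
  field_simp

/-- The local limit theorem for the uniform multinomial law. -/
lemma tendsto_multinomialProb {m : ℕ → ZMod q → ℕ} (hm : ∀ d, ∑ j, m d j = d)
    {mp : NZ q → ℝ} (hlim : Tendsto (fun d => scaledPoint d (m d)) atTop (𝓝 mp)) :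
    Tendsto (fun d : ℕ => Real.sqrt d ^ (q - 1) * multinomialProb d (m d)) atTop (𝓝 (phi mp)) := by
  have hq : (0 : ℝ) < q := Nat.cast_pos.2 (NeZero.pos q)
  have hx (j : ZMod q) : Tendsto (fun d => scaledFull d (m d) j) atTop (𝓝 (full mp j)) := by
    simp_rw [← fun d => full_scaledPoint (hm d)]
    exact ((continuous_full j).tendsto mp).comp hlim
  have hratio (j : ZMod q) : Tendsto (fun d : ℕ => (q : ℝ) * m d j / d) atTop (𝓝 1) := by
    have h1 : Tendsto (fun d : ℕ => 1 + q * scaledFull d (m d) j * (Real.sqrt d)⁻¹) atTop (𝓝 1) := by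
      simpa using (((hx j).const_mul (q : ℝ)).mul tendsto_inv_sqrt_natCast).const_add 1
    refine h1.congr' ?_
    filter_upwards [eventually_gt_atTop 0] with d hd
    have hd0' : (0 : ℝ) < d := Nat.cast_pos.2 hd
    have hs : 0 < Real.sqrt d := Real.sqrt_pos.2 hd0'
    have hsq : Real.sqrt d ^ 2 = (d : ℝ) := Real.sq_sqrt hd0'.le
    rw [scaledFull]
    field_simp
    rw [hsq]
    field_simp
    ring
  have hpos (j : ZMod q) : ∀ᶠ d : ℕ in atTop, 0 < (m d j : ℝ) := by
    filter_upwards [(hratio j).eventually_const_lt (by norm_num : (0 : ℝ) < 1),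
      eventually_gt_atTop 0] with d h1 h2
    by_contra h
    have : (m d j : ℝ) = 0 := le_antisymm (not_lt.1 h) (Nat.cast_nonneg _)
    simp [this] at h1
  have hinf (j : ZMod q) : Tendsto (fun d => m d j) atTop atTop := by
    rw [← tendsto_natCast_atTop_iff (R := ℝ)]
    have h1 : Tendsto (fun d : ℕ => (q : ℝ) * m d j / d * (d / q)) atTop atTop :=
      (hratio j).pos_mul_atTop one_pos (tendsto_natCast_atTop_atTop.atTop_div_const hq)
    refine h1.congr' ?_
    filter_upwards [eventually_gt_atTop 0] with d hd
    have hd0' : (0 : ℝ) < d := Nat.cast_pos.2 hd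
    field_simp
  -- Stirling's formula splits the probability into three factors: `hA` for the correction
  -- sequences, `hB` for the square roots and `hC` for the powers, which form the exponential of an
  -- entropy.
  have hA : Tendsto (fun d => Stirling.stirlingSeq d / ∏ j, Stirling.stirlingSeq (m d j)) atTop
      (𝓝 (Real.sqrt Real.pi / Real.sqrt Real.pi ^ q)) := by
    have := Stirling.tendsto_stirlingSeq_sqrt_pi.div (tendsto_finsetProd Finset.univ fun j _ =>
      Stirling.tendsto_stirlingSeq_sqrt_pi.comp (hinf j)) (by
        simp [Real.pi_pos.le, Real.pi_ne_zero])
    simp only [Finset.prod_const, Finset.card_univ, ZMod.card, Function.comp_apply] at this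
    exact this
  have hB : Tendsto (fun d : ℕ => Real.sqrt 2 / Real.sqrt 2 ^ q *
      (Real.sqrt q ^ q / ∏ j, Real.sqrt (q * m d j / d))) atTop
      (𝓝 (Real.sqrt 2 / Real.sqrt 2 ^ q * (Real.sqrt q ^ q / 1))) := by
    refine Tendsto.const_mul _ (Tendsto.div tendsto_const_nhds ?_ one_ne_zero)
    have := tendsto_finsetProd Finset.univ fun j _ =>
      (Real.continuous_sqrt.tendsto 1).comp (hratio j)
    simpa using this
  have hC : Tendsto (fun d : ℕ => Real.exp (-∑ j, (d / q) * ((1 + q * scaledFull d (m d) j / Real.sqrt d) *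
      Real.log (1 + q * scaledFull d (m d) j / Real.sqrt d) - q * scaledFull d (m d) j / Real.sqrt d)))
      atTop (𝓝 (Real.exp (-∑ j, (q : ℝ) / 2 * full mp j ^ 2))) :=
    (Real.continuous_exp.tendsto _).comp
      (tendsto_finsetSum Finset.univ fun j _ => tendsto_entropy hq (hx j)).neg
  have hfin := (hA.mul hB).mul hC
  have hval : Real.sqrt Real.pi / Real.sqrt Real.pi ^ q *
      (Real.sqrt 2 / Real.sqrt 2 ^ q * (Real.sqrt q ^ q / 1)) *
      Real.exp (-∑ j, (q : ℝ) / 2 * full mp j ^ 2) = phi mp := by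
    rw [phi_eq, Real.sqrt_mul (by norm_num), mul_pow, Finset.mul_sum, ← Finset.sum_neg_distrib]
    simp_rw [neg_mul]
    field_simp
  rw [hval] at hfin
  refine hfin.congr' ?_
  filter_upwards [eventually_all.2 hpos, eventually_gt_atTop 0] with d hp hd
  have hd0' : (0 : ℝ) < d := Nat.cast_pos.2 hd
  have hs : 0 < Real.sqrt d := Real.sqrt_pos.2 hd0'
  have hsq : Real.sqrt d ^ 2 = (d : ℝ) := Real.sq_sqrt hd0'.le
  have hz (j : ZMod q) : 1 + q * scaledFull d (m d) j / Real.sqrt d = q * m d j / d := by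
    rw [scaledFull]
    field_simp
    rw [hsq]
    field_simp
    ring
  have hexp : Real.exp (-∑ j, (d / q) * ((1 + q * scaledFull d (m d) j / Real.sqrt d) *
      Real.log (1 + q * scaledFull d (m d) j / Real.sqrt d)
        - q * scaledFull d (m d) j / Real.sqrt d))
      = (d : ℝ) ^ d / ((q : ℝ) ^ d * ∏ j, (m d j : ℝ) ^ m d j) := by
    simp_rw [mul_sub, Finset.sum_sub_distrib]
    -- The linear terms were put in to make each entropy summand converge; they cancel because the
    -- scaled counts sum to zero.
    have h0 : ∑ j, (d : ℝ) / q * (q * scaledFull d (m d) j / Real.sqrt d) = 0 := by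
      have : ∀ j, (d : ℝ) / q * (q * scaledFull d (m d) j / Real.sqrt d)
          = (d / Real.sqrt d) * scaledFull d (m d) j := fun j => by field_simp
      simp_rw [this, ← Finset.mul_sum, sum_scaledFull (hm d), mul_zero]
    rw [h0, sub_zero, ← Finset.sum_neg_distrib, Real.exp_sum]
    simp_rw [hz]
    have h1 (j : ZMod q) : Real.exp (-((d : ℝ) / q * (q * m d j / d * Real.log (q * m d j / d))))
        = ((d : ℝ) / q / m d j) ^ m d j := by
      have hpj := hp j
      have e1 : (d : ℝ) / q / m d j = ((q : ℝ) * m d j / d)⁻¹ := by field_simp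
      rw [e1, ← Real.exp_log (x := ((q : ℝ) * m d j / d)⁻¹) (by positivity), ← Real.exp_nat_mul,
        Real.log_inv]
      congr 1
      field_simp
    simp_rw [h1, div_pow, Finset.prod_div_distrib, Finset.prod_pow_eq_pow_sum, hm d]
    rw [div_div]
  rw [hexp]
  have hsqrt (j : ZMod q) : Real.sqrt (q * m d j / d) = Real.sqrt q * Real.sqrt (m d j) / Real.sqrt d := by
    rw [Real.sqrt_div (by positivity), Real.sqrt_mul hq.le]
  have hspec : (∏ j, ((m d j).factorial : ℝ)) * (Nat.multinomial Finset.univ (m d) : ℝ)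
      = d.factorial := by
    have := Nat.multinomial_spec Finset.univ (m d)
    rw [hm d] at this
    exact_mod_cast this
  have hfac : (∏ j, ((m d j).factorial : ℝ)) ≠ 0 := by positivity
  have hmult : (Nat.multinomial Finset.univ (m d) : ℝ)
      = d.factorial / ∏ j, ((m d j).factorial : ℝ) := by
    rw [← hspec, mul_div_cancel_left₀ _ hfac]
  rw [multinomialProb, hmult, factorial_eq_stirling hd.ne', Finset.prod_congr rfl fun j _ =>
      factorial_eq_stirling (Nat.cast_pos.1 (hp j)).ne']
  simp_rw [hsqrt, Finset.prod_div_distrib, Finset.prod_mul_distrib, div_pow,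
    Finset.prod_div_distrib, Finset.prod_pow_eq_pow_sum, hm d]
  simp only [Finset.prod_const, Finset.card_univ, ZMod.card]
  have hS : ∏ j, Stirling.stirlingSeq (m d j) ≠ 0 := by
    refine Finset.prod_ne_zero_iff.2 fun j _ => ?_
    obtain ⟨n, hn⟩ := Nat.exists_eq_succ_of_ne_zero (Nat.cast_pos.1 (hp j)).ne'
    rw [hn]
    exact (Stirling.stirlingSeq'_pos n).ne'
  have hP : ∏ j, Real.sqrt (m d j) ≠ 0 :=
    Finset.prod_ne_zero_iff.2 fun j _ => (Real.sqrt_pos.2 (hp j)).ne'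
  have hQ : ∏ j, (m d j : ℝ) ^ m d j ≠ 0 :=
    Finset.prod_ne_zero_iff.2 fun j _ => (pow_pos (hp j) _).ne'
  have hsd : Real.sqrt d ^ q = Real.sqrt d ^ (q - 1) * Real.sqrt d := by
    rw [← pow_succ, Nat.sub_add_cancel (NeZero.one_le)]
  field_simp
  rw [hsd]
  ring

end LocalLimit

/-! ### Coefficients of `exp (L t + B t²)` -/

section Hermite

/-- The power series of `exp (L t)`. -/
def expLin (L : ℂ) : PowerSeries ℂ := PowerSeries.mk fun n => L ^ n / n.factorial

/-- The power series of `exp (B t²)`. -/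
def expSq (B : ℂ) : PowerSeries ℂ :=
  PowerSeries.mk fun n => if Even n then B ^ (n / 2) / (n / 2).factorial else 0

/-- The Hermite coefficients: the coefficients of `exp (L t + B t²)`. -/
def herm (L B : ℂ) (n : ℕ) : ℂ := PowerSeries.coeff n (expLin L * expSq B)

lemma derivative_expLin (L : ℂ) :
    PowerSeries.derivative ℂ (expLin L) = PowerSeries.C L * expLin L := by
  ext n
  rw [PowerSeries.coeff_derivative, PowerSeries.coeff_C_mul, expLin, PowerSeries.coeff_mk,
    PowerSeries.coeff_mk, Nat.factorial_succ]
  have : ((n : ℂ) + 1) ≠ 0 := by exact_mod_cast Nat.succ_ne_zero n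
  push_cast
  field_simp
  ring

lemma derivative_expSq (B : ℂ) : PowerSeries.derivative ℂ (expSq B)
    = PowerSeries.C (2 * B) * PowerSeries.X * expSq B := by
  ext n
  rw [PowerSeries.coeff_derivative, mul_assoc, PowerSeries.coeff_C_mul]
  rcases n with _ | n
  · simp [expSq]
  · rw [PowerSeries.coeff_succ_X_mul, expSq, PowerSeries.coeff_mk, PowerSeries.coeff_mk]
    by_cases h : Even n
    · obtain ⟨k, rfl⟩ := h
      have h1 : Even (k + k + 1 + 1) := ⟨k + 1, by ring⟩
      have h2 : (k + k + 1 + 1) / 2 = k + 1 := by omega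
      have h3 : (k + k) / 2 = k := by omega
      rw [if_pos h1, if_pos ⟨k, rfl⟩, h2, h3, Nat.factorial_succ]
      have : ((k : ℂ) + 1) ≠ 0 := by exact_mod_cast Nat.succ_ne_zero k
      push_cast
      field_simp
      ring
    · have h1 : ¬ Even (n + 1 + 1) := by simpa [Nat.even_add_one] using h
      rw [if_neg h1, if_neg h]
      simp

lemma herm_zero (L B : ℂ) : herm L B 0 = 1 := by
  simp [herm, PowerSeries.coeff_mul, expLin, expSq]

/-- This is the differential equation `P' = (L + 2 B t) P` read off at `t^n`. With the value at `0`
it determines the sequence. -/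
lemma herm_succ (L B : ℂ) (n : ℕ) : herm L B (n + 1) * (n + 1)
    = PowerSeries.coeff n ((PowerSeries.C L + PowerSeries.C (2 * B) * PowerSeries.X)
        * (PowerSeries.mk (herm L B))) := by
  have h : PowerSeries.mk (herm L B) = expLin L * expSq B := by ext n; simp [herm]
  rw [h, herm, ← PowerSeries.coeff_derivative, Derivation.leibniz, derivative_expLin,
    derivative_expSq]
  congr 1
  simp only [smul_eq_mul]
  ring

lemma coeff_mul_congr {R : Type*} [CommSemiring R] (f g g' : PowerSeries R) (n : ℕ)
    (h : ∀ i ≤ n, PowerSeries.coeff i g = PowerSeries.coeff i g') :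
    PowerSeries.coeff n (f * g) = PowerSeries.coeff n (f * g') := by
  rw [PowerSeries.coeff_mul, PowerSeries.coeff_mul]
  refine Finset.sum_congr rfl fun p hp => ?_
  rw [h _ (by have := Finset.HasAntidiagonal.mem_antidiagonal.1 hp; omega)]

/-- The Hermite coefficients from the truncated exponential series. -/
lemma sum_coeff_pow_eq_herm (L B : ℂ) {N n : ℕ} (hn : n ≤ N) :
    ∑ s ∈ Finset.range (N + 1), PowerSeries.coeff n
      ((PowerSeries.C L * PowerSeries.X + PowerSeries.C B * PowerSeries.X ^ 2) ^ s) / (s.factorial : ℂ)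
      = herm L B n := by
  set Z : PowerSeries ℂ := PowerSeries.C L * PowerSeries.X + PowerSeries.C B * PowerSeries.X ^ 2
    with hZ
  have hdZ : PowerSeries.derivative ℂ Z
      = PowerSeries.C L + PowerSeries.C (2 * B) * PowerSeries.X := by
    simp only [hZ, map_add, Derivation.leibniz, Derivation.leibniz_pow, PowerSeries.derivative_C,
      PowerSeries.derivative_X, map_mul, map_ofNat]
    simp
    ring
  have hZ0 : PowerSeries.constantCoeff Z = 0 := by simp [hZ]
  let E (N : ℕ) : PowerSeries ℂ :=
    ∑ s ∈ Finset.range (N + 1), PowerSeries.C ((s.factorial : ℂ)⁻¹) * Z ^ s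
  have hE (N n : ℕ) : PowerSeries.coeff n (E N) = ∑ s ∈ Finset.range (N + 1),
      PowerSeries.coeff n (Z ^ s) / s.factorial := by
    simp only [E, map_sum, PowerSeries.coeff_C_mul]
    exact Finset.sum_congr rfl fun s _ => by rw [div_eq_mul_inv, mul_comm]
  -- Differentiation lowers the truncation by one. So the coefficients up to `N + 1` of `E (N + 1)`
  -- obey the recursion of `herm` in terms of those up to `N` of `E N`.
  have hdE (N : ℕ) : PowerSeries.derivative ℂ (E (N + 1)) = PowerSeries.derivative ℂ Z * E N := by
    simp only [E]
    rw [Finset.sum_range_succ', map_add, map_sum, Finset.mul_sum]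
    simp only [pow_zero, mul_one, PowerSeries.derivative_C, add_zero]
    refine Finset.sum_congr rfl fun s _ => ?_
    rw [Derivation.leibniz, PowerSeries.derivative_C, smul_zero, add_zero, Derivation.leibniz_pow,
      Nat.factorial_succ]
    have : ((s : ℂ) + 1) ≠ 0 := by exact_mod_cast Nat.succ_ne_zero s
    simp only [smul_eq_mul, nsmul_eq_mul, Nat.add_sub_cancel]
    have h2 : PowerSeries.C ((((s + 1) * s.factorial : ℕ) : ℂ)⁻¹) * ((s + 1 : ℕ) : PowerSeries ℂ)
        = PowerSeries.C ((s.factorial : ℂ)⁻¹) := by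
      rw [← map_natCast (PowerSeries.C (R := ℂ)), ← map_mul]
      congr 1
      push_cast
      field_simp
    calc _ = (PowerSeries.C ((((s + 1) * s.factorial : ℕ) : ℂ)⁻¹) * ((s + 1 : ℕ) : PowerSeries ℂ))
          * (Z ^ s * PowerSeries.derivative ℂ Z) := by ring
      _ = _ := by rw [h2]; ring
  have key (N : ℕ) : ∀ n ≤ N, PowerSeries.coeff n (E N) = herm L B n := by
    induction N with
    | zero =>
      intro n hn
      obtain rfl : n = 0 := by omega
      rw [hE, herm_zero]
      simp
    | succ N ih =>
      intro n hn
      rcases n with _ | n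
      · rw [hE, herm_zero, Finset.sum_range_succ']
        simp [hZ0]
      · have h1 := herm_succ L B n
        have h2 : PowerSeries.coeff (n + 1) (E (N + 1)) * (n + 1)
            = PowerSeries.coeff n (PowerSeries.derivative ℂ Z * E N) := by
          rw [← hdE, PowerSeries.coeff_derivative]
        rw [hdZ, coeff_mul_congr _ _ (PowerSeries.mk (herm L B)) n (fun i hi => by
          rw [ih i (by omega), PowerSeries.coeff_mk]), ← h1] at h2
        exact mul_right_cancel₀ (by exact_mod_cast Nat.succ_ne_zero n) h2
  rw [← hE]
  exact key N n hn

/-- Power series with converging logarithmic derivative converge. -/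
lemma tendsto_coeff_of_logDeriv {P A : ℕ → PowerSeries ℂ} {L B : ℂ}
    (hP0 : ∀ d, PowerSeries.coeff 0 (P d) = 1)
    (hP : ∀ d, PowerSeries.derivative ℂ (P d) = A d * P d)
    (hA : ∀ i, Tendsto (fun d => PowerSeries.coeff i (A d)) atTop
      (𝓝 (PowerSeries.coeff i (PowerSeries.C L + PowerSeries.C (2 * B) * PowerSeries.X)))) (n : ℕ) :
    Tendsto (fun d => PowerSeries.coeff n (P d)) atTop (𝓝 (herm L B n)) := by
  -- The coefficient of order `n + 1` is `1 / (n + 1)` times a finite sum of products of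
  -- coefficients of `A` with earlier coefficients of `P`.
  induction n using Nat.strong_induction_on with
  | _ n ih =>
    rcases n with _ | n
    · simp [hP0, herm_zero]
    · have hn : ((n : ℂ) + 1) ≠ 0 := by exact_mod_cast Nat.succ_ne_zero n
      have h1 : Tendsto (fun d => PowerSeries.coeff n (A d * P d)) atTop
          (𝓝 (herm L B (n + 1) * (n + 1))) := by
        rw [herm_succ]
        simp_rw [PowerSeries.coeff_mul]
        refine tendsto_finsetSum _ fun p hp => (hA p.1).mul ?_
        rw [PowerSeries.coeff_mk]
        exact ih _ (by have := Finset.HasAntidiagonal.mem_antidiagonal.1 hp; omega)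
      have h2 := h1.div_const ((n : ℂ) + 1)
      rw [mul_div_cancel_right₀ _ hn] at h2
      refine h2.congr fun d => ?_
      rw [← hP, PowerSeries.coeff_derivative, mul_div_cancel_right₀ _ hn]

end Hermite

/-! ### Multivariate polynomials restricted to lines -/

section Homogeneous

variable {ι : Type*} [Fintype ι] [DecidableEq ι]

/-- The restriction of a polynomial to the line through `w`. -/
def onLine (w : ι → ℂ) : MvPolynomial ι ℂ →ₐ[ℂ] PowerSeries ℂ :=
  MvPolynomial.aeval fun k => PowerSeries.C (w k) * PowerSeries.X

/-- The multi-indices of degree `n`. -/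
abbrev ofDegree (ι : Type*) [Fintype ι] [DecidableEq ι] (n : ℕ) : Finset (ι →₀ ℕ) :=
  Finset.univ.finsuppAntidiag n

lemma mem_ofDegree {n : ℕ} {l : ι →₀ ℕ} : l ∈ ofDegree ι n ↔ ∑ k, l k = n := by
  simp [ofDegree, Finset.mem_finsuppAntidiag]

/-- On the line `t ↦ t w` the homogeneous part of degree `n` becomes the coefficient of `t^n`. This
reduces questions on multivariate generating functions to one variable. -/
lemma coeff_onLine (w : ι → ℂ) (f : MvPolynomial ι ℂ) (n : ℕ) :
    PowerSeries.coeff n (onLine w f)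
      = ∑ l ∈ ofDegree ι n, MvPolynomial.coeff l f * ∏ k, w k ^ l k := by
  induction f using MvPolynomial.induction_on' with
  | monomial s a =>
    have h : onLine w (MvPolynomial.monomial s a)
        = PowerSeries.C (a * ∏ k, w k ^ s k) * PowerSeries.X ^ (∑ k, s k) := by
      rw [onLine, MvPolynomial.aeval_monomial, Finsupp.prod_fintype _ _ (by simp)]
      simp only [mul_pow, Finset.prod_mul_distrib, Finset.prod_pow_eq_pow_sum, map_mul, map_prod,
        map_pow, mul_assoc]
      rfl
    rw [h, PowerSeries.coeff_C_mul, PowerSeries.coeff_X_pow]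
    simp only [MvPolynomial.coeff_monomial, ite_mul, zero_mul, Finset.sum_ite_eq, mem_ofDegree,
      mul_ite, mul_one, mul_zero, eq_comm]
  | add p q hp hq =>
    simp only [map_add, hp, hq, MvPolynomial.coeff_add, add_mul, Finset.sum_add_distrib]

/-- The coefficients of polynomials which converge pointwise converge. -/
lemma tendsto_coeff_of_tendsto_eval {T : Finset (ι →₀ ℕ)} {c : ℕ → (ι →₀ ℕ) → ℂ}
    {c0 : (ι →₀ ℕ) → ℂ}
    (h : ∀ w : ι → ℂ, Tendsto (fun d => ∑ l ∈ T, c d l * ∏ k, w k ^ l k) atTop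
      (𝓝 (∑ l ∈ T, c0 l * ∏ k, w k ^ l k))) {l : ι →₀ ℕ} (hl : l ∈ T) :
    Tendsto (fun d => c d l) atTop (𝓝 (c0 l)) := by
  -- `Φ` sends coefficients to the polynomial function. It is injective on a finite-dimensional
  -- space, hence an embedding for the topology of pointwise convergence.
  let Φ : (T → ℂ) →ₗ[ℂ] ((ι → ℂ) → ℂ) :=
    { toFun := fun a w => ∑ l : T, a l * ∏ k, w k ^ l.1 k
      map_add' := by intro a b; funext w; simp [add_mul, Finset.sum_add_distrib]
      map_smul' := by intro a b; funext w; simp [Finset.mul_sum, mul_assoc] }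
  have hinj : LinearMap.ker Φ = ⊥ := by
    rw [LinearMap.ker_eq_bot']
    intro a ha
    have h1 : (∑ l : T, MvPolynomial.monomial l.1 (a l)) = 0 := by
      refine MvPolynomial.funext fun w => ?_
      have := congrFun ha w
      simp only [map_sum, MvPolynomial.eval_monomial, map_zero]
      simpa [Φ, Finsupp.prod_fintype] using this
    funext l
    have h2 := congrArg (MvPolynomial.coeff l.1) h1
    simpa [MvPolynomial.coeff_sum, MvPolynomial.coeff_monomial, Subtype.coe_inj] using h2
  have hemb := LinearMap.isClosedEmbedding_of_injective (𝕜 := ℂ) (f := Φ) hinj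
  have h2 : Tendsto (fun d => (fun l : T => c d l.1)) atTop (𝓝 fun l : T => c0 l.1) := by
    rw [hemb.isEmbedding.tendsto_nhds_iff, tendsto_pi_nhds]
    intro w
    have := h w
    rw [← Finset.sum_coe_sort T] at this
    simp_rw [← Finset.sum_coe_sort T] at this
    exact this
  exact (tendsto_pi_nhds.1 h2) ⟨l, hl⟩

end Homogeneous

/-! ### Convergence of the Krawtchouk polynomials -/

section KrawtchoukLimit

variable {q : ℕ} [NeZero q]

/-- The linear form `∑_k w_k θ_k^j`. -/
def linForm (w : NZ q → ℂ) (j : ZMod q) : ℂ := ∑ k : NZ q, theta k.1 j * w k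

lemma sum_linForm (w : NZ q → ℂ) : ∑ j, linForm w j = 0 := by
  simp only [linForm]
  rw [Finset.sum_comm]
  refine Finset.sum_eq_zero fun k _ => ?_
  rw [← Finset.sum_mul, sum_theta, if_neg k.2, zero_mul]

lemma onLine_sum_theta (w : NZ q → ℂ) (j : ZMod q) :
    onLine w (∑ k : NZ q, MvPolynomial.C (theta k.1 j) * MvPolynomial.X k)
      = PowerSeries.C (linForm w j) * PowerSeries.X := by
  simp only [onLine, map_sum, map_mul, MvPolynomial.aeval_X, MvPolynomial.aeval_C, linForm,
    Finset.sum_mul, mul_assoc]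
  rfl

/-- The linear coefficient of the limit exponent on the line through `w`. -/
def linCoeff (w : NZ q → ℂ) (mp : NZ q → ℝ) : ℂ := ∑ j, (full mp j : ℂ) * linForm w j

/-- The quadratic coefficient of the limit exponent on the line through `w`. -/
def sqCoeff (w : NZ q → ℂ) : ℂ := -(1 / (2 * (q : ℂ))) * ∑ j, linForm w j ^ 2

lemma onLine_limitExponent (w : NZ q → ℂ) (mp : NZ q → ℝ) :
    onLine w (limitExponent mp) = PowerSeries.C (linCoeff w mp) * PowerSeries.X
      + PowerSeries.C (sqCoeff w) * PowerSeries.X ^ 2 := by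
  have hC (a : ℂ) : onLine w (MvPolynomial.C a) = PowerSeries.C a := by
    rw [onLine, MvPolynomial.aeval_C]; rfl
  rw [limitExponent, map_add, map_mul, map_sum, map_sum]
  simp_rw [map_mul, map_pow, onLine_sum_theta, hC, linCoeff, sqCoeff]
  rw [add_comm]
  simp only [map_mul, map_sum, map_pow, Finset.sum_mul, Finset.mul_sum, mul_pow, mul_assoc]

/-- The generating function of the limit polynomials. -/
lemma sum_limitPoly (w : NZ q → ℂ) (mp : NZ q → ℝ) (n : ℕ) :
    ∑ l ∈ ofDegree (NZ q) n, limitPoly l mp * ∏ k, w k ^ l k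
      = herm (linCoeff w mp) (sqCoeff w) n := by
  have h1 : ∑ l ∈ ofDegree (NZ q) n, limitPoly l mp * ∏ k, w k ^ l k
      = ∑ l ∈ ofDegree (NZ q) n, ∑ s ∈ Finset.range (n + 1),
        (MvPolynomial.coeff l (limitExponent mp ^ s) / (s.factorial : ℂ)) * ∏ k, w k ^ l k := by
    refine Finset.sum_congr rfl fun l hl => ?_
    rw [limitPoly, mem_ofDegree.1 hl, Finset.sum_mul]
  rw [h1, Finset.sum_comm, ← sum_coeff_pow_eq_herm _ _ le_rfl]
  refine Finset.sum_congr rfl fun s _ => ?_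
  rw [← onLine_limitExponent, ← map_pow, coeff_onLine, Finset.sum_div]
  exact Finset.sum_congr rfl fun l _ => by ring

/-- The generating function of the Krawtchouk polynomials. -/
lemma sum_krawtchouk (w : NZ q → ℂ) (h : ℂ) (m : ZMod q → ℕ) (n : ℕ) :
    ∑ l ∈ ofDegree (NZ q) n, krawtchouk l m * h ^ n * ∏ k, w k ^ l k
      = PowerSeries.coeff n
        (∏ j : ZMod q, (1 + PowerSeries.C (h * linForm w j) * PowerSeries.X) ^ m j) := by
  have h1 : (∏ j : ZMod q, (1 + PowerSeries.C (h * linForm w j) * PowerSeries.X) ^ m j)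
      = onLine (fun k => h * w k) (∏ j : ZMod q,
        (1 + ∑ k : NZ q, MvPolynomial.C (theta k.1 j) * MvPolynomial.X k) ^ (m j)) := by
    have h2 (j : ZMod q) : linForm (fun k => h * w k) j = h * linForm w j := by
      simp only [linForm, Finset.mul_sum]
      exact Finset.sum_congr rfl fun k _ => by ring
    simp_rw [map_prod, map_pow, map_add, map_one, onLine_sum_theta, h2]
  rw [h1, coeff_onLine]
  refine Finset.sum_congr rfl fun l hl => ?_
  rw [krawtchouk]
  simp_rw [mul_pow, Finset.prod_mul_distrib, Finset.prod_pow_eq_pow_sum, mem_ofDegree.1 hl]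
  ring

lemma derivation_prod_of_eq_mul {κ : Type*} (s : Finset κ) (f a : κ → PowerSeries ℂ)
    (h : ∀ j ∈ s, PowerSeries.derivative ℂ (f j) = a j * f j) :
    PowerSeries.derivative ℂ (∏ j ∈ s, f j) = (∑ j ∈ s, a j) * ∏ j ∈ s, f j := by
  classical
  induction s using Finset.induction_on with
  | empty => simp
  | insert j s hj ih =>
    rw [Finset.prod_insert hj, Finset.sum_insert hj, Derivation.leibniz, h j (by simp),
      ih fun i hi => h i (by simp [hi])]
    simp only [smul_eq_mul]
    ring

lemma derivative_one_add_pow (v : ℂ) (m : ℕ) :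
    PowerSeries.derivative ℂ ((1 + PowerSeries.C v * PowerSeries.X) ^ m)
      = PowerSeries.mk (fun i => (m : ℂ) * v * (-v) ^ i)
        * (1 + PowerSeries.C v * PowerSeries.X) ^ m := by
  have h1 : PowerSeries.mk (fun i => (m : ℂ) * v * (-v) ^ i)
      * (1 + PowerSeries.C v * PowerSeries.X) = PowerSeries.C ((m : ℂ) * v) := by
    ext i
    rw [mul_add, mul_one, map_add, ← mul_assoc]
    rcases i with _ | i
    · simp
    · rw [PowerSeries.coeff_succ_mul_X, PowerSeries.coeff_mul_C, PowerSeries.coeff_C]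
      simp only [PowerSeries.coeff_mk, Nat.succ_ne_zero, if_false, pow_succ]
      ring
  rcases m with _ | m
  · have : (PowerSeries.mk fun i : ℕ => ((0 : ℕ) : ℂ) * v * (-v) ^ i) = 0 := by ext; simp
    rw [this, pow_zero, PowerSeries.derivative_one, zero_mul]
  · rw [Derivation.leibniz_pow, pow_succ', ← mul_assoc, h1]
    simp only [map_add, PowerSeries.derivative_one, Derivation.leibniz, PowerSeries.derivative_C,
      PowerSeries.derivative_X, map_mul, map_natCast, smul_eq_mul, nsmul_eq_mul,
      Nat.add_sub_cancel]
    ring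

/-- On the line through `w`, with `h = 1 / √d` and `u_j = linForm w j`, the generating function is
`∏ (1 + h u_j t)^(m_j)`. Its logarithmic derivative has the coefficients `∑ m_j h u_j (-h u_j)^i`.
As `m_j h² → 1 / q`, those of order `0` and `1` tend to `linCoeff` and `2 sqCoeff`, and the higher
ones vanish. -/
lemma tendsto_krawtchouk {m : ℕ → ZMod q → ℕ} (hm : ∀ d, ∑ j, m d j = d)
    {mp : NZ q → ℝ} (hlim : Tendsto (fun d => scaledPoint d (m d)) atTop (𝓝 mp)) (l : NZ q →₀ ℕ) :
    Tendsto (fun d : ℕ => krawtchouk l (m d) * (((Real.sqrt d)⁻¹ : ℝ) : ℂ) ^ (∑ k, l k)) atTop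
      (𝓝 (limitPoly l mp)) := by
  have hq : (q : ℝ) ≠ 0 := Nat.cast_ne_zero.2 (NeZero.ne q)
  have hx (j : ZMod q) : Tendsto (fun d => scaledFull d (m d) j) atTop (𝓝 (full mp j)) := by
    simp_rw [← fun d => full_scaledPoint (hm d)]
    exact ((continuous_full j).tendsto mp).comp hlim
  have hmd (j : ZMod q) : Tendsto (fun d : ℕ => (m d j : ℝ) * (Real.sqrt d)⁻¹ ^ 2) atTop
      (𝓝 (q : ℝ)⁻¹) := by
    have h1 : Tendsto (fun d : ℕ => (q : ℝ)⁻¹ + scaledFull d (m d) j * (Real.sqrt d)⁻¹) atTop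
        (𝓝 (q : ℝ)⁻¹) := by
      simpa using ((hx j).mul tendsto_inv_sqrt_natCast).const_add (q : ℝ)⁻¹
    refine h1.congr' ?_
    filter_upwards [eventually_gt_atTop 0] with d hd
    have hd0' : (0 : ℝ) < d := Nat.cast_pos.2 hd
    have hs : 0 < Real.sqrt d := Real.sqrt_pos.2 hd0'
    have hsq : Real.sqrt d ^ 2 = (d : ℝ) := Real.sq_sqrt hd0'.le
    rw [scaledFull]
    field_simp
    rw [hsq]
    ring
  refine tendsto_coeff_of_tendsto_eval (T := ofDegree (NZ q) (∑ k, l k))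
    (c := fun d l' => krawtchouk l' (m d) * (((Real.sqrt d)⁻¹ : ℝ) : ℂ) ^ (∑ k, l k))
    (c0 := fun l' => limitPoly l' mp) (fun w => ?_) (mem_ofDegree.2 rfl)
  rw [sum_limitPoly]
  simp_rw [sum_krawtchouk]
  refine tendsto_coeff_of_logDeriv
    (A := fun d => ∑ j, PowerSeries.mk fun i => (m d j : ℂ)
      * ((((Real.sqrt d)⁻¹ : ℝ) : ℂ) * linForm w j)
      * (-((((Real.sqrt d)⁻¹ : ℝ) : ℂ) * linForm w j)) ^ i) (fun d => ?_) (fun d => ?_)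
    (fun i => ?_) _
  · simp
  · exact derivation_prod_of_eq_mul _ _ _ fun j _ => derivative_one_add_pow _ _
  · simp only [map_sum, PowerSeries.coeff_mk]
    have hinv : Tendsto (fun d : ℕ => (((Real.sqrt d)⁻¹ : ℝ) : ℂ)) atTop (𝓝 0) := by
      rw [← Complex.ofReal_zero]
      exact (Complex.continuous_ofReal.tendsto 0).comp tendsto_inv_sqrt_natCast
    have hmdc (j : ZMod q) : Tendsto (fun d : ℕ => (m d j : ℂ) * (((Real.sqrt d)⁻¹ : ℝ) : ℂ) ^ 2)
        atTop (𝓝 (q : ℂ)⁻¹) := by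
      have := (Complex.continuous_ofReal.tendsto _).comp (hmd j)
      simp only [Function.comp_def, Complex.ofReal_mul, Complex.ofReal_pow,
        Complex.ofReal_natCast, Complex.ofReal_inv (q : ℝ)] at this
      exact this
    rcases i with _ | i
    · have h1 (d : ℕ) : ∑ j, (m d j : ℂ) * ((((Real.sqrt d)⁻¹ : ℝ) : ℂ) * linForm w j)
          * (-((((Real.sqrt d)⁻¹ : ℝ) : ℂ) * linForm w j)) ^ 0
          = ∑ j, (scaledFull d (m d) j : ℂ) * linForm w j := by
        -- The mean `d / q` of the counts, which would diverge like `√d`, drops out because the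
        -- linear forms sum to zero over `j`.
        have h2 : ∑ j, (((d : ℝ) / q * (Real.sqrt d)⁻¹ : ℝ) : ℂ) * linForm w j = 0 := by
          rw [← Finset.mul_sum, sum_linForm, mul_zero]
        rw [← sub_zero (∑ j, (m d j : ℂ) * _ * _), ← h2, ← Finset.sum_sub_distrib]
        refine Finset.sum_congr rfl fun j _ => ?_
        rw [scaledFull]
        push_cast
        ring
      simp_rw [h1]
      have h3 : PowerSeries.coeff 0 (PowerSeries.C (linCoeff w mp)
          + PowerSeries.C (2 * sqCoeff w) * PowerSeries.X) = linCoeff w mp := by simp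
      rw [h3]
      exact tendsto_finsetSum _ fun j _ =>
        ((Complex.continuous_ofReal.tendsto _).comp (hx j)).mul_const _
    · have h1 (d : ℕ) (j : ZMod q) : (m d j : ℂ) * ((((Real.sqrt d)⁻¹ : ℝ) : ℂ) * linForm w j)
          * (-((((Real.sqrt d)⁻¹ : ℝ) : ℂ) * linForm w j)) ^ (i + 1)
          = ((m d j : ℂ) * (((Real.sqrt d)⁻¹ : ℝ) : ℂ) ^ 2)
            * ((((Real.sqrt d)⁻¹ : ℝ) : ℂ) ^ i * (-1) ^ (i + 1) * linForm w j ^ (i + 2)) := by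
        rw [neg_pow, mul_pow]; ring
      simp_rw [h1]
      have h2 : PowerSeries.coeff (i + 1) (PowerSeries.C (linCoeff w mp)
          + PowerSeries.C (2 * sqCoeff w) * PowerSeries.X)
          = ∑ j, (q : ℂ)⁻¹ * (0 ^ i * (-1) ^ (i + 1) * linForm w j ^ (i + 2)) := by
        have hq' : (q : ℂ) ≠ 0 := Nat.cast_ne_zero.2 (NeZero.ne q)
        rw [map_add, PowerSeries.coeff_succ_mul_X, PowerSeries.coeff_C, PowerSeries.coeff_C,
          if_neg (Nat.succ_ne_zero i), zero_add]
        rcases i with _ | i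
        · simp only [if_true, sqCoeff, Finset.mul_sum]
          refine Finset.sum_congr rfl fun j _ => ?_
          field_simp
          ring
        · simp
      rw [h2]
      exact tendsto_finsetSum _ fun j _ => (hmdc j).mul (((hinv.pow i).mul_const _).mul_const _)

end KrawtchoukLimit

/-! ### Convergence of the individual terms -/

section TermLimit

variable {q : ℕ} [NeZero q]

lemma norm_kappa_le {d : ℕ} (ν : PMF (Fin d → ZMod q)) (l : NZ q →₀ ℕ) : ‖kappa ν l‖ ≤ 1 := by
  rw [kappa, norm_div, Complex.norm_natCast]
  refine div_le_one_of_le₀ ?_ (Nat.cast_nonneg _)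
  refine (norm_sum_le _ _).trans ?_
  simpa using Finset.sum_le_card_nsmul (indexGroup d l) _ 1 fun r _ => norm_rho_le ν r

/-- Already the real part is at least one, since `Re κ ≤ ‖κ‖ ≤ 1`. This gives both the bound and the
continuity of the killing factor. -/
lemma one_le_norm_killed_denom {α : ℝ} (hα0 : 0 ≤ α) (hα1 : α < 1) {κ : ℂ} (hκ : ‖κ‖ ≤ 1) :
    1 ≤ ‖1 + ((α / (1 - α) : ℝ) : ℂ) * (1 - κ)‖ := by
  have h1 : 0 ≤ α / (1 - α) := div_nonneg hα0 (by linarith)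
  have h2 : 0 ≤ (1 - κ).re := by
    have := (Complex.re_le_norm κ).trans hκ
    simpa using this
  refine le_trans ?_ (Complex.re_le_norm _)
  rw [Complex.add_re, Complex.re_ofReal_mul, Complex.one_re]
  nlinarith [mul_nonneg h1 h2]

lemma norm_killed_le {α : ℝ} (hα0 : 0 ≤ α) (hα1 : α < 1) {κ : ℂ} (hκ : ‖κ‖ ≤ 1) :
    ‖killed α κ‖ ≤ 1 := by
  rw [killed, norm_div, norm_one]
  exact div_le_one_of_le₀ (one_le_norm_killed_denom hα0 hα1 hκ) (norm_nonneg _)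

lemma tendsto_killed {α : ℝ} (hα0 : 0 ≤ α) (hα1 : α < 1) {κ : ℕ → ℂ} {κ₀ : ℂ}
    (h : Tendsto κ atTop (𝓝 κ₀)) (hκ : ‖κ₀‖ ≤ 1) :
    Tendsto (fun d => killed α (κ d)) atTop (𝓝 (killed α κ₀)) := by
  refine Tendsto.div tendsto_const_nhds (((h.const_sub 1).const_mul _).const_add 1) ?_
  have := one_le_norm_killed_denom hα0 hα1 hκ
  exact norm_pos_iff.1 (by linarith)

lemma killed_one (α : ℝ) : killed α 1 = 1 := by simp [killed]

lemma tendsto_descFactorial_div_pow (s : ℕ) :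
    Tendsto (fun d : ℕ => (d.descFactorial s : ℝ) / (d : ℝ) ^ s) atTop (𝓝 1) := by
  induction s with
  | zero => simp
  | succ s ih =>
    have h1 : Tendsto (fun d : ℕ => 1 - (s : ℝ) / d) atTop (𝓝 1) := by
      simpa using (tendsto_const_div_atTop_nhds_zero_nat (s : ℝ)).const_sub 1
    have h2 := h1.mul ih
    rw [one_mul] at h2
    refine h2.congr' ?_
    filter_upwards [eventually_ge_atTop s, eventually_gt_atTop 0] with d hd hd0
    have : (0 : ℝ) < d := Nat.cast_pos.2 hd0
    rw [Nat.descFactorial_succ, Nat.cast_mul, Nat.cast_sub hd]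
    field_simp
    ring

lemma inv_hConst {d : ℕ} {l : NZ q →₀ ℕ} (h : ∑ k, l k ≤ d) :
    (hConst d l)⁻¹ = (d.descFactorial (∑ k, l k) : ℝ) / ∏ k, ((l k).factorial : ℝ) := by
  have h1 : ((d - ∑ k, l k).factorial : ℝ) * (d.descFactorial (∑ k, l k) : ℝ) = d.factorial := by
    exact_mod_cast Nat.factorial_mul_descFactorial h
  have h2 : ((d - ∑ k, l k).factorial : ℝ) ≠ 0 := by positivity
  rw [hConst, inv_div, ← h1, mul_div_mul_left _ _ h2]

lemma tendsto_inv_hConst (l : NZ q →₀ ℕ) :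
    Tendsto (fun d : ℕ => (hConst d l)⁻¹ / (d : ℝ) ^ (∑ k, l k)) atTop
      (𝓝 (∏ k, ((l k).factorial : ℝ))⁻¹) := by
  have h := (tendsto_descFactorial_div_pow (∑ k, l k)).div_const (∏ k, ((l k).factorial : ℝ))
  rw [one_div] at h
  refine h.congr' ?_
  filter_upwards [eventually_ge_atTop (∑ k, l k)] with d hd
  rw [inv_hConst hd, div_right_comm]

/-- Each term of the Krawtchouk expansion converges. -/
lemma tendsto_term {α : ℝ} (hα0 : 0 ≤ α) (hα1 : α < 1)
    (ν : (d : ℕ) → PMF (Fin d → ZMod q)) {κ : (NZ q →₀ ℕ) → ℂ}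
    (hκ : ∀ l, Tendsto (fun d => kappa (ν d) l) atTop (𝓝 (κ l)))
    {mp np : NZ q → ℝ} {m n : ℕ → ZMod q → ℕ} (hm : ∀ d, ∑ j, m d j = d)
    (hn : ∀ d, ∑ j, n d j = d) (hmp : Tendsto (fun d => scaledPoint d (m d)) atTop (𝓝 mp))
    (hnp : Tendsto (fun d => scaledPoint d (n d)) atTop (𝓝 np)) (l : NZ q →₀ ℕ) :
    Tendsto (fun d => term α (ν d) l (m d) (n d)) atTop (𝓝 (limitTerm α κ l mp np)) := by
  have hκ1 : ‖κ l‖ ≤ 1 := le_of_tendsto (hκ l).norm (.of_forall fun d => norm_kappa_le _ _)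
  have h1 := (Complex.continuous_ofReal.tendsto _).comp
    ((tendsto_multinomialProb hm hmp).mul (tendsto_multinomialProb hn hnp))
  have hf : (∏ k, ((l k).factorial : ℝ))⁻¹ ≠ 0 := by positivity
  have h2 := (Complex.continuous_ofReal.tendsto _).comp ((tendsto_inv_hConst l).inv₀ hf)
  have h3 := tendsto_killed hα0 hα1 (hκ l) hκ1
  have h4 := tendsto_krawtchouk hm hmp l
  have h5 := (Complex.continuous_conj.tendsto _).comp (tendsto_krawtchouk hn hnp l)
  have h6 := h1.mul (((h2.mul h3).mul h4).mul h5)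
  have h7 : limitTerm α κ l mp np = ((phi mp * phi np : ℝ) : ℂ)
      * (((((∏ k, ((l k).factorial : ℝ))⁻¹)⁻¹ : ℝ) : ℂ) * killed α (κ l) * limitPoly l mp
        * (starRingEnd ℂ) (limitPoly l np)) := by
    rw [limitTerm, limitCoeff, inv_inv]
    push_cast
    ring
  rw [h7]
  refine h6.congr' ?_
  filter_upwards [eventually_gt_atTop 0] with d hd
  have hd0 : (0 : ℝ) < d := Nat.cast_pos.2 hd
  have hsq : Real.sqrt d ^ 2 = (d : ℝ) := Real.sq_sqrt hd0.le
  have hs : (Real.sqrt d : ℂ) ≠ 0 := Complex.ofReal_ne_zero.2 (Real.sqrt_pos.2 hd0).ne'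
  have hsqc : (d : ℂ) = (Real.sqrt d : ℂ) ^ 2 := by
    rw [← Complex.ofReal_pow, hsq, Complex.ofReal_natCast]
  have hh : (hConst d l : ℂ) ≠ 0 := Complex.ofReal_ne_zero.2 (hConst_pos d l).ne'
  simp only [Function.comp_apply, term, map_mul, map_pow, Complex.conj_ofReal]
  push_cast
  have e1 (N : ℕ) : (d : ℂ) ^ N = ((Real.sqrt d : ℂ) ^ N) ^ 2 := by
    rw [hsqc, ← pow_mul, ← pow_mul, mul_comm]
  have hN := pow_ne_zero (∑ k, l k) hs
  rw [e1, e1, inv_pow]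
  generalize (Real.sqrt d : ℂ) ^ (∑ k, l k) = S at *
  generalize (Real.sqrt d : ℂ) ^ (q - 1) = A
  generalize (hConst d l : ℂ) = H at *
  rw [inv_div, div_inv_eq_mul]
  -- The powers of `d` balance: with `S = √d^|l|`, the factor `h_l` is scaled by `S²` and each of
  -- the two Krawtchouk polynomials by `S⁻¹`.
  have : S ^ 2 * S⁻¹ * S⁻¹ = 1 := by field_simp
  linear_combination (A * multinomialProb d (m d) * (A * multinomialProb d (n d)) * H
    * killed α (kappa (ν d) l) * krawtchouk l (m d) * (starRingEnd ℂ) (krawtchouk l (n d))) * this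

end TermLimit

/-! ### The multivariate exponential series -/

section MultiExponential

variable {ι : Type*} [Fintype ι] [DecidableEq ι]

/-- The term `∏_k x_k ^ l_k / l_k!` of the multivariate exponential series. -/
def expTerm (x : ι → ℂ) (l : ι →₀ ℕ) : ℂ := ∏ k, x k ^ l k / ((l k).factorial : ℂ)

lemma sum_piFinset_expTerm (x : ι → ℂ) (n : ℕ) :
    ∑ f ∈ Fintype.piFinset fun _ : ι => Finset.range n, ∏ k, x k ^ f k / ((f k).factorial : ℂ)
      = ∏ k, ∑ i ∈ Finset.range n, x k ^ i / (i.factorial : ℂ) := by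
  rw [Finset.prod_univ_sum]

omit [DecidableEq ι] in
lemma norm_expTerm (x : ι → ℂ) (l : ι →₀ ℕ) :
    ‖expTerm x l‖ = ∏ k, ‖x k‖ ^ l k / ((l k).factorial : ℝ) := by
  simp [expTerm]

/-- Every finite set of indices lies in a cube, and over a cube the sum factors into partial sums of
one-variable exponential series. -/
lemma summable_pi_pow_div (x : ι → ℝ) (hx : ∀ k, 0 ≤ x k) :
    Summable fun f : ι → ℕ => ∏ k, x k ^ f k / ((f k).factorial : ℝ) := by
  refine summable_of_sum_le (c := ∏ k, Real.exp (x k))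
    (fun f => Finset.prod_nonneg fun k _ => div_nonneg (pow_nonneg (hx k) _) (by positivity))
    fun s => ?_
  obtain ⟨n, hn⟩ : ∃ n, ∀ f ∈ s, ∀ k, f k < n := by
    refine ⟨(s.sup fun f => ∑ k, f k) + 1, fun f hf k => Nat.lt_succ_of_le ?_⟩
    exact (Finset.single_le_sum (f := f) (fun _ _ => Nat.zero_le _) (Finset.mem_univ k)).trans
      (Finset.le_sup (f := fun f : ι → ℕ => ∑ k, f k) hf)
  calc ∑ f ∈ s, ∏ k, x k ^ f k / ((f k).factorial : ℝ)
      ≤ ∑ f ∈ Fintype.piFinset fun _ : ι => Finset.range n,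
          ∏ k, x k ^ f k / ((f k).factorial : ℝ) := by
        refine Finset.sum_le_sum_of_subset_of_nonneg (fun f hf => ?_) fun f _ _ =>
          Finset.prod_nonneg fun k _ => div_nonneg (pow_nonneg (hx k) _) (by positivity)
        simpa using hn f hf
    _ = ∏ k, ∑ i ∈ Finset.range n, x k ^ i / (i.factorial : ℝ) := by
        rw [Finset.prod_univ_sum]
    _ ≤ ∏ k, Real.exp (x k) := by
        refine Finset.prod_le_prod (fun k _ => Finset.sum_nonneg fun i _ =>
          div_nonneg (pow_nonneg (hx k) _) (by positivity)) fun k _ => ?_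
        exact Real.sum_le_exp_of_nonneg (hx k) n

lemma summable_norm_expTerm (x : ι → ℂ) : Summable fun l : ι →₀ ℕ => ‖expTerm x l‖ := by
  simp_rw [norm_expTerm]
  have h := summable_pi_pow_div (fun k => ‖x k‖) fun k => norm_nonneg _
  rw [← (Finsupp.equivFunOnFinite (α := ι) (M := ℕ)).summable_iff] at h
  refine h.congr fun l => ?_
  simp only [Function.comp_apply, Finsupp.equivFunOnFinite_apply]

/-- The multivariate exponential series. -/
lemma hasSum_expTerm (x : ι → ℂ) : HasSum (expTerm x) (Complex.exp (∑ k, x k)) := by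
  have h1 : Summable fun f : ι → ℕ => ∏ k, x k ^ f k / ((f k).factorial : ℂ) := by
    refine Summable.of_norm ?_
    have := summable_pi_pow_div (fun k => ‖x k‖) fun k => norm_nonneg _
    simpa using this
  -- The cubes exhaust the index set, so the unconditional sum can be computed along them.
  have h2 : Tendsto (fun n : ℕ => Fintype.piFinset fun _ : ι => Finset.range n) atTop atTop := by
    refine tendsto_atTop_finset_of_monotone
      (fun a b h => Fintype.piFinset_subset _ _ fun _ => Finset.range_mono h) fun f => ?_
    refine ⟨(∑ k, f k) + 1, ?_⟩
    simp only [Fintype.mem_piFinset, Finset.mem_range]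
    exact fun k => Nat.lt_succ_of_le
      (Finset.single_le_sum (f := f) (fun _ _ => Nat.zero_le _) (Finset.mem_univ k))
  have h3 := h1.hasSum.comp h2
  have h4 : Tendsto (fun n : ℕ => ∏ k, ∑ i ∈ Finset.range n, x k ^ i / (i.factorial : ℂ)) atTop
      (𝓝 (∏ k, Complex.exp (x k))) := by
    refine tendsto_finsetProd _ fun k _ => ?_
    have := (NormedSpace.expSeries_div_hasSum_exp (𝔸 := ℂ) (x k)).tendsto_sum_nat
    rwa [← Complex.exp_eq_exp_ℂ] at this
  have h5 := tendsto_nhds_unique h3 (h4.congr fun n => (sum_piFinset_expTerm x n).symm)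
  rw [Complex.exp_sum, ← h5]
  have h6 := h1.hasSum
  rw [← (Finsupp.equivFunOnFinite (α := ι) (M := ℕ)).hasSum_iff] at h6
  refine h6.congr_fun fun l => ?_
  simp only [Function.comp_apply, Finsupp.equivFunOnFinite_apply, expTerm]

end MultiExponential

/-! ### Fourier transform of the scaled Green function at finite `d` -/

section Transform

variable {q : ℕ} [NeZero q]

lemma mem_countVectors {d : ℕ} {m : ZMod q → ℕ} : m ∈ countVectors q d ↔ ∑ j, m j = d := by
  simp [countVectors]

/-- The Fourier coefficients `(1/q) ∑_j c_j θ_k^j`. -/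
def fourierCoeff (c : ZMod q → ℂ) (k : ZMod q) : ℂ := (q : ℂ)⁻¹ * ∑ j, c j * theta k j

/-- The transform of a product function with respect to the Krawtchouk polynomials. -/
lemma sum_multinomialProb_mul_krawtchouk (c : ZMod q → ℂ) {d : ℕ} {l : NZ q →₀ ℕ}
    (hl : ∑ k, l k ≤ d) :
    ∑ m ∈ countVectors q d, (multinomialProb d m : ℂ) * (∏ j, c j ^ m j) * krawtchouk l m
      = ((hConst d l)⁻¹ : ℝ) * (fourierCoeff c 0 ^ (d - ∑ k, l k)
        * ∏ k : NZ q, fourierCoeff c k.1 ^ l k) := by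
  classical
  have hq : (q : ℂ) ≠ 0 := Nat.cast_ne_zero.2 (NeZero.ne q)
  have h1 (j : ZMod q) : (1 + ∑ k : NZ q, MvPolynomial.C (theta k.1 j) * MvPolynomial.X k)
      = ∑ k : ZMod q, MvPolynomial.C (theta k j) * dehom q k := by
    rw [sum_zmod, dehom_zero]
    simp [dehom_coe]
  -- The generating function in `w` of the transforms is the `d`-th power of one linear form, up to
  -- the factor `q^(-d)`. Its coefficients are, up to `q`, the Fourier coefficients of `c`.
  have h2 : ∑ j, MvPolynomial.C (c j)
        * (1 + ∑ k : NZ q, MvPolynomial.C (theta k.1 j) * MvPolynomial.X k)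
      = ∑ k : ZMod q, MvPolynomial.C ((q : ℂ) * fourierCoeff c k) * dehom q k := by
    simp_rw [h1, Finset.mul_sum]
    rw [Finset.sum_comm]
    refine Finset.sum_congr rfl fun k _ => ?_
    rw [fourierCoeff, mul_inv_cancel_left₀ hq, map_sum, Finset.sum_mul]
    exact Finset.sum_congr rfl fun j _ => by rw [map_mul]; ring
  have h3 := Finset.sum_pow_eq_sum_piAntidiag Finset.univ (fun j => MvPolynomial.C (c j)
        * (1 + ∑ k : NZ q, MvPolynomial.C (theta k.1 j) * MvPolynomial.X k)) d
  rw [h2, Finset.sum_pow_eq_sum_piAntidiag] at h3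
  have h4 := congrArg (MvPolynomial.coeff l) h3
  have key (f : ZMod q → ℕ) : (∏ k, dehom q k ^ f k)
      = MvPolynomial.monomial (Finsupp.equivFunOnFinite.symm fun k : NZ q => f k.1) 1 := by
    rw [prod_zmod, dehom_zero, one_pow, one_mul, MvPolynomial.monomial_eq]
    simp [dehom_coe, Finsupp.prod_fintype]
  simp only [mul_pow, Finset.prod_mul_distrib, ← map_pow, ← map_prod, ← mul_assoc, key,
    MvPolynomial.coeff_sum, MvPolynomial.coeff_monomial,
    ← map_mul, ← map_natCast (MvPolynomial.C (σ := NZ q) (R := ℂ)),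
    MvPolynomial.coeff_C_mul] at h4
  -- A monomial in the nonzero types leaves the exponent of the type `0` undetermined, but the total
  -- degree `d` fixes it.
  rw [Finset.sum_eq_single_of_mem (extend d l) (by simp [sum_extend hl]) (by
    intro f hf hne
    rw [if_neg, mul_zero]
    intro h
    refine hne (funext fun j => ?_)
    have hk (k : NZ q) : f k.1 = l k := by rw [← h]; simp
    by_cases hj : j = 0
    · subst hj
      have hs := (Finset.mem_piAntidiag.1 hf).1
      rw [sum_zmod] at hs
      simp_rw [hk] at hs
      rw [extend_zero]
      omega
    · have := hk ⟨j, hj⟩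
      simpa [extend, hj] using this)] at h4
  have h5 : (Finsupp.equivFunOnFinite.symm fun k : NZ q => extend d l k.1) = l := by
    ext k; simp [extend_coe]
  rw [h5, if_pos rfl, mul_one, prod_zmod, prod_zmod, extend_zero] at h4
  simp_rw [extend_coe] at h4
  have h6 : (Nat.multinomial Finset.univ (extend d l) : ℂ) = ((hConst d l)⁻¹ : ℝ) := by
    exact_mod_cast congrArg ((↑) : ℝ → ℂ) (multinomial_extend hl)
  rw [h6, Finset.prod_pow_eq_pow_sum, ← pow_add, Nat.sub_add_cancel hl] at h4
  have h7 : ∑ m ∈ countVectors q d, (multinomialProb d m : ℂ) * (∏ j, c j ^ m j) * krawtchouk l m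
      = ((q : ℂ) ^ d)⁻¹ * ∑ m ∈ Finset.piAntidiag Finset.univ d,
        (Nat.multinomial Finset.univ m : ℂ) * (∏ j, c j ^ m j) * krawtchouk l m := by
    rw [countVectors, Finset.mul_sum]
    refine Finset.sum_congr rfl fun m _ => ?_
    rw [multinomialProb]
    push_cast
    ring
  have h8 := pow_ne_zero d hq
  rw [h7]
  simp only [krawtchouk]
  rw [← h4]
  field_simp

/-- The vector `(0, a)`, centred. -/
def centred (a : NZ q → ℝ) (j : ZMod q) : ℝ :=
  (if h : j ≠ 0 then a ⟨j, h⟩ else 0) - (∑ k, a k) / q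

lemma sum_centred (a : NZ q → ℝ) : ∑ j, centred a j = 0 := by
  have hq : (q : ℝ) ≠ 0 := Nat.cast_ne_zero.2 (NeZero.ne q)
  simp only [centred, Finset.sum_sub_distrib]
  rw [sum_zmod]
  have (k : NZ q) : (if h : k.1 ≠ 0 then a ⟨k.1, h⟩ else 0) = a k := by simp [k.2]
  simp only [this]
  simp [ZMod.card]
  field_simp
  simp

lemma centred_neg (a : NZ q → ℝ) (j : ZMod q) : centred (-a) j = - centred a j := by
  simp only [centred, Pi.neg_apply, Finset.sum_neg_distrib]
  split_ifs <;> ring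

lemma centred_zero (j : ZMod q) : centred (0 : NZ q → ℝ) j = 0 := by simp [centred]

lemma continuous_centred (j : ZMod q) : Continuous fun a : NZ q → ℝ => centred a j := by
  unfold centred
  split_ifs <;> fun_prop

/-- The trigonometric function `x ↦ exp (i a · x)`. -/
def trig {ι : Type*} [Fintype ι] (a x : ι → ℝ) : ℂ := Complex.exp ((∑ k, a k * x k : ℝ) * Complex.I)

/-- Since the counts sum to `d`, the shift by `d / q` is absorbed by centring `a`. The result is a
product of powers over the types, as the Krawtchouk transform requires. -/
lemma trig_scaledPoint (a : NZ q → ℝ) {d : ℕ} {m : ZMod q → ℕ} (hm : ∑ j, m j = d) :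
    trig a (scaledPoint d m)
      = ∏ j, Complex.exp ((centred a j / Real.sqrt d : ℝ) * Complex.I) ^ m j := by
  have h1 : (∑ k, a k * scaledPoint d m k : ℝ) = ∑ j, m j * (centred a j / Real.sqrt d) := by
    have hm' : ∑ j, (m j : ℝ) = d := by exact_mod_cast hm
    have h2 : ∑ j, (m j : ℝ) * (centred a j / Real.sqrt d)
        = (∑ k : NZ q, (m k.1 : ℝ) * a k - d * ((∑ k, a k) / q)) / Real.sqrt d := by
      simp_rw [mul_div_assoc', ← Finset.sum_div, centred, mul_sub, Finset.sum_sub_distrib,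
        ← Finset.sum_mul, hm']
      congr 2
      · rw [sum_zmod]
        simp only [ne_eq, not_true_eq_false, dite_false, mul_zero, zero_add]
        exact Finset.sum_congr rfl fun k _ => by simp [k.2]
      · rw [mul_div_assoc]
    rw [h2]
    simp only [scaledPoint, mul_div_assoc', ← Finset.sum_div, mul_sub, Finset.sum_sub_distrib]
    congr 2
    · exact Finset.sum_congr rfl fun k _ => mul_comm _ _
    · rw [← Finset.sum_mul, mul_comm]
  rw [trig, h1]
  simp_rw [← Complex.exp_nat_mul]
  rw [← Complex.exp_sum]
  congr 1
  push_cast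
  rw [Finset.sum_mul]
  exact Finset.sum_congr rfl fun j _ => by ring

/-- The Fourier coefficients of the factors of `trig a (scaledPoint d m)`. -/
def stepCoeff (d : ℕ) (a : NZ q → ℝ) (k : ZMod q) : ℂ :=
  fourierCoeff (fun j => Complex.exp ((centred a j / Real.sqrt d : ℝ) * Complex.I)) k

lemma sum_trig_mul_krawtchouk (a : NZ q → ℝ) {d : ℕ} {l : NZ q →₀ ℕ} (hl : ∑ k, l k ≤ d) :
    ∑ m ∈ countVectors q d,
        (multinomialProb d m : ℂ) * trig a (scaledPoint d m) * krawtchouk l m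
      = ((hConst d l)⁻¹ : ℝ) * (stepCoeff d a 0 ^ (d - ∑ k, l k)
        * ∏ k : NZ q, stepCoeff d a k.1 ^ l k) := by
  simp only [stepCoeff]
  rw [← sum_multinomialProb_mul_krawtchouk _ hl]
  exact Finset.sum_congr rfl fun m hm => by rw [trig_scaledPoint a (mem_countVectors.1 hm)]

lemma conj_trig {ι : Type*} [Fintype ι] (a x : ι → ℝ) :
    (starRingEnd ℂ) (trig a x) = trig (-a) x := by
  rw [trig, trig, ← Complex.exp_conj]
  congr 1
  simp

lemma sum_trig_mul_conj_krawtchouk (a : NZ q → ℝ) {d : ℕ} {l : NZ q →₀ ℕ} (hl : ∑ k, l k ≤ d) :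
    ∑ m ∈ countVectors q d,
        (multinomialProb d m : ℂ) * trig a (scaledPoint d m) * (starRingEnd ℂ) (krawtchouk l m)
      = ((hConst d l)⁻¹ : ℝ) * (starRingEnd ℂ) (stepCoeff d (-a) 0 ^ (d - ∑ k, l k)
        * ∏ k : NZ q, stepCoeff d (-a) k.1 ^ l k) := by
  have h := congrArg (starRingEnd ℂ) (sum_trig_mul_krawtchouk (-a) hl)
  rw [map_sum, map_mul _ (((hConst d l)⁻¹ : ℝ) : ℂ), Complex.conj_ofReal] at h
  rw [← h]
  refine Finset.sum_congr rfl fun m _ => ?_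
  rw [map_mul, map_mul, conj_trig, neg_neg, Complex.conj_ofReal]

/-- The weights of the law of the pair of grouped positions. -/
def pairWeight {d : ℕ} (α : ℝ) (ν : PMF (Fin d → ZMod q)) (m n : ZMod q → ℕ) : ℝ :=
  ((d : ℝ) ^ (q - 1))⁻¹ * scaledGreen α ν m n

/-- The terms of the transform of the pair weights. -/
def transformTerm {d : ℕ} (α : ℝ) (ν : PMF (Fin d → ZMod q)) (a b : NZ q → ℝ)
    (l : NZ q →₀ ℕ) : ℂ :=
  killed α (kappa ν l) * (((hConst d l)⁻¹ : ℝ) * ((stepCoeff d a 0 ^ (d - ∑ k, l k)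
        * ∏ k : NZ q, stepCoeff d a k.1 ^ l k) * (starRingEnd ℂ)
      (stepCoeff d (-b) 0 ^ (d - ∑ k, l k) * ∏ k : NZ q, stepCoeff d (-b) k.1 ^ l k)))

/-- Each term of the expansion separates in `m` and `n`. The two transforms bring `h_l⁻¹` each,
against one factor `h_l` of the term. -/
lemma sum_pairWeight_trig {α : ℝ} (hα0 : 0 ≤ α) (hα1 : α < 1) {d : ℕ} (hd : d ≠ 0)
    {ν : PMF (Fin d → ZMod q)} (hν : Exchangeable ν) (a b : NZ q → ℝ) :
    ∑ m ∈ countVectors q d, ∑ n ∈ countVectors q d, (pairWeight α ν m n : ℂ)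
        * (trig a (scaledPoint d m) * trig b (scaledPoint d n))
      = ∑ l ∈ indices q d, transformTerm α ν a b l := by
  have hd0 : ((d : ℂ) ^ (q - 1)) ≠ 0 := pow_ne_zero _ (Nat.cast_ne_zero.2 hd)
  have h1 (m) (hm : m ∈ countVectors q d) (n) (hn : n ∈ countVectors q d) :
      (pairWeight α ν m n : ℂ) * (trig a (scaledPoint d m) * trig b (scaledPoint d n))
      = ∑ l ∈ indices q d, (killed α (kappa ν l) * (hConst d l : ℂ))
        * (((multinomialProb d m : ℂ) * trig a (scaledPoint d m) * krawtchouk l m)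
        * ((multinomialProb d n : ℂ) * trig b (scaledPoint d n)
          * (starRingEnd ℂ) (krawtchouk l n))) := by
    rw [pairWeight, Complex.ofReal_mul, scaledGreen_eq hα0 hα1 hν (mem_countVectors.1 hm)
      (mem_countVectors.1 hn), Finset.mul_sum, Finset.sum_mul]
    refine Finset.sum_congr rfl fun l _ => ?_
    rw [term]
    push_cast
    field_simp
  rw [Finset.sum_congr rfl fun m hm => Finset.sum_congr rfl fun n hn => h1 m hm n hn]
  simp_rw [Finset.sum_comm (s := countVectors q d) (t := indices q d)]
  refine Finset.sum_congr rfl fun l hl => ?_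
  simp_rw [← Finset.mul_sum]
  rw [← Finset.sum_mul, sum_trig_mul_krawtchouk a (mem_indices.1 hl),
    sum_trig_mul_conj_krawtchouk b (mem_indices.1 hl), transformTerm]
  have h3 : (hConst d l : ℂ) ≠ 0 := Complex.ofReal_ne_zero.2 (hConst_pos d l).ne'
  push_cast
  field_simp

lemma scaledGreen_nonneg {α : ℝ} (hα0 : 0 ≤ α) (hα1 : α < 1) {d : ℕ}
    (ν : PMF (Fin d → ZMod q)) (m n : ZMod q → ℕ) : 0 ≤ scaledGreen α ν m n := by
  have h1 : 0 ≤ groupedGreen α ν m n :=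
    div_nonneg (Finset.sum_nonneg fun x _ => Finset.sum_nonneg fun y _ => green_nonneg hα0 ν x y)
      (by positivity)
  have h2 : 0 ≤ 1 - α := by linarith
  unfold scaledGreen
  positivity

lemma pairWeight_nonneg {α : ℝ} (hα0 : 0 ≤ α) (hα1 : α < 1) {d : ℕ}
    (ν : PMF (Fin d → ZMod q)) (m n : ZMod q → ℕ) : 0 ≤ pairWeight α ν m n :=
  mul_nonneg (by positivity) (scaledGreen_nonneg hα0 hα1 ν m n)

lemma kappa_zero {d : ℕ} (ν : PMF (Fin d → ZMod q)) : kappa ν 0 = 1 := by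
  have h1 (r) (hr : r ∈ indexGroup d (0 : NZ q →₀ ℕ)) : rho ν r = 1 := by
    simp only [indexGroup, Finset.mem_filter, Finset.mem_univ, true_and, Finsupp.coe_zero,
      Pi.zero_apply, count, Finset.card_eq_zero, Finset.filter_eq_empty_iff] at hr
    have h2 (i : Fin d) : r i = 0 := by
      by_contra h
      exact hr ⟨r i, h⟩ trivial rfl
    simp only [rho, h2, theta_zero_left, Finset.prod_const_one, mul_one]
    exact_mod_cast congrArg ((↑) : ℝ → ℂ) (sum_toReal ν)
  have h3 : ((indexGroup d (0 : NZ q →₀ ℕ)).card : ℝ) = (hConst d (0 : NZ q →₀ ℕ))⁻¹ :=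
    card_indexGroup (by simp)
  have h4 : ((indexGroup d (0 : NZ q →₀ ℕ)).card : ℂ) ≠ 0 := by
    have : ((indexGroup d (0 : NZ q →₀ ℕ)).card : ℝ) ≠ 0 := by
      rw [h3]; exact inv_ne_zero (hConst_pos _ _).ne'
    exact_mod_cast this
  rw [kappa, Finset.sum_congr rfl h1, Finset.sum_const, nsmul_eq_mul, mul_one, div_self h4]

lemma hConst_zero (d : ℕ) : hConst d (0 : NZ q →₀ ℕ) = 1 := by
  have : (d.factorial : ℝ) ≠ 0 := by positivity
  simp [hConst, this]

lemma stepCoeff_zero (d : ℕ) (k : ZMod q) :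
    stepCoeff d (0 : NZ q → ℝ) k = if k = 0 then 1 else 0 := by
  have hq : (q : ℂ) ≠ 0 := Nat.cast_ne_zero.2 (NeZero.ne q)
  simp only [stepCoeff, fourierCoeff, centred_zero, zero_div, Complex.ofReal_zero, zero_mul,
    Complex.exp_zero, one_mul, sum_theta]
  split_ifs <;> simp [hq]

/-- The mass is the transform at zero, where the nontrivial Fourier coefficients vanish and only `l
= 0` survives. -/
lemma sum_pairWeight {α : ℝ} (hα0 : 0 ≤ α) (hα1 : α < 1) {d : ℕ} (hd : d ≠ 0)
    {ν : PMF (Fin d → ZMod q)} (hν : Exchangeable ν) :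
    ∑ m ∈ countVectors q d, ∑ n ∈ countVectors q d, pairWeight α ν m n = 1 := by
  have h := sum_pairWeight_trig hα0 hα1 hd hν 0 0
  have ht (x : NZ q → ℝ) : trig 0 x = 1 := by simp [trig]
  simp only [ht, mul_one] at h
  rw [Finset.sum_eq_single_of_mem 0 (mem_indices.2 (by simp))] at h
  · have h2 : transformTerm α ν (0 : NZ q → ℝ) 0 0 = 1 := by
      simp [transformTerm, kappa_zero, killed_one, hConst_zero, stepCoeff_zero]
    rw [h2] at h
    exact_mod_cast h
  · intro l _ hl
    obtain ⟨k, hk⟩ := Finsupp.ne_iff.1 hl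
    have : ∏ k : NZ q, stepCoeff d (0 : NZ q → ℝ) k.1 ^ l k = 0 := by
      refine Finset.prod_eq_zero (Finset.mem_univ k) ?_
      rw [stepCoeff_zero, if_neg k.2, zero_pow hk]
    rw [transformTerm, this]
    simp

end Transform

/-! ### Limit of the Fourier transforms -/

section TransformLimit

variable {q : ℕ} [NeZero q]

/-- The variance of `a · 𝔐₊` under the limit normal law. -/
def trigVar (a : NZ q → ℝ) : ℝ := (q : ℝ)⁻¹ * ∑ j, centred a j ^ 2

/-- The Fourier coefficients of the centred vector. -/
def centredCoeff (a : NZ q → ℝ) (k : ZMod q) : ℂ := fourierCoeff (fun j => (centred a j : ℂ)) k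

/-- A bound for the Fourier coefficients. -/
def centredBound (a : NZ q → ℝ) : ℝ := (q : ℝ)⁻¹ * ∑ j, |centred a j|

lemma centredBound_nonneg (a : NZ q → ℝ) : 0 ≤ centredBound a := by
  unfold centredBound; positivity

lemma trigVar_neg (a : NZ q → ℝ) : trigVar (-a) = trigVar a := by
  simp [trigVar, centred_neg]

lemma centredCoeff_neg (a : NZ q → ℝ) (k : ZMod q) : centredCoeff (-a) k = - centredCoeff a k := by
  simp [centredCoeff, fourierCoeff, centred_neg]

lemma norm_stepCoeff_le_one (d : ℕ) (a : NZ q → ℝ) (k : ZMod q) : ‖stepCoeff d a k‖ ≤ 1 := by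
  have hq : (q : ℝ) ≠ 0 := Nat.cast_ne_zero.2 (NeZero.ne q)
  rw [stepCoeff, fourierCoeff, norm_mul, norm_inv, Complex.norm_natCast]
  have h : ‖∑ j, Complex.exp ((centred a j / Real.sqrt d : ℝ) * Complex.I) * theta k j‖ ≤ q := by
    refine (norm_sum_le _ _).trans ?_
    simp [norm_theta, Complex.norm_exp_ofReal_mul_I, ZMod.card, -Complex.ofReal_div]
  calc (q : ℝ)⁻¹ * _ ≤ (q : ℝ)⁻¹ * q := by gcongr
    _ = 1 := inv_mul_cancel₀ hq

/-- A nontrivial character sums to zero, so `1` may be subtracted from the exponential. Hence these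
coefficients are of order `1 / √d`. -/
lemma stepCoeff_eq_sub (d : ℕ) (a : NZ q → ℝ) (k : NZ q) : stepCoeff d a k.1
    = (q : ℂ)⁻¹ * ∑ j,
      (Complex.exp ((centred a j / Real.sqrt d : ℝ) * Complex.I) - 1) * theta k.1 j := by
  simp only [sub_mul, one_mul, Finset.sum_sub_distrib, sum_theta, if_neg k.2, sub_zero]
  rfl

lemma norm_sqrt_mul_stepCoeff_le (d : ℕ) (a : NZ q → ℝ) (k : NZ q) :
    ‖(Real.sqrt d : ℂ) * stepCoeff d a k.1‖ ≤ centredBound a := by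
  rw [norm_mul, Complex.norm_real, Real.norm_of_nonneg (Real.sqrt_nonneg _)]
  rcases Nat.eq_zero_or_pos d with rfl | hd
  · simpa using centredBound_nonneg a
  have hs : 0 < Real.sqrt d := Real.sqrt_pos.2 (Nat.cast_pos.2 hd)
  rw [stepCoeff_eq_sub, norm_mul, norm_inv, Complex.norm_natCast, centredBound, mul_left_comm]
  refine mul_le_mul_of_nonneg_left ?_ (by positivity)
  have h : ‖∑ j, (Complex.exp ((centred a j / Real.sqrt d : ℝ) * Complex.I) - 1) * theta k.1 j‖
      ≤ ∑ j, |centred a j| / Real.sqrt d := by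
    refine (norm_sum_le _ _).trans (Finset.sum_le_sum fun j _ => ?_)
    rw [norm_mul, norm_theta, mul_one, mul_comm]
    refine (Real.norm_exp_I_mul_ofReal_sub_one_le).trans ?_
    rw [Real.norm_eq_abs, abs_div, abs_of_pos hs]
  calc _ ≤ Real.sqrt d * ∑ j, |centred a j| / Real.sqrt d := by gcongr
    _ = _ := by rw [← Finset.sum_div]; field_simp

lemma tendsto_scaled_exp_sub_one (x : ℝ) :
    Tendsto (fun d : ℕ => (Real.sqrt d : ℂ) * (Complex.exp ((x / Real.sqrt d : ℝ) * Complex.I) - 1))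
      atTop (𝓝 (x * Complex.I)) := by
  have h1 : HasDerivAt (fun z : ℂ => Complex.exp (z * (x * Complex.I))) (x * Complex.I) 0 := by
    have := ((hasDerivAt_id (0 : ℂ)).mul_const ((x : ℂ) * Complex.I)).cexp
    simpa using this
  have h2 : Tendsto (fun d : ℕ => (((Real.sqrt d)⁻¹ : ℝ) : ℂ)) atTop (𝓝[≠] 0) := by
    refine tendsto_nhdsWithin_iff.2 ⟨?_, ?_⟩
    · rw [← Complex.ofReal_zero]
      exact (Complex.continuous_ofReal.tendsto 0).comp tendsto_inv_sqrt_natCast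
    · filter_upwards [eventually_gt_atTop 0] with d hd
      have hs : 0 < Real.sqrt d := Real.sqrt_pos.2 (Nat.cast_pos.2 hd)
      exact Complex.ofReal_ne_zero.2 (inv_ne_zero hs.ne')
  have h3 := h1.tendsto_slope_zero.comp h2
  refine h3.congr fun d => ?_
  simp only [Function.comp_apply, zero_add, zero_mul, Complex.exp_zero, smul_eq_mul]
  push_cast
  rw [inv_inv]
  congr 3
  ring

lemma tendsto_sqrt_mul_stepCoeff (a : NZ q → ℝ) (k : NZ q) :
    Tendsto (fun d : ℕ => (Real.sqrt d : ℂ) * stepCoeff d a k.1) atTop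
      (𝓝 (Complex.I * centredCoeff a k.1)) := by
  have h : Tendsto (fun d : ℕ => (q : ℂ)⁻¹ * ∑ j, (Real.sqrt d : ℂ) *
      (Complex.exp ((centred a j / Real.sqrt d : ℝ) * Complex.I) - 1) * theta k.1 j) atTop
      (𝓝 ((q : ℂ)⁻¹ * ∑ j, (centred a j : ℂ) * Complex.I * theta k.1 j)) :=
    (tendsto_finsetSum _ fun j _ => (tendsto_scaled_exp_sub_one _).mul_const _).const_mul _
  have h2 : (q : ℂ)⁻¹ * ∑ j, (centred a j : ℂ) * Complex.I * theta k.1 j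
      = Complex.I * centredCoeff a k.1 := by
    rw [centredCoeff, fourierCoeff, mul_left_comm, Finset.mul_sum (a := Complex.I)]
    congr 1
    exact Finset.sum_congr rfl fun j _ => by ring
  rw [h2] at h
  refine h.congr fun d => ?_
  rw [stepCoeff_eq_sub, mul_left_comm, Finset.mul_sum (a := (Real.sqrt d : ℂ))]
  simp only [mul_assoc]

lemma tendsto_scaled_exp_sub_two (x : ℝ) :
    Tendsto (fun d : ℕ => (d : ℂ) * (Complex.exp ((x / Real.sqrt d : ℝ) * Complex.I) - 1
      - (x / Real.sqrt d : ℝ) * Complex.I)) atTop (𝓝 (-(x : ℂ) ^ 2 / 2)) := by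
  have hy : Tendsto (fun d : ℕ => |x| ^ 3 * (Real.sqrt d)⁻¹) atTop (𝓝 0) := by
    simpa using tendsto_inv_sqrt_natCast.const_mul (|x| ^ 3)
  have hsmall : ∀ᶠ d : ℕ in atTop, |x| / Real.sqrt d ≤ 1 := by
    have : Tendsto (fun d : ℕ => |x| / Real.sqrt d) atTop (𝓝 0) := by
      simpa [div_eq_mul_inv] using tendsto_inv_sqrt_natCast.const_mul |x|
    exact (this.eventually_lt_const one_pos).mono fun _ h => h.le
  rw [← tendsto_sub_nhds_zero_iff]
  refine squeeze_zero_norm' ?_ hy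
  filter_upwards [hsmall, eventually_gt_atTop 0] with d hd hd0
  have hd0' : (0 : ℝ) < d := Nat.cast_pos.2 hd0
  have hs : 0 < Real.sqrt d := Real.sqrt_pos.2 hd0'
  have hsq : Real.sqrt d ^ 2 = (d : ℝ) := Real.sq_sqrt hd0'.le
  set z : ℂ := (x / Real.sqrt d : ℝ) * Complex.I with hz
  have hzn : ‖z‖ = |x| / Real.sqrt d := by
    rw [hz, norm_mul, Complex.norm_real, Complex.norm_I, mul_one, Real.norm_eq_abs, abs_div,
      abs_of_pos hs]
  have h0 := Complex.exp_bound (x := z) (by rw [hzn]; exact hd) (n := 3) (by norm_num)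
  simp only [Finset.sum_range_succ, Finset.sum_range_zero, Nat.factorial] at h0
  norm_num at h0
  have h2 : (d : ℂ) * z ^ 2 = -(x : ℂ) ^ 2 := by
    have : (Real.sqrt d : ℂ) ^ 2 = d := by rw [← Complex.ofReal_pow, hsq, Complex.ofReal_natCast]
    have hs' : (Real.sqrt d : ℂ) ≠ 0 := Complex.ofReal_ne_zero.2 hs.ne'
    rw [hz, mul_pow, Complex.I_sq]
    push_cast
    rw [div_pow, this]
    have : (d : ℂ) ≠ 0 := Nat.cast_ne_zero.2 hd0.ne'
    field_simp
  have h3 : (d : ℂ) * (Complex.exp z - 1 - z) - -(x : ℂ) ^ 2 / 2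
      = d * (Complex.exp z - (1 + z + z ^ 2 / 2)) := by
    rw [← h2]; ring
  rw [h3, norm_mul, Complex.norm_natCast]
  -- The constant `2 / 9` is `4 / (3! * 3)`, from `Complex.exp_bound` at order three.
  calc (d : ℝ) * ‖Complex.exp z - (1 + z + z ^ 2 / 2)‖ ≤ d * (‖z‖ ^ 3 * (2 / 9)) := by gcongr
    _ ≤ d * ‖z‖ ^ 3 := by
        have : 0 ≤ ‖z‖ ^ 3 := by positivity
        gcongr; linarith
    _ = |x| ^ 3 * (Real.sqrt d)⁻¹ := by
        rw [hzn]; nth_rewrite 1 [← hsq]; field_simp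

/-- The first-order terms, of size `√d` after multiplication by `d`, cancel because the centred
vector sums to zero. The second order gives the variance. -/
lemma tendsto_mul_stepCoeff_zero_sub_one (a : NZ q → ℝ) :
    Tendsto (fun d : ℕ => (d : ℂ) * (stepCoeff d a 0 - 1)) atTop
      (𝓝 (-(trigVar a : ℂ) / 2)) := by
  have hq : (q : ℂ) ≠ 0 := Nat.cast_ne_zero.2 (NeZero.ne q)
  have h : Tendsto (fun d : ℕ => (q : ℂ)⁻¹ * ∑ j, (d : ℂ) *
      (Complex.exp ((centred a j / Real.sqrt d : ℝ) * Complex.I) - 1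
        - (centred a j / Real.sqrt d : ℝ) * Complex.I)) atTop
      (𝓝 ((q : ℂ)⁻¹ * ∑ j, (-(centred a j : ℂ) ^ 2 / 2))) :=
    (tendsto_finsetSum _ fun j _ => tendsto_scaled_exp_sub_two _).const_mul _
  have h2 : (q : ℂ)⁻¹ * ∑ j, (-(centred a j : ℂ) ^ 2 / 2) = -(trigVar a : ℂ) / 2 := by
    rw [trigVar, ← Finset.sum_div, Finset.sum_neg_distrib]
    push_cast
    ring
  rw [h2] at h
  refine h.congr fun d => ?_
  rw [← Finset.mul_sum, Finset.sum_sub_distrib, Finset.sum_sub_distrib, ← Finset.sum_mul,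
    ← Complex.ofReal_sum, ← Finset.sum_div, sum_centred]
  simp only [stepCoeff, fourierCoeff, theta_zero_left, mul_one, Finset.sum_const, Finset.card_univ,
    ZMod.card, nsmul_eq_mul, zero_div, Complex.ofReal_zero, zero_mul, sub_zero]
  linear_combination (-(d : ℂ)) * inv_mul_cancel₀ hq

lemma tendsto_stepCoeff_zero (a : NZ q → ℝ) :
    Tendsto (fun d : ℕ => stepCoeff d a 0) atTop (𝓝 1) := by
  have h1 := tendsto_mul_stepCoeff_zero_sub_one a
  have h2 : Tendsto (fun d : ℕ => ((d : ℂ))⁻¹) atTop (𝓝 0) :=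
    tendsto_inv_atTop_nhds_zero_nat (𝕜 := ℂ)
  have h3 := (h2.mul h1).add_const 1
  rw [zero_mul, zero_add] at h3
  refine h3.congr' ?_
  filter_upwards [eventually_gt_atTop 0] with d hd
  have : (d : ℂ) ≠ 0 := Nat.cast_ne_zero.2 hd.ne'
  field_simp
  ring

/-- The full power has the form `(1 + x_d / d)^d` with converging `x_d`, and the `s` missing factors
tend to one. -/
lemma tendsto_stepCoeff_zero_pow (a : NZ q → ℝ) (s : ℕ) :
    Tendsto (fun d : ℕ => stepCoeff d a 0 ^ (d - s)) atTop
      (𝓝 (Complex.exp (-(trigVar a : ℂ) / 2))) := by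
  have h1 := Complex.tendsto_one_add_pow_exp_of_tendsto (tendsto_mul_stepCoeff_zero_sub_one a)
  have h2 := (tendsto_stepCoeff_zero a).pow s
  rw [one_pow] at h2
  have h3 := h1.div h2 one_ne_zero
  rw [div_one] at h3
  refine h3.congr' ?_
  filter_upwards [eventually_ge_atTop s, (tendsto_stepCoeff_zero a).eventually_ne one_ne_zero]
    with d hd hne
  simp only [Pi.div_apply, add_sub_cancel]
  rw [div_eq_iff (pow_ne_zero _ hne), ← pow_add, Nat.sub_add_cancel hd]

/-- The arguments of the exponential series of the limit transform. -/
def pairCoeff (a b : NZ q → ℝ) (k : NZ q) : ℂ :=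
  -(centredCoeff a k.1 * (starRingEnd ℂ) (centredCoeff b k.1))

/-- The transform of the limit law. -/
def limitTransform (α : ℝ) (κ : (NZ q →₀ ℕ) → ℂ) (a b : NZ q → ℝ) : ℂ :=
  ∑' l, killed α (κ l) * (Complex.exp (-(trigVar a : ℂ) / 2) * Complex.exp (-(trigVar b : ℂ) / 2)
    * expTerm (pairCoeff a b) l)

/-- A factor `d^|l|` is moved from `h_l⁻¹` to the nontrivial coefficients, `√d` to each, after which
every factor converges and is bounded by itself. -/
lemma transformTerm_eq {d : ℕ} (hd : d ≠ 0) (α : ℝ) (ν : PMF (Fin d → ZMod q)) (a b : NZ q → ℝ)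
    (l : NZ q →₀ ℕ) : transformTerm α ν a b l
      = killed α (kappa ν l) * ((((hConst d l)⁻¹ / (d : ℝ) ^ (∑ k, l k) : ℝ) : ℂ)
        * (stepCoeff d a 0 ^ (d - ∑ k, l k)
          * (starRingEnd ℂ) (stepCoeff d (-b) 0 ^ (d - ∑ k, l k)))
        * ∏ k : NZ q, (((Real.sqrt d : ℂ) * stepCoeff d a k.1)
          * (starRingEnd ℂ) ((Real.sqrt d : ℂ) * stepCoeff d (-b) k.1)) ^ l k) := by
  have hd0 : (0 : ℝ) < d := Nat.cast_pos.2 (Nat.pos_of_ne_zero hd)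
  have hs : (Real.sqrt d : ℂ) * (Real.sqrt d : ℂ) = d := by
    rw [← Complex.ofReal_mul, Real.mul_self_sqrt hd0.le, Complex.ofReal_natCast]
  have h1 (k : NZ q) : ((Real.sqrt d : ℂ) * stepCoeff d a k.1)
      * (starRingEnd ℂ) ((Real.sqrt d : ℂ) * stepCoeff d (-b) k.1)
      = d * (stepCoeff d a k.1 * (starRingEnd ℂ) (stepCoeff d (-b) k.1)) := by
    rw [map_mul, Complex.conj_ofReal, ← hs]; ring
  simp_rw [h1, mul_pow, Finset.prod_mul_distrib, Finset.prod_pow_eq_pow_sum]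
  rw [transformTerm, map_mul, map_prod]
  have h2 : (d : ℂ) ^ (∑ k, l k) ≠ 0 := pow_ne_zero _ (Nat.cast_ne_zero.2 hd)
  simp only [map_pow]
  push_cast
  generalize (d : ℂ) ^ (∑ k, l k) = D at *
  have : D⁻¹ * D = 1 := inv_mul_cancel₀ h2
  rw [div_eq_mul_inv]
  generalize D⁻¹ = D' at *
  linear_combination (-(killed α (kappa ν l) * (hConst d l : ℂ)⁻¹
    * (stepCoeff d a 0 ^ (d - ∑ k, l k)
    * (starRingEnd ℂ) (stepCoeff d (-b) 0) ^ (d - ∑ k, l k))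
    * (∏ k : NZ q, stepCoeff d a k.1 ^ l k)
    * (∏ k : NZ q, (starRingEnd ℂ) (stepCoeff d (-b) k.1) ^ l k))) * this

lemma tendsto_transformTerm {α : ℝ} (hα0 : 0 ≤ α) (hα1 : α < 1)
    {ν : (d : ℕ) → PMF (Fin d → ZMod q)} {κ : (NZ q →₀ ℕ) → ℂ}
    (hκ : ∀ l, Tendsto (fun d => kappa (ν d) l) atTop (𝓝 (κ l))) (a b : NZ q → ℝ)
    (l : NZ q →₀ ℕ) :
    Tendsto (fun d => transformTerm α (ν d) a b l) atTop
      (𝓝 (killed α (κ l) * (Complex.exp (-(trigVar a : ℂ) / 2)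
        * Complex.exp (-(trigVar b : ℂ) / 2) * expTerm (pairCoeff a b) l))) := by
  have hκ1 : ‖κ l‖ ≤ 1 := le_of_tendsto (hκ l).norm (.of_forall fun d => norm_kappa_le _ _)
  have h1 := tendsto_killed hα0 hα1 (hκ l) hκ1
  have h2 := (Complex.continuous_ofReal.tendsto _).comp (tendsto_inv_hConst l)
  have h3 := tendsto_stepCoeff_zero_pow a (∑ k, l k)
  have h4 := (Complex.continuous_conj.tendsto _).comp (tendsto_stepCoeff_zero_pow (-b) (∑ k, l k))
  have h5 (k : NZ q) := ((tendsto_sqrt_mul_stepCoeff a k).mul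
    ((Complex.continuous_conj.tendsto _).comp (tendsto_sqrt_mul_stepCoeff (-b) k))).pow (l k)
  have h6 := h1.mul ((h2.mul (h3.mul h4)).mul (tendsto_finsetProd Finset.univ fun k _ => h5 k))
  have e1 : (starRingEnd ℂ) (Complex.exp (-(trigVar (-b) : ℂ) / 2))
      = Complex.exp (-(trigVar b : ℂ) / 2) := by
    rw [trigVar_neg, ← Complex.exp_conj, map_div₀, map_neg, Complex.conj_ofReal, map_ofNat]
  have e2 (k : NZ q) : Complex.I * centredCoeff a k.1
      * (starRingEnd ℂ) (Complex.I * centredCoeff (-b) k.1) = pairCoeff a b k := by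
    rw [centredCoeff_neg, pairCoeff, map_mul, Complex.conj_I, map_neg]
    linear_combination (centredCoeff a k.1 * (starRingEnd ℂ) (centredCoeff b k.1)) * Complex.I_mul_I
  have e3 : killed α (κ l) * (((∏ k, ((l k).factorial : ℝ))⁻¹ : ℝ)
      * (Complex.exp (-(trigVar a : ℂ) / 2) * (starRingEnd ℂ) (Complex.exp (-(trigVar (-b) : ℂ) / 2)))
      * ∏ k : NZ q, (Complex.I * centredCoeff a k.1
      * (starRingEnd ℂ) (Complex.I * centredCoeff (-b) k.1)) ^ l k)
      = killed α (κ l) * (Complex.exp (-(trigVar a : ℂ) / 2)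
        * Complex.exp (-(trigVar b : ℂ) / 2) * expTerm (pairCoeff a b) l) := by
    simp_rw [e1, e2, expTerm, Finset.prod_div_distrib]
    push_cast
    ring
  rw [e3] at h6
  refine h6.congr' ?_
  filter_upwards [eventually_ne_atTop 0] with d hd
  rw [transformTerm_eq hd]
  rfl

/-- The bound is free of `d` and summable in `l`: `h_l⁻¹ ≤ d^|l| / ∏ l!`, the zeroth coefficients
and the killing factor are at most one in norm, and the rescaled coefficients are bounded by
`centredBound`. -/
lemma norm_transformTerm_le {α : ℝ} (hα0 : 0 ≤ α) (hα1 : α < 1) {d : ℕ} (hd : d ≠ 0)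
    (ν : PMF (Fin d → ZMod q)) (a b : NZ q → ℝ) {l : NZ q →₀ ℕ} (hl : ∑ k, l k ≤ d) :
    ‖transformTerm α ν a b l‖
      ≤ ‖expTerm (fun _ : NZ q => ((centredBound a * centredBound (-b) : ℝ) : ℂ)) l‖ := by
  have hd0 : (0 : ℝ) < d := Nat.cast_pos.2 (Nat.pos_of_ne_zero hd)
  rw [transformTerm_eq hd, norm_expTerm, norm_mul, norm_mul, norm_mul, norm_mul, norm_prod]
  have h1 := norm_killed_le hα0 hα1 (norm_kappa_le ν l)
  have h2 : ‖(((hConst d l)⁻¹ / (d : ℝ) ^ (∑ k, l k) : ℝ) : ℂ)‖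
      ≤ (∏ k, ((l k).factorial : ℝ))⁻¹ := by
    rw [Complex.norm_real, Real.norm_of_nonneg (div_nonneg (inv_nonneg.2 (hConst_pos d l).le)
      (by positivity)), inv_hConst hl, div_right_comm, div_eq_mul_inv _ (∏ k, _)]
    refine mul_le_of_le_one_left (by positivity) (div_le_one_of_le₀ ?_ (by positivity))
    exact_mod_cast Nat.descFactorial_le_pow d _
  have h3 : ‖stepCoeff d a 0 ^ (d - ∑ k, l k)‖ ≤ 1 := by
    rw [norm_pow]; exact pow_le_one₀ (norm_nonneg _) (norm_stepCoeff_le_one _ _ _)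
  have h4 : ‖(starRingEnd ℂ) (stepCoeff d (-b) 0 ^ (d - ∑ k, l k))‖ ≤ 1 := by
    rw [RCLike.norm_conj, norm_pow]; exact pow_le_one₀ (norm_nonneg _) (norm_stepCoeff_le_one _ _ _)
  have h5 : ∏ k : NZ q, ‖(((Real.sqrt d : ℂ) * stepCoeff d a k.1)
          * (starRingEnd ℂ) ((Real.sqrt d : ℂ) * stepCoeff d (-b) k.1)) ^ l k‖
      ≤ ∏ k : NZ q, (centredBound a * centredBound (-b)) ^ l k := by
    refine Finset.prod_le_prod (fun _ _ => norm_nonneg _) fun k _ => ?_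
    rw [norm_pow]
    refine pow_le_pow_left₀ (norm_nonneg _) ?_ _
    rw [norm_mul, RCLike.norm_conj]
    exact mul_le_mul (norm_sqrt_mul_stepCoeff_le d a k) (norm_sqrt_mul_stepCoeff_le d (-b) k)
      (norm_nonneg _) (centredBound_nonneg a)
  have h6 : 0 ≤ ∏ k : NZ q, (centredBound a * centredBound (-b)) ^ l k :=
    Finset.prod_nonneg fun k _ => pow_nonneg
      (mul_nonneg (centredBound_nonneg a) (centredBound_nonneg (-b))) _
  calc _ ≤ 1 * ((∏ k, ((l k).factorial : ℝ))⁻¹ * (1 * 1)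
        * ∏ k : NZ q, (centredBound a * centredBound (-b)) ^ l k) := by gcongr
    _ = _ := by
        rw [Complex.norm_real, Real.norm_of_nonneg (mul_nonneg (centredBound_nonneg a)
          (centredBound_nonneg (-b))), Finset.prod_div_distrib]
        field_simp

lemma tendsto_sum_pairWeight_trig {α : ℝ} (hα0 : 0 ≤ α) (hα1 : α < 1)
    {ν : (d : ℕ) → PMF (Fin d → ZMod q)} (hν : ∀ d, Exchangeable (ν d))
    {κ : (NZ q →₀ ℕ) → ℂ} (hκ : ∀ l, Tendsto (fun d => kappa (ν d) l) atTop (𝓝 (κ l)))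
    (a b : NZ q → ℝ) :
    Tendsto (fun d => ∑ m ∈ countVectors q d, ∑ n ∈ countVectors q d,
      (pairWeight α (ν d) m n : ℂ) * (trig a (scaledPoint d m) * trig b (scaledPoint d n))) atTop
      (𝓝 (limitTransform α κ a b)) := by
  classical
  -- Extension by zero beyond `|l| ≤ d` puts all `d` on one index set, as dominated convergence for
  -- series needs; each `l` is inside from `d = |l|` on.
  have h : Tendsto (fun d => ∑' l, if l ∈ indices q d then transformTerm α (ν d) a b l else 0) atTop
      (𝓝 (limitTransform α κ a b)) := by
    refine tendsto_tsum_of_dominated_convergence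
      (summable_norm_expTerm fun _ : NZ q => ((centredBound a * centredBound (-b) : ℝ) : ℂ))
      (fun l => ?_) ?_
    · refine (tendsto_transformTerm hα0 hα1 hκ a b l).congr' ?_
      filter_upwards [eventually_ge_atTop (∑ k, l k)] with d hd
      rw [if_pos (mem_indices.2 hd)]
    · filter_upwards [eventually_ne_atTop 0] with d hd l
      split_ifs with hl
      · exact norm_transformTerm_le hα0 hα1 hd _ a b (mem_indices.1 hl)
      · simp
  refine h.congr' ?_
  filter_upwards [eventually_ne_atTop 0] with d hd
  rw [sum_pairWeight_trig hα0 hα1 hd (hν d), tsum_eq_sum (s := indices q d) fun l hl => if_neg hl]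
  exact Finset.sum_congr rfl fun l hl => if_pos hl

lemma continuous_centredCoeff (k : ZMod q) : Continuous fun a : NZ q → ℝ => centredCoeff a k := by
  unfold centredCoeff fourierCoeff
  have := fun j => continuous_centred (q := q) j
  fun_prop

lemma continuous_trigVar : Continuous fun a : NZ q → ℝ => trigVar a := by
  unfold trigVar
  have := fun j => continuous_centred (q := q) j
  fun_prop

lemma centredCoeff_zero (k : ZMod q) : centredCoeff (0 : NZ q → ℝ) k = 0 := by
  simp [centredCoeff, fourierCoeff, centred_zero]

lemma trigVar_zero : trigVar (0 : NZ q → ℝ) = 0 := by simp [trigVar, centred_zero]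

lemma trigVar_nonneg (a : NZ q → ℝ) : 0 ≤ trigVar a := by unfold trigVar; positivity

/-- Near the origin all `pairCoeff` are smaller than one, so the exponential series at the vector of
ones dominates. Lévy's theorem requires no more than continuity at zero. -/
lemma continuousAt_limitTransform {α : ℝ} (hα0 : 0 ≤ α) (hα1 : α < 1) {κ : (NZ q →₀ ℕ) → ℂ}
    (hκ : ∀ l, ‖κ l‖ ≤ 1) :
    ContinuousAt (fun p : (NZ q → ℝ) × (NZ q → ℝ) => limitTransform α κ p.1 p.2) 0 := by
  have hc (k : NZ q) : Continuous fun p : (NZ q → ℝ) × (NZ q → ℝ) => pairCoeff p.1 p.2 k := by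
    unfold pairCoeff
    have := continuous_centredCoeff (q := q) k.1
    fun_prop
  have hV := continuous_trigVar (q := q)
  refine tendsto_tsum_of_dominated_convergence (summable_norm_expTerm fun _ : NZ q => (1 : ℂ))
    (fun l => ?_) ?_
  · refine Continuous.tendsto ?_ _
    unfold expTerm
    fun_prop
  · have h1 (k : NZ q) : ∀ᶠ p : (NZ q → ℝ) × (NZ q → ℝ) in 𝓝 0, ‖pairCoeff p.1 p.2 k‖ < 1 := by
      refine (hc k).norm.continuousAt.eventually_lt_const ?_
      simp [pairCoeff, centredCoeff_zero]
    filter_upwards [eventually_all.2 h1] with p hp l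
    rw [norm_mul, norm_mul, norm_mul]
    have h2 (a : NZ q → ℝ) : ‖Complex.exp (-(trigVar a : ℂ) / 2)‖ ≤ 1 := by
      rw [Complex.norm_exp]
      refine Real.exp_le_one_iff.2 ?_
      have : (-(trigVar a : ℂ) / 2) = ((-trigVar a / 2 : ℝ) : ℂ) := by push_cast; ring
      rw [this, Complex.ofReal_re]
      linarith [trigVar_nonneg a]
    have h3 : ‖expTerm (pairCoeff p.1 p.2) l‖ ≤ ‖expTerm (fun _ : NZ q => (1 : ℂ)) l‖ := by
      rw [norm_expTerm, norm_expTerm]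
      refine Finset.prod_le_prod (fun _ _ => by positivity) fun k _ => ?_
      have := (hp k).le
      rw [norm_one]
      gcongr
    calc _ ≤ 1 * (1 * 1 * ‖expTerm (fun _ : NZ q => (1 : ℂ)) l‖) := by
            gcongr
            · exact norm_killed_le hα0 hα1 (hκ l)
            · exact h2 _
            · exact h2 _
      _ = _ := by ring

/-- The transform of the marginal of the limit law. -/
lemma limitTransform_zero_right {α : ℝ} {κ : (NZ q →₀ ℕ) → ℂ} (hκ : κ 0 = 1) (a : NZ q → ℝ) :
    limitTransform α κ a 0 = Complex.exp (-(trigVar a : ℂ) / 2) := by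
  rw [limitTransform, tsum_eq_single 0]
  · simp [hκ, killed_one, trigVar_zero, expTerm]
  · intro l hl
    obtain ⟨k, hk⟩ := Finsupp.ne_iff.1 hl
    have : expTerm (pairCoeff a 0) l = 0 := by
      refine Finset.prod_eq_zero (Finset.mem_univ k) ?_
      simp only [pairCoeff, centredCoeff_zero, map_zero, mul_zero, neg_zero]
      rw [zero_pow hk, zero_div]
    rw [this, mul_zero, mul_zero]

lemma limitTransform_zero_left {α : ℝ} {κ : (NZ q →₀ ℕ) → ℂ} (hκ : κ 0 = 1) (a : NZ q → ℝ) :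
    limitTransform α κ 0 a = Complex.exp (-(trigVar a : ℂ) / 2) := by
  rw [limitTransform, tsum_eq_single 0]
  · simp [hκ, killed_one, trigVar_zero, expTerm]
  · intro l hl
    obtain ⟨k, hk⟩ := Finsupp.ne_iff.1 hl
    have : expTerm (pairCoeff 0 a) l = 0 := by
      refine Finset.prod_eq_zero (Finset.mem_univ k) ?_
      simp only [pairCoeff, centredCoeff_zero, zero_mul, neg_zero]
      rw [zero_pow hk, zero_div]
    rw [this, mul_zero, mul_zero]

end TransformLimit

/-! ### Lévy's continuity theorem for pairs -/

section Levy

variable {ι : Type*} [Fintype ι]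

/-- The pair of the two halves of a vector indexed by `ι ⊕ ι`. -/
def splitPair (x : EuclideanSpace ℝ (ι ⊕ ι)) : (ι → ℝ) × (ι → ℝ) :=
  (fun k => x (Sum.inl k), fun k => x (Sum.inr k))

/-- The inverse of `splitPair`. -/
def joinPair (z : (ι → ℝ) × (ι → ℝ)) : EuclideanSpace ℝ (ι ⊕ ι) :=
  WithLp.toLp 2 (Sum.elim z.1 z.2)

omit [Fintype ι] in
lemma splitPair_joinPair (z : (ι → ℝ) × (ι → ℝ)) : splitPair (joinPair z) = z := rfl

omit [Fintype ι] in
lemma continuous_splitPair : Continuous (splitPair (ι := ι)) := by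
  unfold splitPair; fun_prop

omit [Fintype ι] in
lemma continuous_joinPair : Continuous (joinPair (ι := ι)) := by
  unfold joinPair
  refine (PiLp.continuous_toLp 2 _).comp (continuous_pi fun k => ?_)
  cases k <;> simp only [Sum.elim_inl, Sum.elim_inr] <;> fun_prop

lemma continuous_trig (a : ι → ℝ) : Continuous (trig a) := by
  unfold trig; fun_prop

lemma norm_trig (a x : ι → ℝ) : ‖trig a x‖ = 1 := Complex.norm_exp_ofReal_mul_I _

lemma exp_inner_eq (x t : EuclideanSpace ℝ (ι ⊕ ι)) :
    Complex.exp ((inner ℝ x t : ℝ) * Complex.I)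
      = trig (splitPair t).1 (splitPair x).1 * trig (splitPair t).2 (splitPair x).2 := by
  rw [trig, trig, ← Complex.exp_add, PiLp.inner_apply, Fintype.sum_sum_type]
  congr 1
  simp only [splitPair, RCLike.inner_apply, conj_trivial]
  push_cast
  ring

/-- Lévy's continuity theorem for pairs of vectors. -/
lemma exists_weak_limit (μ : ℕ → Measure ((ι → ℝ) × (ι → ℝ))) [∀ n, IsProbabilityMeasure (μ n)]
    (Φ : (ι → ℝ) → (ι → ℝ) → ℂ)
    (hΦ : ContinuousAt (fun p : (ι → ℝ) × (ι → ℝ) => Φ p.1 p.2) 0)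
    (h : ∀ a b, Tendsto (fun n => ∫ z, trig a z.1 * trig b z.2 ∂μ n) atTop (𝓝 (Φ a b))) :
    ∃ Γ : Measure ((ι → ℝ) × (ι → ℝ)), IsProbabilityMeasure Γ ∧
      (∀ F : ((ι → ℝ) × (ι → ℝ)) →ᵇ ℝ,
        Tendsto (fun n => ∫ z, F z ∂μ n) atTop (𝓝 (∫ z, F z ∂Γ))) ∧
      ∀ a b, ∫ z, trig a z.1 * trig b z.2 ∂Γ = Φ a b := by
  have hm := (continuous_joinPair (ι := ι)).measurable
  have hms := (continuous_splitPair (ι := ι)).measurable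
  let p (n : ℕ) : ProbabilityMeasure (EuclideanSpace ℝ (ι ⊕ ι)) :=
    ⟨(μ n).map joinPair, Measure.isProbabilityMeasure_map hm.aemeasurable⟩
  have hchar (n : ℕ) (t : EuclideanSpace ℝ (ι ⊕ ι)) : charFun (p n : Measure _) t
      = ∫ z, trig (splitPair t).1 z.1 * trig (splitPair t).2 z.2 ∂μ n := by
    rw [charFun_apply]
    simp_rw [exp_inner_eq]
    have hc : Continuous fun x : EuclideanSpace ℝ (ι ⊕ ι) =>
        trig (splitPair t).1 (splitPair x).1 * trig (splitPair t).2 (splitPair x).2 :=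
      ((continuous_trig _).comp continuous_splitPair.fst).mul
        ((continuous_trig _).comp continuous_splitPair.snd)
    change ∫ x, _ ∂((μ n).map joinPair) = _
    rw [integral_map hm.aemeasurable hc.aestronglyMeasurable]
    rfl
  have hlim (t : EuclideanSpace ℝ (ι ⊕ ι)) : Tendsto (fun n => charFun (p n : Measure _) t) atTop
      (𝓝 (Φ (splitPair t).1 (splitPair t).2)) := by
    simp_rw [hchar]
    exact h _ _
  have hcont : ContinuousAt (fun t : EuclideanSpace ℝ (ι ⊕ ι) =>
      Φ (splitPair t).1 (splitPair t).2) 0 :=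
    ContinuousAt.comp (g := fun p : (ι → ℝ) × (ι → ℝ) => Φ p.1 p.2) (f := splitPair)
      (by exact hΦ) continuous_splitPair.continuousAt
  -- Continuity of the limit transform at zero excludes escape of mass.
  have htight : IsTightMeasureSet (Set.range fun n => (p n : Measure _)) :=
    isTightMeasureSet_of_tendsto_charFun hcont hlim
  have hcompact : IsCompact (closure (Set.range p)) := by
    refine isCompact_closure_of_isTightMeasureSet ?_
    have hset : {x : Measure (EuclideanSpace ℝ (ι ⊕ ι)) | ∃ ρ ∈ Set.range p, (ρ : Measure _) = x}
        = Set.range fun n => (p n : Measure _) := by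
      ext ρ
      simp
    rw [hset]
    exact htight
  -- One limit point along an ultrafilter suffices: its characteristic function is the given limit,
  -- and this identifies it as the limit of the whole sequence.
  obtain ⟨p₀, -, hp₀⟩ := hcompact.ultrafilter_le_nhds ((Ultrafilter.of atTop).map p)
    (.trans (by simp) (Filter.monotone_principal subset_closure))
  have hU : Tendsto p (Ultrafilter.of atTop : Ultrafilter ℕ) (𝓝 p₀) := hp₀
  have hchar₀ (t : EuclideanSpace ℝ (ι ⊕ ι)) : charFun (p₀ : Measure _) t
      = Φ (splitPair t).1 (splitPair t).2 := by
    refine tendsto_nhds_unique ?_ ((hlim t).mono_left (Ultrafilter.of_le atTop))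
    rw [ProbabilityMeasure.tendsto_iff_forall_integral_rclike_tendsto ℂ] at hU
    simp_rw [charFun_eq_integral_innerProbChar]
    exact hU (BoundedContinuousFunction.innerProbChar t)
  have hweak : Tendsto p atTop (𝓝 p₀) := ProbabilityMeasure.tendsto_of_tendsto_charFun fun t => by
    rw [hchar₀]; exact hlim t
  refine ⟨(p₀ : Measure _).map splitPair, Measure.isProbabilityMeasure_map hms.aemeasurable,
    fun F => ?_, fun a b => ?_⟩
  · rw [ProbabilityMeasure.tendsto_iff_forall_integral_tendsto] at hweak
    have h1 := hweak (F.compContinuous ⟨splitPair, continuous_splitPair⟩)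
    rw [integral_map hms.aemeasurable F.continuous.aestronglyMeasurable]
    refine h1.congr fun n => ?_
    change ∫ x, _ ∂((μ n).map joinPair) = _
    rw [integral_map hm.aemeasurable
      (BoundedContinuousFunction.continuous _).aestronglyMeasurable]
    rfl
  · have hc : Continuous fun z : (ι → ℝ) × (ι → ℝ) => trig a z.1 * trig b z.2 :=
      ((continuous_trig _).comp continuous_fst).mul ((continuous_trig _).comp continuous_snd)
    rw [integral_map hms.aemeasurable hc.aestronglyMeasurable]
    have := hchar₀ (joinPair (a, b))
    rw [splitPair_joinPair, charFun_apply] at this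
    simp_rw [exp_inner_eq, splitPair_joinPair] at this
    exact this

end Levy

/-! ### Weak convergence of the scaled Green function -/

section WeakLimit

variable {q : ℕ} [NeZero q]

/-- The law of the pair of scaled grouped positions. -/
def pairLaw {d : ℕ} (α : ℝ) (ν : PMF (Fin d → ZMod q)) : Measure ((NZ q → ℝ) × (NZ q → ℝ)) :=
  ∑ m ∈ countVectors q d, ∑ n ∈ countVectors q d,
    ENNReal.ofReal (pairWeight α ν m n) • Measure.dirac (scaledPoint d m, scaledPoint d n)

lemma isProbabilityMeasure_pairLaw {α : ℝ} (hα0 : 0 ≤ α) (hα1 : α < 1) {d : ℕ} (hd : d ≠ 0)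
    {ν : PMF (Fin d → ZMod q)} (hν : Exchangeable ν) : IsProbabilityMeasure (pairLaw α ν) := by
  constructor
  simp only [pairLaw, Measure.coe_finsetSum, Finset.sum_apply, Measure.smul_apply, measure_univ,
    smul_eq_mul, mul_one]
  simp_rw [← ENNReal.ofReal_sum_of_nonneg fun n _ => pairWeight_nonneg hα0 hα1 ν _ n]
  rw [← ENNReal.ofReal_sum_of_nonneg fun m _ => Finset.sum_nonneg fun n _ =>
    pairWeight_nonneg hα0 hα1 ν m n, sum_pairWeight hα0 hα1 hd hν, ENNReal.ofReal_one]

lemma integral_pairLaw {E : Type*} [NormedAddCommGroup E] [NormedSpace ℝ E] [CompleteSpace E]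
    {α : ℝ} (hα0 : 0 ≤ α) (hα1 : α < 1) {d : ℕ} (ν : PMF (Fin d → ZMod q))
    (F : (NZ q → ℝ) × (NZ q → ℝ) → E) :
    ∫ z, F z ∂(pairLaw α ν) = ∑ m ∈ countVectors q d, ∑ n ∈ countVectors q d,
      pairWeight α ν m n • F (scaledPoint d m, scaledPoint d n) := by
  have hi (m n : ZMod q → ℕ) : Integrable F (ENNReal.ofReal (pairWeight α ν m n)
      • Measure.dirac (scaledPoint d m, scaledPoint d n)) :=
    (integrable_dirac (by simp)).smul_measure ENNReal.ofReal_ne_top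
  rw [pairLaw, integral_finsetSum_measure fun m _ =>
    integrable_finsetSum_measure.2 fun n _ => hi m n]
  refine Finset.sum_congr rfl fun m _ => ?_
  rw [integral_finsetSum_measure fun n _ => hi m n]
  refine Finset.sum_congr rfl fun n _ => ?_
  rw [integral_smul_measure, integral_dirac,
    ENNReal.toReal_ofReal (pairWeight_nonneg hα0 hα1 ν m n)]

/-- The scaled Green function converges weakly to the law with transform `limitTransform`. -/
lemma exists_limit_law {α : ℝ} (hα0 : 0 ≤ α) (hα1 : α < 1)
    {ν : (d : ℕ) → PMF (Fin d → ZMod q)} (hν : ∀ d, Exchangeable (ν d))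
    {κ : (NZ q →₀ ℕ) → ℂ} (hκ : ∀ l, Tendsto (fun d => kappa (ν d) l) atTop (𝓝 (κ l))) :
    ∃ Γ : Measure ((NZ q → ℝ) × (NZ q → ℝ)), IsProbabilityMeasure Γ ∧
      (∀ F : ((NZ q → ℝ) × (NZ q → ℝ)) →ᵇ ℝ,
        Tendsto (fun d : ℕ => ((d : ℝ) ^ (q - 1))⁻¹ *
            ∑ m ∈ countVectors q d, ∑ n ∈ countVectors q d,
              F (scaledPoint d m, scaledPoint d n) * scaledGreen α (ν d) m n)
          atTop (𝓝 (∫ z, F z ∂Γ))) ∧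
      ∀ a b, ∫ z, trig a z.1 * trig b z.2 ∂Γ = limitTransform α κ a b := by
  have hκ1 (l) : ‖κ l‖ ≤ 1 := le_of_tendsto (hκ l).norm (.of_forall fun d => norm_kappa_le _ _)
  -- The shift avoids `d = 0`, where the factor `0 ^ (q - 1)` can destroy the mass.
  have hprob (n : ℕ) : IsProbabilityMeasure (pairLaw α (ν (n + 1))) :=
    isProbabilityMeasure_pairLaw hα0 hα1 (Nat.succ_ne_zero n) (hν _)
  obtain ⟨Γ, hΓ, hF, hΦ⟩ := exists_weak_limit (fun n => pairLaw α (ν (n + 1)))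
    (limitTransform α κ) (continuousAt_limitTransform hα0 hα1 hκ1) (fun a b => by
      have := (tendsto_add_atTop_iff_nat 1).2 (tendsto_sum_pairWeight_trig hα0 hα1 hν hκ a b)
      refine this.congr fun n => ?_
      rw [integral_pairLaw hα0 hα1]
      simp only [Complex.real_smul])
  refine ⟨Γ, hΓ, fun F => ?_, hΦ⟩
  rw [← tendsto_add_atTop_iff_nat 1]
  refine (hF F).congr fun n => ?_
  rw [integral_pairLaw hα0 hα1, Finset.mul_sum]
  simp_rw [Finset.mul_sum, pairWeight, smul_eq_mul]
  exact Finset.sum_congr rfl fun m _ => Finset.sum_congr rfl fun n _ => by ring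

end WeakLimit

/-! ### The limit normal law and its Laplace transform -/

section Gauss

variable {q : ℕ} [NeZero q]

lemma continuous_phi : Continuous (phi (q := q)) := by
  unfold phi; fun_prop

lemma phi_nonneg (x : NZ q → ℝ) : 0 ≤ phi x := by
  unfold phi; positivity

lemma integral_gauss {E : Type*} [NormedAddCommGroup E] [NormedSpace ℝ E]
    (f : (NZ q → ℝ) → E) : ∫ x, f x ∂(gauss q) = ∫ x, phi x • f x := by
  rw [gauss, integral_withDensity_eq_integral_toReal_smul
    (continuous_phi.measurable.ennreal_ofReal) (by simp)]
  simp_rw [ENNReal.toReal_ofReal (phi_nonneg _)]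

lemma integrable_gauss_iff {E : Type*} [NormedAddCommGroup E] [NormedSpace ℝ E]
    {f : (NZ q → ℝ) → E} : Integrable f (gauss q) ↔ Integrable (fun x => phi x • f x) := by
  rw [gauss, integrable_withDensity_iff_integrable_smul'
    (continuous_phi.measurable.ennreal_ofReal) (by simp)]
  simp_rw [ENNReal.toReal_ofReal (phi_nonneg _)]

lemma sum_sq_le_sum_full (x : NZ q → ℝ) : ∑ k, x k ^ 2 ≤ ∑ j, full x j ^ 2 := by
  rw [sum_zmod]
  have h (k : NZ q) : full x k.1 = x k := by simp [full, k.2]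
  simp_rw [h]
  nlinarith [sq_nonneg (full x 0)]

lemma integrable_exp_neg_mul_sum_sq {ι : Type*} [Fintype ι] {b : ℝ} (hb : 0 < b) :
    Integrable fun x : ι → ℝ => Real.exp (-b * ∑ k, x k ^ 2) := by
  have h := (GaussianFourier.integrable_cexp_neg_mul_sum_add (ι := ι) (b := (b : ℂ))
    (by simpa using hb) 0).norm
  refine h.congr (.of_forall fun x => ?_)
  simp only [Pi.zero_apply, zero_mul, Finset.sum_const_zero, add_zero]
  have : -(b : ℂ) * ∑ i, (x i : ℂ) ^ 2 = ((-b * ∑ i, x i ^ 2 : ℝ) : ℂ) := by push_cast; ring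
  rw [this, Complex.norm_exp, Complex.ofReal_re]

/-- Continuous functions of at most exponential growth. -/
def ExpGrowth {ι : Type*} [Fintype ι] (f : (ι → ℝ) → ℂ) : Prop :=
  Continuous f ∧ ∃ K c : ℝ, 0 ≤ K ∧ 0 ≤ c ∧ ∀ x, ‖f x‖ ≤ K * Real.exp (c * ∑ k, |x k|)

lemma integrable_exp_sum_abs (c : ℝ) :
    Integrable (fun x : NZ q → ℝ => Real.exp (c * ∑ k, |x k|)) (gauss q) := by
  have hq : (0 : ℝ) < q := Nat.cast_pos.2 (NeZero.pos q)
  rw [integrable_gauss_iff]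
  obtain ⟨A, hA⟩ : ∃ A : ℝ, A = Real.sqrt (2 * Real.pi) / Real.sqrt (2 * Real.pi) ^ q
    * Real.sqrt q ^ q := ⟨_, rfl⟩
  have hA0 : 0 ≤ A := by rw [hA]; positivity
  have h := (integrable_exp_neg_mul_sum_sq (ι := NZ q) (b := (q : ℝ) / 4) (by positivity)).const_mul
    (A * Real.exp (∑ _k : NZ q, c ^ 2 / q))
  refine h.mono' ?_ (.of_forall fun x => ?_)
  · exact (continuous_phi.smul (by fun_prop)).aestronglyMeasurable
  · rw [smul_eq_mul, Real.norm_of_nonneg (mul_nonneg (phi_nonneg x) (Real.exp_nonneg _)), phi_eq,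
      ← hA, mul_assoc, mul_assoc, ← Real.exp_add, ← Real.exp_add]
    refine mul_le_mul_of_nonneg_left (Real.exp_le_exp.2 ?_) hA0
    have h1 := sum_sq_le_sum_full x
    -- Completing the square spends half of the exponent `(q / 2) ∑ x_k²`; the other half keeps the
    -- product integrable.
    have h2 : c * ∑ k, |x k| ≤ ∑ _k : NZ q, c ^ 2 / q + (q : ℝ) / 4 * ∑ k, x k ^ 2 := by
      rw [Finset.mul_sum, Finset.mul_sum, ← Finset.sum_add_distrib]
      refine Finset.sum_le_sum fun k _ => ?_
      have h3 : c ^ 2 / q + (q : ℝ) / 4 * x k ^ 2 - c * |x k|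
          = (2 * c - q * |x k|) ^ 2 / (4 * q) := by
        rw [← sq_abs (x k)]; field_simp; ring
      have h4 : 0 ≤ (2 * c - q * |x k|) ^ 2 / (4 * q) := by positivity
      linarith
    nlinarith

lemma ExpGrowth.integrable {f : (NZ q → ℝ) → ℂ} (hf : ExpGrowth f) : Integrable f (gauss q) := by
  obtain ⟨hc, K, c, _, _, h⟩ := hf
  exact ((integrable_exp_sum_abs c).const_mul K).mono' hc.aestronglyMeasurable (.of_forall h)

section ExpGrowthAlgebra

variable {ι : Type*} [Fintype ι] {f g : (ι → ℝ) → ℂ}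

lemma ExpGrowth.mul (hf : ExpGrowth f) (hg : ExpGrowth g) : ExpGrowth fun x => f x * g x := by
  obtain ⟨hc, K, c, hK, hc0, h⟩ := hf
  obtain ⟨hc', K', c', hK', hc0', h'⟩ := hg
  refine ⟨hc.mul hc', K * K', c + c', by positivity, by positivity, fun x => ?_⟩
  rw [norm_mul, add_mul, Real.exp_add, mul_mul_mul_comm]
  exact mul_le_mul (h x) (h' x) (norm_nonneg _) (by positivity)

lemma ExpGrowth.add (hf : ExpGrowth f) (hg : ExpGrowth g) : ExpGrowth fun x => f x + g x := by
  obtain ⟨hc, K, c, hK, hc0, h⟩ := hf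
  obtain ⟨hc', K', c', hK', hc0', h'⟩ := hg
  refine ⟨hc.add hc', K + K', c + c', by positivity, by positivity, fun x => ?_⟩
  have hs : 0 ≤ ∑ k, |x k| := Finset.sum_nonneg fun _ _ => abs_nonneg _
  calc ‖f x + g x‖ ≤ ‖f x‖ + ‖g x‖ := norm_add_le _ _
    _ ≤ K * Real.exp (c * ∑ k, |x k|) + K' * Real.exp (c' * ∑ k, |x k|) := add_le_add (h x) (h' x)
    _ ≤ K * Real.exp ((c + c') * ∑ k, |x k|) + K' * Real.exp ((c + c') * ∑ k, |x k|) := by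
      gcongr <;> linarith
    _ = _ := by ring

lemma ExpGrowth.const (a : ℂ) : ExpGrowth fun _ : ι → ℝ => a :=
  ⟨continuous_const, ‖a‖, 0, norm_nonneg _, le_rfl, fun x => by simp⟩

lemma ExpGrowth.sum {β : Type*} (s : Finset β) {f : β → (ι → ℝ) → ℂ}
    (h : ∀ i ∈ s, ExpGrowth (f i)) : ExpGrowth fun x => ∑ i ∈ s, f i x := by
  classical
  induction s using Finset.induction_on with
  | empty => simpa using ExpGrowth.const (ι := ι) 0
  | insert i s hi ih =>
    simp_rw [Finset.sum_insert hi]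
    exact (h i (by simp)).add (ih fun j hj => h j (by simp [hj]))

lemma ExpGrowth.of_le_sum_abs (hc : Continuous f) {C : ℝ} (hC : 0 ≤ C)
    (h : ∀ x, ‖f x‖ ≤ C * ∑ k, |x k|) : ExpGrowth f := by
  refine ⟨hc, C, 1, hC, zero_le_one, fun x => (h x).trans ?_⟩
  have := Real.add_one_le_exp (1 * ∑ k, |x k|)
  gcongr
  linarith

lemma ExpGrowth.trig (a : ι → ℝ) : ExpGrowth (GreenLimit.trig a) :=
  ⟨continuous_trig a, 1, 0, zero_le_one, le_rfl, fun x => by simp [norm_trig]⟩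

end ExpGrowthAlgebra

lemma abs_full_le (x : NZ q → ℝ) (j : ZMod q) : |full x j| ≤ ∑ k, |x k| := by
  unfold full
  split_ifs with h
  · exact Finset.single_le_sum (f := fun k => |x k|) (fun _ _ => abs_nonneg _)
      (Finset.mem_univ (⟨j, h⟩ : NZ q))
  · rw [abs_neg]
    exact Finset.abs_sum_le_sum_abs _ _

lemma expGrowth_full (j : ZMod q) : ExpGrowth fun x : NZ q → ℝ => ((full x j : ℝ) : ℂ) :=
  ExpGrowth.of_le_sum_abs (Complex.continuous_ofReal.comp (continuous_full j)) zero_le_one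
    fun x => by simpa using abs_full_le x j

lemma expGrowth_coeff_limitExponent (l : NZ q →₀ ℕ) :
    ExpGrowth fun x : NZ q → ℝ => MvPolynomial.coeff l (limitExponent x) := by
  simp only [limitExponent, MvPolynomial.coeff_add, MvPolynomial.coeff_C_mul,
    MvPolynomial.coeff_sum]
  refine (ExpGrowth.const _).add (ExpGrowth.sum _ fun j _ => ?_)
  exact (expGrowth_full j).mul (ExpGrowth.const _)

lemma expGrowth_coeff_limitExponent_pow (s : ℕ) (l : NZ q →₀ ℕ) :
    ExpGrowth fun x : NZ q → ℝ => MvPolynomial.coeff l (limitExponent x ^ s) := by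
  classical
  induction s generalizing l with
  | zero => simpa using ExpGrowth.const _
  | succ s ih =>
    simp_rw [pow_succ, MvPolynomial.coeff_mul]
    exact ExpGrowth.sum _ fun p _ => (ih _).mul (expGrowth_coeff_limitExponent _)

lemma expGrowth_limitPoly (l : NZ q →₀ ℕ) : ExpGrowth (limitPoly l) := by
  unfold limitPoly
  refine ExpGrowth.sum _ fun s _ => ?_
  simp_rw [div_eq_mul_inv]
  exact (expGrowth_coeff_limitExponent_pow s l).mul (ExpGrowth.const _)

/-- The substitution which diagonalizes the exponent of `phi`. -/
def diagMatrix (q : ℕ) [NeZero q] : Matrix (NZ q) (NZ q) ℝ :=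
  1 + Matrix.replicateCol Unit (fun _ : NZ q => -(1 / (Real.sqrt q * (Real.sqrt q + 1))))
    * Matrix.replicateRow Unit (fun _ : NZ q => (1 : ℝ))

lemma card_NZ : Fintype.card (NZ q) = q - 1 := by
  have := sum_zmod (q := q) (fun _ => (1 : ℕ))
  simp only [Finset.sum_const, Finset.card_univ, ZMod.card, smul_eq_mul, mul_one] at this
  omega

lemma card_NZ_real : (Fintype.card (NZ q) : ℝ) = q - 1 := by
  rw [card_NZ, Nat.cast_sub NeZero.one_le, Nat.cast_one]

lemma sqrt_q_pos : 0 < Real.sqrt q := Real.sqrt_pos.2 (Nat.cast_pos.2 (NeZero.pos q))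

/-- For a rank-one perturbation of the identity the determinant is `1 - c (q - 1)`, here with `c = 1
/ (√q (√q + 1))` and `q - 1 = (√q - 1)(√q + 1)`. -/
lemma det_diagMatrix : (diagMatrix q).det = (Real.sqrt q)⁻¹ := by
  have h := sqrt_q_pos (q := q)
  have hsq : Real.sqrt q ^ 2 = (q : ℝ) := Real.sq_sqrt (Nat.cast_nonneg q)
  rw [diagMatrix, Matrix.det_one_add_replicateCol_mul_replicateRow]
  simp only [dotProduct, one_mul, Finset.sum_const, Finset.card_univ, nsmul_eq_mul, card_NZ_real]
  generalize Real.sqrt q = s at *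
  rw [← hsq]
  field_simp
  ring

lemma toLin_diagMatrix (v : NZ q → ℝ) (k : NZ q) : Matrix.toLin' (diagMatrix q) v k
    = v k - 1 / (Real.sqrt q * (Real.sqrt q + 1)) * ∑ i, v i := by
  rw [Matrix.toLin'_apply, diagMatrix, Matrix.add_mulVec, Matrix.one_mulVec, Pi.add_apply,
    sub_eq_add_neg]
  congr 1
  simp only [Matrix.mulVec, dotProduct, Matrix.mul_apply, Matrix.replicateCol_apply,
    Matrix.replicateRow_apply, Finset.univ_unique, Finset.sum_singleton, mul_one, Finset.mul_sum,
    neg_mul]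
  rw [← Finset.sum_neg_distrib]

lemma sum_full_sq (x : NZ q → ℝ) : ∑ j, full x j ^ 2 = (∑ k, x k) ^ 2 + ∑ k, x k ^ 2 := by
  rw [sum_zmod]
  have h (k : NZ q) : full x k.1 = x k := by simp [full, k.2]
  have h0 : full x 0 = -∑ k, x k := by simp [full]
  simp_rw [h, h0, neg_sq]

/-- The form `∑ x_k² + (∑ x_k)²` has eigenvalue `q` on the constant vectors and `1` on the vectors
of sum zero. The matrix divides the former by `√q` and fixes the latter. -/
lemma sum_full_sq_diag (v : NZ q → ℝ) :
    ∑ j, full (Matrix.toLin' (diagMatrix q) v) j ^ 2 = ∑ k, v k ^ 2 := by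
  have h := sqrt_q_pos (q := q)
  have hsq : Real.sqrt q ^ 2 = (q : ℝ) := Real.sq_sqrt (Nat.cast_nonneg q)
  rw [sum_full_sq]
  simp_rw [toLin_diagMatrix]
  obtain ⟨c, hc⟩ : ∃ c : ℝ, c = 1 / (Real.sqrt q * (Real.sqrt q + 1)) := ⟨_, rfl⟩
  obtain ⟨S, hS⟩ : ∃ S : ℝ, S = ∑ i, v i := ⟨_, rfl⟩
  rw [← hc, ← hS]
  have h1 : ∑ k, (v k - c * S) = S - (q - 1) * (c * S) := by
    rw [Finset.sum_sub_distrib, Finset.sum_const, Finset.card_univ, nsmul_eq_mul, card_NZ_real,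
      hS]
  have h2 : ∑ k, (v k - c * S) ^ 2 = ∑ k, v k ^ 2 - 2 * (c * S) * S + (q - 1) * (c * S) ^ 2 := by
    simp_rw [sub_sq, Finset.sum_add_distrib, Finset.sum_sub_distrib]
    rw [Finset.sum_const, Finset.card_univ, nsmul_eq_mul, card_NZ_real]
    congr 2
    rw [← Finset.sum_mul, ← Finset.mul_sum, ← hS]
    ring
  rw [h1, h2, hc]
  generalize Real.sqrt q = s at *
  rw [← hsq]
  field_simp
  ring

lemma integral_comp_diag (f : (NZ q → ℝ) → ℂ) (hf : Continuous f) :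
    ∫ x, f x = ((Real.sqrt q)⁻¹ : ℝ) * ∫ v, f (Matrix.toLin' (diagMatrix q) v) := by
  have h := sqrt_q_pos (q := q)
  have hdet : (diagMatrix q).det ≠ 0 := by rw [det_diagMatrix]; exact (inv_pos.2 h).ne'
  have hmap := Real.map_matrix_volume_pi_eq_smul_volume_pi hdet
  have hL : Continuous (Matrix.toLin' (diagMatrix q)) := LinearMap.continuous_of_finiteDimensional _
  have h1 : ∫ x, f x ∂(Measure.map (Matrix.toLin' (diagMatrix q)) volume)
      = ∫ v, f (Matrix.toLin' (diagMatrix q) v) :=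
    integral_map hL.aemeasurable hf.aestronglyMeasurable
  rw [hmap, integral_smul_measure, det_diagMatrix, inv_inv, abs_of_pos h,
    ENNReal.toReal_ofReal h.le] at h1
  rw [← h1, Complex.real_smul, ← mul_assoc, ← Complex.ofReal_mul, inv_mul_cancel₀ h.ne',
    Complex.ofReal_one, one_mul]

lemma sum_full_mul (x : NZ q → ℝ) (y : ZMod q → ℂ) :
    ∑ j, (full x j : ℂ) * y j = ∑ k : NZ q, (y k.1 - y 0) * x k := by
  rw [sum_zmod]
  have h (k : NZ q) : full x k.1 = x k := by simp [full, k.2]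
  have h0 : full x 0 = -∑ k, x k := by simp [full]
  simp_rw [h, h0]
  push_cast
  rw [neg_mul, Finset.sum_mul, ← Finset.sum_neg_distrib, ← Finset.sum_add_distrib]
  exact Finset.sum_congr rfl fun k _ => by ring

/-- The Laplace transform of the limit normal law. -/
lemma integral_gauss_exp (y : ZMod q → ℂ) (hy : ∑ j, y j = 0) :
    ∫ x, Complex.exp (∑ j, (full x j : ℂ) * y j) ∂(gauss q)
      = Complex.exp ((q : ℂ)⁻¹ / 2 * ∑ j, y j ^ 2) := by
  have h := sqrt_q_pos (q := q)
  have hq : (0 : ℝ) < q := Nat.cast_pos.2 (NeZero.pos q)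
  have hsq : Real.sqrt q ^ 2 = (q : ℝ) := Real.sq_sqrt (Nat.cast_nonneg q)
  obtain ⟨A, hA⟩ : ∃ A : ℝ, A = Real.sqrt (2 * Real.pi) / Real.sqrt (2 * Real.pi) ^ q
    * Real.sqrt q ^ q := ⟨_, rfl⟩
  obtain ⟨c, hc⟩ : ∃ c : ℝ, c = 1 / (Real.sqrt q * (Real.sqrt q + 1)) := ⟨_, rfl⟩
  have hZ : ∑ k : NZ q, (y k.1 - y 0) = -q * y 0 := by
    rw [sum_zmod] at hy
    rw [Finset.sum_sub_distrib, Finset.sum_const, Finset.card_univ, card_NZ, nsmul_eq_mul,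
      Nat.cast_sub NeZero.one_le, Nat.cast_one]
    linear_combination hy
  -- `ζ` is the linear form after the substitution. The rank-one part of the matrix contributes `-c`
  -- times the sum of the `y k - y 0`, which is `-q y 0` because `y` sums to zero.
  set ζ : NZ q → ℂ := fun k => (y k.1 - y 0) + c * (q * y 0) with hζ
  have hcont : Continuous fun x : NZ q → ℝ =>
      phi x • Complex.exp (∑ j, (full x j : ℂ) * y j) := by
    have := fun j => continuous_full (q := q) j
    have := continuous_phi (q := q)
    fun_prop
  rw [integral_gauss, integral_comp_diag _ hcont]
  have hint (v : NZ q → ℝ) : phi (Matrix.toLin' (diagMatrix q) v)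
      • Complex.exp (∑ j, (full (Matrix.toLin' (diagMatrix q) v) j : ℂ) * y j)
      = A * Complex.exp (-((q : ℂ) / 2) * ∑ k, (v k : ℂ) ^ 2 + ∑ k, ζ k * v k) := by
    rw [phi_eq, sum_full_sq_diag, ← hA, sum_full_mul, Complex.real_smul, Complex.exp_add]
    push_cast
    rw [mul_assoc]
    congr 3
    simp_rw [toLin_diagMatrix, ← hc]
    push_cast
    simp_rw [mul_sub, Finset.sum_sub_distrib, ← Finset.sum_mul, hZ, hζ, add_mul,
      Finset.sum_add_distrib, Finset.mul_sum]
    rw [sub_eq_add_neg, ← Finset.sum_neg_distrib]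
    congr 1
    exact Finset.sum_congr rfl fun k _ => by ring
  simp_rw [hint]
  rw [integral_const_mul, GaussianFourier.integral_cexp_neg_mul_sum_add (by simpa using hq)]
  have hexp : (∑ k, ζ k ^ 2) / (4 * ((q : ℂ) / 2)) = (q : ℂ)⁻¹ / 2 * ∑ j, y j ^ 2 := by
    have hqc : (q : ℂ) ≠ 0 := Nat.cast_ne_zero.2 (NeZero.ne q)
    have hs : (Real.sqrt q : ℂ) ≠ 0 := Complex.ofReal_ne_zero.2 h.ne'
    have hs1 : (Real.sqrt q : ℂ) + 1 ≠ 0 := by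
      rw [← Complex.ofReal_one, ← Complex.ofReal_add]
      exact Complex.ofReal_ne_zero.2 (by linarith)
    have hsqc : (q : ℂ) = (Real.sqrt q : ℂ) ^ 2 := by
      rw [← Complex.ofReal_pow, hsq, Complex.ofReal_natCast]
    have h1 : ∑ k, ζ k ^ 2 = ∑ k : NZ q, y k.1 ^ 2 - 2 * (y 0 - c * (q * y 0)) * ∑ k : NZ q, y k.1
        + (q - 1) * (y 0 - c * (q * y 0)) ^ 2 := by
      have h2 (k : NZ q) : ζ k ^ 2 = y k.1 ^ 2 - 2 * (y 0 - c * (q * y 0)) * y k.1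
          + (y 0 - c * (q * y 0)) ^ 2 := by rw [hζ]; ring
      simp_rw [h2, Finset.sum_add_distrib, Finset.sum_sub_distrib, ← Finset.mul_sum]
      rw [Finset.sum_const, Finset.card_univ, card_NZ, nsmul_eq_mul,
        Nat.cast_sub NeZero.one_le, Nat.cast_one]
    have h3 : ∑ k : NZ q, y k.1 = - y 0 := by
      rw [sum_zmod] at hy
      linear_combination hy
    rw [h1, h3, sum_zmod (fun j => y j ^ 2)]
    have h4 : (c : ℂ) = 1 / ((Real.sqrt q : ℂ) * ((Real.sqrt q : ℂ) + 1)) := by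
      rw [hc]; push_cast; ring
    have h5 : (c : ℂ) * q = (Real.sqrt q : ℂ) / ((Real.sqrt q : ℂ) + 1) := by
      rw [h4]
      generalize (Real.sqrt q : ℂ) = s at *
      rw [hsqc]
      field_simp
    have h6 : (y 0 - c * (q * y 0)) = y 0 / ((Real.sqrt q : ℂ) + 1) := by
      rw [← mul_assoc, h5]; field_simp; ring
    have h7 : - 2 * (y 0 - c * (q * y 0)) * (- y 0) + (q - 1) * (y 0 - c * (q * y 0)) ^ 2
        = y 0 ^ 2 := by
      rw [h6]
      generalize (Real.sqrt q : ℂ) = s at *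
      rw [hsqc]
      field_simp
      ring
    have h8 : ∑ k : NZ q, y k.1 ^ 2 - 2 * (y 0 - c * (q * y 0)) * (-y 0)
        + (q - 1) * (y 0 - c * (q * y 0)) ^ 2 = y 0 ^ 2 + ∑ k : NZ q, y k.1 ^ 2 := by
      linear_combination h7
    rw [h8]
    field_simp
    norm_num
  have hconst : ((Real.sqrt q)⁻¹ : ℝ) * ((A : ℂ) *
      ((Real.pi : ℂ) / ((q : ℂ) / 2)) ^ ((Fintype.card (NZ q) : ℂ) / 2)) = 1 := by
    have h1 : ((Real.pi : ℂ) / ((q : ℂ) / 2)) ^ ((Fintype.card (NZ q) : ℂ) / 2)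
        = (((2 * Real.pi / q) ^ (((q : ℝ) - 1) / 2) : ℝ) : ℂ) := by
      rw [Complex.ofReal_cpow (by positivity), ← card_NZ_real]
      push_cast
      congr 1
      field_simp
    have hpi : 0 < 2 * Real.pi := by positivity
    have h2 (z : ℝ) (hz : 0 < z) : z ^ (((q : ℝ) - 1) / 2) = Real.sqrt z ^ q / Real.sqrt z := by
      rw [Real.sqrt_eq_rpow, ← Real.rpow_natCast, ← Real.rpow_mul hz.le, ← Real.rpow_sub hz]
      congr 1; ring
    rw [h1, ← Complex.ofReal_mul, ← Complex.ofReal_mul, ← Complex.ofReal_one]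
    congr 1
    rw [h2 _ (by positivity), Real.sqrt_div hpi.le, hA, div_pow]
    have hp : 0 < Real.sqrt (2 * Real.pi) := Real.sqrt_pos.2 hpi
    field_simp
  rw [hexp, ← mul_assoc, ← mul_assoc, mul_assoc _ (A : ℂ), hconst, one_mul]

instance isProbabilityMeasure_gauss : IsProbabilityMeasure (gauss q) := by
  have h := integral_gauss_exp (q := q) 0 (by simp)
  simp only [Pi.zero_apply, mul_zero, Finset.sum_const_zero, Complex.exp_zero, ne_eq,
    OfNat.ofNat_ne_zero, not_false_eq_true, zero_pow, integral_const, Complex.real_smul,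
    mul_one] at h
  have h1 : (gauss q).real Set.univ = 1 := by exact_mod_cast h
  constructor
  rw [Measure.real] at h1
  exact (ENNReal.toReal_eq_one_iff _).1 h1

lemma trig_eq_exp_full (a x : NZ q → ℝ) :
    trig a x = Complex.exp (∑ j, (full x j : ℂ) * (Complex.I * centred a j)) := by
  rw [sum_full_mul, trig]
  congr 1
  push_cast
  rw [Finset.sum_mul]
  refine Finset.sum_congr rfl fun k _ => ?_
  simp only [centred, k.2, ne_eq, not_false_eq_true, dite_true, not_true_eq_false, dite_false]
  push_cast
  ring

lemma integral_gauss_trig (a : NZ q → ℝ) :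
    ∫ x, trig a x ∂(gauss q) = Complex.exp (-(trigVar a : ℂ) / 2) := by
  simp_rw [trig_eq_exp_full]
  rw [integral_gauss_exp _ (by
    rw [← Finset.mul_sum, ← Complex.ofReal_sum, sum_centred, Complex.ofReal_zero, mul_zero])]
  congr 1
  simp only [mul_pow, Complex.I_sq, trigVar, ← Finset.mul_sum]
  push_cast
  ring

end Gauss

/-! ### Summability of the Hermite coefficients -/

section HermiteSeries

lemma summable_norm_expLin (L : ℂ) : Summable fun i => ‖PowerSeries.coeff i (expLin L)‖ := by
  simp only [expLin, PowerSeries.coeff_mk, norm_div, norm_pow, Complex.norm_natCast]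
  exact Real.summable_pow_div_factorial _

lemma tsum_norm_expLin (L : ℂ) : ∑' i, ‖PowerSeries.coeff i (expLin L)‖ = Real.exp ‖L‖ := by
  simp only [expLin, PowerSeries.coeff_mk, norm_div, norm_pow, Complex.norm_natCast]
  rw [Real.exp_eq_exp_ℝ, NormedSpace.exp_eq_tsum_div]

lemma tsum_expLin (L : ℂ) : ∑' i, PowerSeries.coeff i (expLin L) = Complex.exp L := by
  simp only [expLin, PowerSeries.coeff_mk]
  rw [Complex.exp_eq_exp_ℂ, NormedSpace.exp_eq_tsum_div]

lemma hasSum_expSq (B : ℂ) : HasSum (fun j => PowerSeries.coeff j (expSq B)) (Complex.exp B) := by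
  have hinj : Function.Injective fun k : ℕ => 2 * k := fun a b h => by
    simpa using h
  refine (hinj.hasSum_iff fun j hj => ?_).1 ?_
  · rw [expSq, PowerSeries.coeff_mk, if_neg]
    rintro ⟨k, rfl⟩
    exact hj ⟨k, by ring⟩
  · have h := NormedSpace.expSeries_div_hasSum_exp (𝔸 := ℂ) B
    rw [← Complex.exp_eq_exp_ℂ] at h
    refine h.congr_fun fun k => ?_
    simp [expSq]

lemma summable_norm_expSq (B : ℂ) : Summable fun j => ‖PowerSeries.coeff j (expSq B)‖ :=
  (hasSum_expSq B).summable.norm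

/-- A bound for the Hermite coefficients. -/
def hermBound (L B : ℂ) (n : ℕ) : ℝ := ∑ p ∈ Finset.HasAntidiagonal.antidiagonal n,
  ‖PowerSeries.coeff p.1 (expLin L)‖ * ‖PowerSeries.coeff p.2 (expSq B)‖

lemma norm_herm_le (L B : ℂ) (n : ℕ) : ‖herm L B n‖ ≤ hermBound L B n := by
  rw [herm, PowerSeries.coeff_mul, hermBound]
  refine (norm_sum_le _ _).trans (Finset.sum_le_sum fun p _ => ?_)
  rw [norm_mul]

lemma summable_hermBound (L B : ℂ) : Summable (hermBound L B) := by
  have := (summable_norm_sum_mul_antidiagonal_of_summable_norm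
    (f := fun i => ‖PowerSeries.coeff i (expLin L)‖)
    (g := fun i => ‖PowerSeries.coeff i (expSq B)‖)
    (by simpa using summable_norm_expLin L) (by simpa using summable_norm_expSq B)).of_norm
  exact this

/-- Only `exp ‖L‖` depends on `L`. With `L` linear in the space variable this is integrable for the
normal law, which permits termwise integration. -/
lemma tsum_hermBound (L B : ℂ) : ∑' n, hermBound L B n
    = Real.exp ‖L‖ * ∑' j, ‖PowerSeries.coeff j (expSq B)‖ := by
  rw [← tsum_norm_expLin, tsum_mul_tsum_eq_tsum_sum_antidiagonal_of_summable_norm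
    (f := fun i => ‖PowerSeries.coeff i (expLin L)‖)
    (g := fun i => ‖PowerSeries.coeff i (expSq B)‖)
    (by simpa using summable_norm_expLin L) (by simpa using summable_norm_expSq B)]
  rfl

lemma hasSum_herm (L B : ℂ) : HasSum (herm L B) (Complex.exp (L + B)) := by
  have h1 : Summable (herm L B) :=
    Summable.of_norm_bounded (summable_hermBound L B) (norm_herm_le L B)
  have h2 : ∑' n, herm L B n = Complex.exp (L + B) := by
    rw [Complex.exp_add, ← tsum_expLin, ← (hasSum_expSq B).tsum_eq,
      tsum_mul_tsum_eq_tsum_sum_antidiagonal_of_summable_norm (summable_norm_expLin L)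
        (summable_norm_expSq B)]
    exact tsum_congr fun n => by rw [herm, PowerSeries.coeff_mul]
  rw [← h2]
  exact h1.hasSum

end HermiteSeries

/-! ### Multinomial theorem and comparison of coefficients -/

section Multinomial

variable {ι : Type*} [Fintype ι] [DecidableEq ι]

lemma sum_expTerm (x : ι → ℂ) (n : ℕ) :
    ∑ l ∈ ofDegree ι n, expTerm x l = (∑ k, x k) ^ n / (n.factorial : ℂ) := by
  have hn : (n.factorial : ℂ) ≠ 0 := Nat.cast_ne_zero.2 n.factorial_ne_zero
  rw [Finset.sum_pow_eq_sum_piAntidiag, Finset.sum_div]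
  refine Finset.sum_nbij' (fun l => ⇑l) (fun f => Finsupp.equivFunOnFinite.symm f) ?_ ?_ ?_ ?_ ?_
  · intro l hl
    simpa using mem_ofDegree.1 hl
  · intro f hf
    rw [mem_ofDegree]
    simpa using hf
  · intro l _
    ext k; simp
  · intro f _
    funext k; simp
  · intro l hl
    have h := Nat.multinomial_spec Finset.univ ⇑l
    rw [mem_ofDegree.1 hl] at h
    have h2 : (∏ k, ((l k).factorial : ℂ)) * (Nat.multinomial Finset.univ ⇑l : ℂ)
        = n.factorial := by exact_mod_cast h
    have h3 : (∏ k, ((l k).factorial : ℂ)) ≠ 0 :=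
      Finset.prod_ne_zero_iff.2 fun k _ => Nat.cast_ne_zero.2 (Nat.factorial_ne_zero _)
    rw [expTerm, Finset.prod_div_distrib, div_eq_div_iff h3 hn, ← h2]
    ring

lemma eq_of_sum_eq {T : Finset (ι →₀ ℕ)} {c c0 : (ι →₀ ℕ) → ℂ}
    (h : ∀ w : ι → ℂ, ∑ l ∈ T, c l * ∏ k, w k ^ l k = ∑ l ∈ T, c0 l * ∏ k, w k ^ l k)
    {l : ι →₀ ℕ} (hl : l ∈ T) : c l = c0 l :=
  tendsto_nhds_unique (tendsto_const_nhds (x := c l) (f := (atTop : Filter ℕ)))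
    (tendsto_coeff_of_tendsto_eval (c := fun _ => c) (c0 := c0)
      (fun w => by rw [h w]; exact tendsto_const_nhds) hl)

end Multinomial

/-- Both are power series of `f` at zero, and that expansion is unique. -/
lemma eq_of_hasSum_pow {p p' : ℕ → ℂ} {f : ℂ → ℂ} (h : ∀ t, HasSum (fun n => t ^ n * p n) (f t))
    (h' : ∀ t, HasSum (fun n => t ^ n * p' n) (f t)) : p = p' := by
  have key (p : ℕ → ℂ) (h : ∀ t, HasSum (fun n => t ^ n * p n) (f t)) :
      HasFPowerSeriesAt f (FormalMultilinearSeries.ofScalars ℂ p) 0 := by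
    rw [hasFPowerSeriesAt_iff]
    refine .of_forall fun z => ?_
    simpa [FormalMultilinearSeries.coeff_ofScalars] using h z
  have := (key p h).eq_formalMultilinearSeries (key p' h')
  funext n
  rw [← FormalMultilinearSeries.coeff_ofScalars (𝕜 := ℂ) (p := p), this,
    FormalMultilinearSeries.coeff_ofScalars]

/-! ### Fourier transforms of the limit polynomials -/

section TransformLimitPoly

variable {q : ℕ} [NeZero q]

lemma norm_linCoeff_le (w : NZ q → ℂ) (x : NZ q → ℝ) :
    ‖linCoeff w x‖ ≤ (∑ j, ‖linForm w j‖) * ∑ k, |x k| := by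
  rw [linCoeff, Finset.sum_mul]
  refine (norm_sum_le _ _).trans (Finset.sum_le_sum fun j _ => ?_)
  rw [norm_mul, mul_comm, Complex.norm_real, Real.norm_eq_abs]
  gcongr
  exact abs_full_le x j

lemma continuous_linCoeff (w : NZ q → ℂ) : Continuous fun x => linCoeff w x := by
  unfold linCoeff
  have := fun j => continuous_full (q := q) j
  fun_prop

/-- This is the Laplace transform at `I * centred a + linForm w`. The square of `linForm` cancels
against `sqCoeff`, and only the variance and the cross term remain. -/
lemma integral_trig_mul_exp (a : NZ q → ℝ) (w : NZ q → ℂ) :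
    ∫ x, trig a x * Complex.exp (linCoeff w x + sqCoeff w) ∂(gauss q)
      = Complex.exp (-(trigVar a : ℂ) / 2)
        * Complex.exp (∑ k : NZ q, Complex.I * centredCoeff a k.1 * w k) := by
  have h1 (x : NZ q → ℝ) : trig a x * Complex.exp (linCoeff w x + sqCoeff w)
      = Complex.exp (sqCoeff w) * Complex.exp (∑ j, (full x j : ℂ)
        * (Complex.I * centred a j + linForm w j)) := by
    rw [trig_eq_exp_full, ← Complex.exp_add, ← Complex.exp_add, linCoeff]
    congr 1
    simp_rw [mul_add, Finset.sum_add_distrib]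
    ring
  simp_rw [h1]
  rw [integral_const_mul, integral_gauss_exp, ← Complex.exp_add, ← Complex.exp_add]
  · congr 1
    have h2 : ∑ k : NZ q, Complex.I * centredCoeff a k.1 * w k
        = Complex.I * ((q : ℂ)⁻¹ * ∑ j, (centred a j : ℂ) * linForm w j) := by
      simp only [centredCoeff, fourierCoeff, linForm, Finset.mul_sum, Finset.sum_mul]
      rw [Finset.sum_comm]
      exact Finset.sum_congr rfl fun j _ => Finset.sum_congr rfl fun k _ => by ring
    have h3 : ∑ j, (Complex.I * centred a j + linForm w j) ^ 2
        = -∑ j, (centred a j : ℂ) ^ 2 + 2 * Complex.I * ∑ j, (centred a j : ℂ) * linForm w j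
          + ∑ j, linForm w j ^ 2 := by
      rw [Finset.mul_sum, ← Finset.sum_neg_distrib, ← Finset.sum_add_distrib,
        ← Finset.sum_add_distrib]
      refine Finset.sum_congr rfl fun j _ => ?_
      linear_combination (centred a j : ℂ) ^ 2 * Complex.I_sq
    rw [h2, h3, sqCoeff, trigVar]
    have hq : (q : ℂ) ≠ 0 := Nat.cast_ne_zero.2 (NeZero.ne q)
    push_cast
    field_simp
    ring
  · rw [Finset.sum_add_distrib, ← Finset.mul_sum, ← Complex.ofReal_sum, sum_centred, sum_linForm]
    simp

lemma hasSum_integral_trig_mul_herm (a : NZ q → ℝ) (w : NZ q → ℂ) :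
    HasSum (fun n => ∫ x, trig a x * herm (linCoeff w x) (sqCoeff w) n ∂(gauss q))
      (Complex.exp (-(trigVar a : ℂ) / 2)
        * Complex.exp (∑ k : NZ q, Complex.I * centredCoeff a k.1 * w k)) := by
  rw [← integral_trig_mul_exp]
  have hcont (n : ℕ) : Continuous fun x : NZ q → ℝ => herm (linCoeff w x) (sqCoeff w) n := by
    simp_rw [← sum_limitPoly]
    exact continuous_finsetSum _ fun l _ => (expGrowth_limitPoly l).1.mul continuous_const
  refine hasSum_integral_of_dominated_convergence
    (fun n x => hermBound (linCoeff w x) (sqCoeff w) n) (fun n => ?_)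
    (fun n => .of_forall fun x => ?_) (.of_forall fun x => summable_hermBound _ _) ?_
    (.of_forall fun x => (hasSum_herm _ _).mul_left _)
  · exact ((continuous_trig a).mul (hcont n)).aestronglyMeasurable
  · rw [norm_mul, norm_trig, one_mul]
    exact norm_herm_le _ _ _
  · simp_rw [tsum_hermBound]
    refine Integrable.mul_const ?_ _
    refine (integrable_exp_sum_abs (∑ j, ‖linForm w j‖)).mono' ?_ (.of_forall fun x => ?_)
    · exact (Real.continuous_exp.comp (continuous_linCoeff w).norm).aestronglyMeasurable
    · rw [Real.norm_of_nonneg (Real.exp_nonneg _)]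
      exact Real.exp_le_exp.2 (norm_linCoeff_le w x)

/-- The transform of the limit polynomials. -/
lemma integral_trig_mul_limitPoly (a : NZ q → ℝ) (l : NZ q →₀ ℕ) :
    ∫ x, trig a x * limitPoly l x ∂(gauss q) = Complex.exp (-(trigVar a : ℂ) / 2)
      * expTerm (fun k : NZ q => Complex.I * centredCoeff a k.1) l := by
  let J (w : NZ q → ℂ) (n : ℕ) : ℂ := ∑ l ∈ ofDegree (NZ q) n,
    (∫ x, trig a x * limitPoly l x ∂(gauss q)) * ∏ k, w k ^ l k
  have hJ (w : NZ q → ℂ) (n : ℕ) :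
      ∫ x, trig a x * herm (linCoeff w x) (sqCoeff w) n ∂(gauss q) = J w n := by
    simp_rw [← sum_limitPoly, Finset.mul_sum, ← mul_assoc]
    rw [integral_finsetSum _ fun l _ =>
      (((ExpGrowth.trig a).mul (expGrowth_limitPoly l)).mul (ExpGrowth.const _)).integrable]
    exact Finset.sum_congr rfl fun l _ => integral_mul_const _ _
  have hJs (w : NZ q → ℂ) (t : ℂ) (n : ℕ) : J (fun k => t * w k) n = t ^ n * J w n := by
    simp only [J, Finset.mul_sum]
    refine Finset.sum_congr rfl fun l hl => ?_
    simp_rw [mul_pow, Finset.prod_mul_distrib, Finset.prod_pow_eq_pow_sum, mem_ofDegree.1 hl]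
    ring
  -- Replacing `w` by `t w` turns the sum over degrees into a power series in `t`, so each degree
  -- can be compared with the exponential series. Varying `w` within one degree then separates the
  -- multi-indices.
  have key (w : NZ q → ℂ) : J w = fun n => Complex.exp (-(trigVar a : ℂ) / 2)
      * ((∑ k : NZ q, Complex.I * centredCoeff a k.1 * w k) ^ n / n.factorial) := by
    refine eq_of_hasSum_pow (f := fun t => Complex.exp (-(trigVar a : ℂ) / 2)
        * Complex.exp (t * ∑ k : NZ q, Complex.I * centredCoeff a k.1 * w k))
        (fun t => ?_) fun t => ?_
    · have h := hasSum_integral_trig_mul_herm a fun k => t * w k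
      simp_rw [hJ, hJs] at h
      convert h using 3
      rw [Finset.mul_sum]
      exact Finset.sum_congr rfl fun k _ => by ring
    · have h := NormedSpace.expSeries_div_hasSum_exp (𝔸 := ℂ)
        (t * ∑ k : NZ q, Complex.I * centredCoeff a k.1 * w k)
      rw [← Complex.exp_eq_exp_ℂ] at h
      refine (h.mul_left (Complex.exp (-(trigVar a : ℂ) / 2))).congr_fun fun n => ?_
      rw [mul_pow]
      ring
  refine eq_of_sum_eq (T := ofDegree (NZ q) (∑ k, l k))
    (c := fun l => ∫ x, trig a x * limitPoly l x ∂(gauss q))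
    (c0 := fun l => Complex.exp (-(trigVar a : ℂ) / 2)
      * expTerm (fun k : NZ q => Complex.I * centredCoeff a k.1) l) (fun w => ?_)
    (mem_ofDegree.2 rfl)
  have h1 := congrFun (key w) (∑ k, l k)
  refine h1.trans ?_
  rw [← sum_expTerm, Finset.mul_sum]
  refine Finset.sum_congr rfl fun l' _ => ?_
  simp only [expTerm, mul_pow, mul_div_right_comm, Finset.prod_mul_distrib]
  ring

end TransformLimitPoly

/-! ### Density of the trigonometric functions in `L²` -/

section TrigDense

variable {ι : Type*} [Fintype ι]

lemma charFunDual_eq_integral_trig [DecidableEq ι] (μ : Measure (ι → ℝ))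
    (L : StrongDual ℝ (ι → ℝ)) :
    charFunDual μ L = ∫ x, trig (fun k => L (Pi.single k 1)) x ∂μ := by
  rw [charFunDual_apply]
  refine integral_congr_ae (.of_forall fun x => ?_)
  have h : L x = ∑ k, L (Pi.single k 1) * x k := by
    conv_lhs => rw [← Finset.univ_sum_single x]
    rw [map_sum]
    refine Finset.sum_congr rfl fun k _ => ?_
    have : (Pi.single k (x k) : ι → ℝ) = x k • Pi.single k 1 := by
      rw [← Pi.single_smul, smul_eq_mul, mul_one]
    simp [this, mul_comm]
  simp only [trig, h]

lemma ext_of_integral_trig {μ ν : Measure (ι → ℝ)} [IsFiniteMeasure μ] [IsFiniteMeasure ν]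
    (h : ∀ a : ι → ℝ, ∫ x, trig a x ∂μ = ∫ x, trig a x ∂ν) : μ = ν := by
  classical
  refine Measure.ext_of_charFunDual (funext fun L => ?_)
  rw [charFunDual_eq_integral_trig, charFunDual_eq_integral_trig, h]

lemma integrable_trig_mul {μ : Measure (ι → ℝ)} (a : ι → ℝ) {f : (ι → ℝ) → ℂ}
    (hf : Integrable f μ) : Integrable (fun x => trig a x * f x) μ :=
  hf.bdd_mul (c := 1) (continuous_trig a).aestronglyMeasurable
    (.of_forall fun x => (norm_trig a x).le)

/-- The positive and negative parts of `r` are densities of two finite measures with the same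
Fourier transform, so these measures coincide. -/
lemma ae_eq_zero_of_integral_trig_mul_ofReal {μ : Measure (ι → ℝ)} [IsFiniteMeasure μ]
    {r : (ι → ℝ) → ℝ} (hr : Integrable r μ) (h : ∀ a, ∫ x, trig a x * (r x : ℂ) ∂μ = 0) :
    r =ᵐ[μ] 0 := by
  have hfin (r : (ι → ℝ) → ℝ) (hr : Integrable r μ) :
      IsFiniteMeasure (μ.withDensity fun x => ENNReal.ofReal (r x)) :=
    isFiniteMeasure_withDensity_ofReal hr.2
  have hm (r : (ι → ℝ) → ℝ) (hr : Integrable r μ) (a : ι → ℝ) :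
      ∫ x, trig a x ∂(μ.withDensity fun x => ENNReal.ofReal (r x))
        = ∫ x, trig a x * ((max (r x) 0 : ℝ) : ℂ) ∂μ := by
    rw [integral_withDensity_eq_integral_toReal_smul₀ hr.1.aemeasurable.ennreal_ofReal
      (.of_forall fun x => ENNReal.ofReal_lt_top)]
    refine integral_congr_ae (.of_forall fun x => ?_)
    simp only [Complex.real_smul]
    rw [ENNReal.toReal_ofReal', mul_comm]
  have := hfin r hr
  have := hfin _ hr.neg
  have heq : (μ.withDensity fun x => ENNReal.ofReal (r x))
      = μ.withDensity fun x => ENNReal.ofReal ((-r) x) := by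
    refine ext_of_integral_trig fun a => ?_
    rw [hm r hr, hm _ hr.neg, ← sub_eq_zero, ← integral_sub
      (integrable_trig_mul a (f := fun x => ((max (r x) 0 : ℝ) : ℂ)) hr.pos_part.ofReal)
      (integrable_trig_mul a (f := fun x => ((max ((-r) x) 0 : ℝ) : ℂ)) hr.neg.pos_part.ofReal),
      ← h a]
    refine integral_congr_ae (.of_forall fun x => ?_)
    simp only [Pi.neg_apply]
    rw [← mul_sub, ← Complex.ofReal_sub, max_zero_sub_max_neg_zero_eq_self]
  have := (withDensity_eq_iff hr.1.aemeasurable.ennreal_ofReal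
    hr.neg.1.aemeasurable.ennreal_ofReal ?_).1 heq
  · filter_upwards [this] with x hx
    have h1 := congrArg ENNReal.toReal hx
    simp only [ENNReal.toReal_ofReal', Pi.neg_apply] at h1
    have := max_zero_sub_max_neg_zero_eq_self (r x)
    simp only [Pi.zero_apply]
    linarith
  · exact hr.lintegral_lt_top.ne

/-- The frequencies are closed under negation, so the conjugate of `f` also has zero transform, and
hence so do its real and imaginary parts. -/
lemma ae_eq_zero_of_integral_trig_mul {μ : Measure (ι → ℝ)} [IsFiniteMeasure μ]
    {f : (ι → ℝ) → ℂ} (hf : Integrable f μ) (h : ∀ a, ∫ x, trig a x * f x ∂μ = 0) :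
    f =ᵐ[μ] 0 := by
  have hconj (a : ι → ℝ) : ∫ x, trig a x * (starRingEnd ℂ) (f x) ∂μ = 0 := by
    have h1 := congrArg (starRingEnd ℂ) (h (-a))
    rw [← integral_conj, map_zero] at h1
    rw [← h1]
    refine integral_congr_ae (.of_forall fun x => ?_)
    simp [conj_trig]
  have hcf : Integrable (fun x => (starRingEnd ℂ) (f x)) μ :=
    Complex.conjLIE.integrable_comp_iff.2 hf
  have hre : (fun x => (f x).re) =ᵐ[μ] 0 := by
    refine ae_eq_zero_of_integral_trig_mul_ofReal hf.re fun a => ?_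
    have h2 (x : ι → ℝ) : trig a x * ((f x).re : ℂ)
        = (1 / 2) * (trig a x * f x + trig a x * (starRingEnd ℂ) (f x)) := by
      rw [Complex.re_eq_add_conj]; ring
    simp_rw [h2]
    rw [integral_const_mul, integral_add (integrable_trig_mul a hf) (integrable_trig_mul a hcf),
      h, hconj]
    simp
  have him : (fun x => (f x).im) =ᵐ[μ] 0 := by
    refine ae_eq_zero_of_integral_trig_mul_ofReal hf.im fun a => ?_
    have h2 (x : ι → ℝ) : trig a x * ((f x).im : ℂ)
        = (1 / (2 * Complex.I)) * (trig a x * f x - trig a x * (starRingEnd ℂ) (f x)) := by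
      rw [Complex.im_eq_sub_conj]; ring
    simp_rw [h2]
    rw [integral_const_mul, integral_sub (integrable_trig_mul a hf) (integrable_trig_mul a hcf),
      h, hconj]
    simp
  filter_upwards [hre, him] with x h1 h2
  exact Complex.ext h1 h2

lemma memLp_trig (μ : Measure (ι → ℝ)) [IsFiniteMeasure μ] (a : ι → ℝ) : MemLp (trig a) 2 μ :=
  MemLp.of_bound (continuous_trig a).aestronglyMeasurable 1
    (.of_forall fun x => (norm_trig a x).le)

lemma inner_toLp {X : Type*} [MeasurableSpace X] {μ : Measure X} {f g : X → ℂ} (hf : MemLp f 2 μ)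
    (hg : MemLp g 2 μ) :
    inner ℂ (hf.toLp f) (hg.toLp g) = ∫ x, (starRingEnd ℂ) (f x) * g x ∂μ := by
  rw [L2.inner_def]
  refine integral_congr_ae ?_
  filter_upwards [hf.coeFn_toLp, hg.coeFn_toLp] with x h1 h2
  rw [h1, h2, RCLike.inner_apply, mul_comm]

/-- The trigonometric functions span a dense subspace of `L²`. -/
lemma dense_span_trig (μ : Measure (ι → ℝ)) [IsFiniteMeasure μ] :
    Dense (Submodule.span ℂ (Set.range fun a => (memLp_trig μ a).toLp (trig a)) :
      Set (Lp ℂ 2 μ)) := by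
  rw [Submodule.dense_iff_topologicalClosure_eq_top, Submodule.topologicalClosure_eq_top_iff,
    Submodule.eq_bot_iff]
  intro h hh
  rw [Submodule.mem_orthogonal] at hh
  have h1 (a : ι → ℝ) : ∫ x, trig a x * h x ∂μ = 0 := by
    have := hh _ (Submodule.subset_span ⟨-a, rfl⟩)
    rw [← Lp.toLp_coeFn h (Lp.memLp h), inner_toLp] at this
    rw [← this]
    refine integral_congr_ae (.of_forall fun x => ?_)
    simp [conj_trig]
  rw [Lp.eq_zero_iff_ae_eq_zero]
  exact ae_eq_zero_of_integral_trig_mul ((Lp.memLp h).integrable (by norm_num)) h1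

end TrigDense

/-! ### Diagonal forms in a Bessel family -/

section Frame

variable {H ι : Type*} [NormedAddCommGroup H] [InnerProductSpace ℂ H] {e : ι → H} {S : Set H}

/-- Bessel's inequality for a family whose Gram identity holds on a set with dense span. -/
lemma sum_norm_inner_sq_le (hS : Dense (Submodule.span ℂ S : Set H))
    (he : ∀ s ∈ S, ∀ t ∈ S, HasSum (fun l => inner ℂ s (e l) * inner ℂ (e l) t) (inner ℂ s t))
    (T : Finset ι) (f : H) : ∑ l ∈ T, ‖inner ℂ (e l) f‖ ^ 2 ≤ ‖f‖ ^ 2 := by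
  have h1 : ∀ s ∈ S, ∀ y ∈ Submodule.span ℂ S,
      HasSum (fun l => inner ℂ s (e l) * inner ℂ (e l) y) (inner ℂ s y) := by
    intro s hs y hy
    induction hy using Submodule.span_induction with
    | mem t ht => exact he s hs t ht
    | zero => simp
    | add x y _ _ hx hy => simpa [inner_add_right, mul_add] using hx.add hy
    | smul c x _ hx => simpa [inner_smul_right, mul_left_comm] using hx.mul_left c
  have h2 : ∀ y ∈ Submodule.span ℂ S, ∀ x ∈ Submodule.span ℂ S,
      HasSum (fun l => inner ℂ x (e l) * inner ℂ (e l) y) (inner ℂ x y) := by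
    intro y hy x hx
    induction hx using Submodule.span_induction with
    | mem t ht => exact h1 t ht y hy
    | zero => simp
    | add x y _ _ hx hy => simpa [inner_add_left, add_mul] using hx.add hy
    | smul c x _ hx =>
      simpa only [inner_smul_left, mul_assoc] using hx.mul_left ((starRingEnd ℂ) c)
  -- On the span the full series equals `‖f‖²`, so its partial sums are smaller. For a fixed finite
  -- `T` this inequality passes to the closure.
  have hcl : IsClosed {f : H | ∑ l ∈ T, ‖inner ℂ (e l) f‖ ^ 2 ≤ ‖f‖ ^ 2} :=
    isClosed_le (by fun_prop) (by fun_prop)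
  refine hcl.closure_subset_iff.2 (fun f hf => ?_) (hS.closure_eq ▸ Set.mem_univ f)
  have h3 := (Complex.hasSum_re (h2 f hf f hf))
  have h4 (l : ι) : (inner ℂ f (e l) * inner ℂ (e l) f).re = ‖inner ℂ (e l) f‖ ^ 2 := by
    rw [← inner_conj_symm f (e l), mul_comm, Complex.mul_conj, Complex.ofReal_re,
      Complex.normSq_eq_norm_sq]
  have h5 : (inner ℂ f f).re = ‖f‖ ^ 2 := by
    rw [← inner_self_eq_norm_sq (𝕜 := ℂ)]; rfl
  simp_rw [h4, h5] at h3
  exact sum_le_hasSum T (fun l _ => by positivity) h3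

lemma sum_norm_mul_inner_le {y : ι → ℂ} {C D : ℝ}
    (hy : ∀ T : Finset ι, ∑ l ∈ T, ‖y l‖ ^ 2 ≤ C ^ 2) (hC : 0 ≤ C) {x : ι → ℂ}
    (hx : ∀ T : Finset ι, ∑ l ∈ T, ‖x l‖ ^ 2 ≤ D ^ 2) (hD : 0 ≤ D) (T : Finset ι) :
    ∑ l ∈ T, ‖y l * x l‖ ≤ C * D := by
  simp_rw [norm_mul]
  refine le_of_sq_le_sq ?_ (by positivity)
  refine (Finset.sum_mul_sq_le_sq_mul_sq T _ _).trans ?_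
  rw [mul_pow]
  exact mul_le_mul (hy T) (hx T) (Finset.sum_nonneg fun _ _ => by positivity) (by positivity)

/-- An expansion in a Bessel family extends from a set with dense span. -/
lemma hasSum_of_dense_span (hS : Dense (Submodule.span ℂ S : Set H))
    (he : ∀ (T : Finset ι) (f : H), ∑ l ∈ T, ‖inner ℂ (e l) f‖ ^ 2 ≤ ‖f‖ ^ 2)
    {y : ι → ℂ} {C : ℝ} (hC : 0 ≤ C) (hy : ∀ T : Finset ι, ∑ l ∈ T, ‖y l‖ ^ 2 ≤ C ^ 2)
    (Φ : H →L[ℂ] ℂ) (hΦ : ∀ s ∈ S, HasSum (fun l => y l * inner ℂ (e l) s) (Φ s)) (g : H) :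
    HasSum (fun l => y l * inner ℂ (e l) g) (Φ g) := by
  have hb (g : H) (T : Finset ι) : ∑ l ∈ T, ‖y l * inner ℂ (e l) g‖ ≤ C * ‖g‖ :=
    sum_norm_mul_inner_le hy hC (fun T => he T g) (norm_nonneg g) T
  have hs (g : H) : Summable fun l => ‖y l * inner ℂ (e l) g‖ :=
    summable_of_sum_le (fun _ => norm_nonneg _) (hb g)
  -- By Cauchy–Schwarz and Bessel the series defines a functional of norm at most `C`. It agrees
  -- with `Φ` on a set of dense span.
  let Ψ : H →L[ℂ] ℂ := LinearMap.mkContinuous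
    { toFun := fun g => ∑' l, y l * inner ℂ (e l) g
      map_add' := fun g g' => by
        simp_rw [inner_add_right, mul_add]
        exact (hs g).of_norm.tsum_add (hs g').of_norm
      map_smul' := fun c g => by
        simp_rw [inner_smul_right, mul_left_comm, RingHom.id_apply, smul_eq_mul]
        exact tsum_mul_left } C fun g =>
        (norm_tsum_le_tsum_norm (hs g)).trans ((hs g).tsum_le_of_sum_le (hb g))
  have hΨ : Ψ = Φ := ContinuousLinearMap.ext_on hS fun s hs' => (hΦ s hs').tsum_eq
  rw [← hΨ]
  exact (hs g).of_norm.hasSum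

/-- A bounded sesquilinear form which is diagonal in a Parseval frame on a set with dense span is so
everywhere. -/
lemma hasSum_inner_of_dense_span {K : Type*} [NormedAddCommGroup K] [InnerProductSpace ℂ K]
    (hS : Dense (Submodule.span ℂ S : Set H))
    (he : ∀ s ∈ S, ∀ t ∈ S, HasSum (fun l => inner ℂ s (e l) * inner ℂ (e l) t) (inner ℂ s t))
    {k : ι → ℂ} (hk : ∀ l, ‖k l‖ ≤ 1) (A B : H →L[ℂ] K)
    (h : ∀ s ∈ S, ∀ t ∈ S, HasSum (fun l => k l * inner ℂ s (e l) * inner ℂ (e l) t)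
      (inner ℂ (A s) (B t))) (f g : H) :
    HasSum (fun l => k l * inner ℂ f (e l) * inner ℂ (e l) g) (inner ℂ (A f) (B g)) := by
  have hb := sum_norm_inner_sq_le hS he
  have hk' (y : ι → ℂ) (hy : ∀ l, ‖y l‖ ≤ 1) (f : H) (T : Finset ι) :
      ∑ l ∈ T, ‖y l * inner ℂ f (e l)‖ ^ 2 ≤ ‖f‖ ^ 2 := by
    refine (Finset.sum_le_sum fun l _ => ?_).trans (hb T f)
    rw [norm_mul, norm_inner_symm]
    gcongr
    exact mul_le_of_le_one_left (norm_nonneg _) (hy l)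
  have h1 (s : H) (hs : s ∈ S) (g : H) :
      HasSum (fun l => k l * inner ℂ s (e l) * inner ℂ (e l) g) (inner ℂ (A s) (B g)) :=
    hasSum_of_dense_span hS hb (norm_nonneg s) (hk' k hk s) ((innerSL ℂ (A s)).comp B)
      (fun t ht => h s hs t ht) g
  have hconj (f g : H) (l : ι) : (starRingEnd ℂ) (k l * inner ℂ f (e l) * inner ℂ (e l) g)
      = (starRingEnd ℂ) (k l) * inner ℂ g (e l) * inner ℂ (e l) f := by
    rw [map_mul, map_mul, inner_conj_symm, inner_conj_symm]
    ring
  -- The form is antilinear in its first argument; conjugating the series makes it linear there, so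
  -- that the same extension applies.
  have h2 := hasSum_of_dense_span hS hb (norm_nonneg g)
    (hk' (fun l => (starRingEnd ℂ) (k l)) (fun l => by simpa using hk l) g)
    ((innerSL ℂ (B g)).comp A) (fun s hs => by
      have := Complex.hasSum_conj'.2 (h1 s hs g)
      simp_rw [hconj, inner_conj_symm] at this
      exact this) f
  have h3 := Complex.hasSum_conj'.2 h2
  simp_rw [← hconj f g, Complex.conj_conj] at h3
  rw [← inner_conj_symm (A f) (B g)]
  exact h3

end Frame

/-! ### The limit series as kernel of the limit law -/

section LimitKernel

variable {q : ℕ} [NeZero q]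

/-- Parseval's identity for the centred vectors. -/
lemma sum_centredCoeff_mul_conj (a b : NZ q → ℝ) :
    ∑ k : NZ q, centredCoeff a k.1 * (starRingEnd ℂ) (centredCoeff b k.1)
      = (q : ℂ)⁻¹ * ∑ j, (centred a j : ℂ) * centred b j := by
  have hq : (q : ℂ) ≠ 0 := Nat.cast_ne_zero.2 (NeZero.ne q)
  have h0 : centredCoeff a 0 = 0 := by
    simp only [centredCoeff, fourierCoeff, theta_zero_left, mul_one]
    rw [← Complex.ofReal_sum, sum_centred]
    simp
  have h1 : ∑ k : NZ q, centredCoeff a k.1 * (starRingEnd ℂ) (centredCoeff b k.1)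
      = ∑ k : ZMod q, centredCoeff a k * (starRingEnd ℂ) (centredCoeff b k) := by
    rw [sum_zmod (fun k => centredCoeff a k * (starRingEnd ℂ) (centredCoeff b k)), h0, zero_mul,
      zero_add]
  have h2 (i j : ZMod q) : ∑ k : ZMod q, theta k i * theta k (-j) = if i = j then (q : ℂ) else 0 := by
    simp_rw [← theta_add_right, theta_comm _ (i + -j)]
    rw [sum_theta]
    simp only [← sub_eq_add_neg, sub_eq_zero]
  have h3 (k : ZMod q) : centredCoeff a k * (starRingEnd ℂ) (centredCoeff b k)
      = ∑ i, ∑ j, (q : ℂ)⁻¹ * (q : ℂ)⁻¹ * centred a i * centred b j * (theta k i * theta k (-j)) := by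
    simp only [centredCoeff, fourierCoeff, map_mul, map_sum, map_inv₀, map_natCast,
      Complex.conj_ofReal, conj_theta]
    rw [mul_mul_mul_comm, Finset.sum_mul_sum, Finset.mul_sum]
    refine Finset.sum_congr rfl fun i _ => ?_
    rw [Finset.mul_sum]
    exact Finset.sum_congr rfl fun j _ => by ring
  simp_rw [h1, h3]
  rw [Finset.sum_comm, Finset.mul_sum]
  refine Finset.sum_congr rfl fun i _ => ?_
  rw [Finset.sum_comm]
  simp_rw [← Finset.mul_sum, h2, mul_ite, mul_zero]
  rw [Finset.sum_ite_eq Finset.univ i, if_pos (Finset.mem_univ i)]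
  field_simp

/-- The cross term of the square is turned into the Fourier coefficients by Parseval's identity on
`ZMod q`. -/
lemma trigVar_sub (a b : NZ q → ℝ) : (trigVar (b - a) : ℂ)
    = trigVar a + trigVar b + 2 * ∑ k, pairCoeff a b k := by
  have hc (j : ZMod q) : centred (b - a) j = centred b j - centred a j := by
    simp only [centred, Pi.sub_apply, Finset.sum_sub_distrib]
    split_ifs <;> ring
  simp only [pairCoeff, Finset.sum_neg_distrib, sum_centredCoeff_mul_conj]
  simp only [trigVar, hc]
  push_cast
  simp only [sub_sq, Finset.sum_add_distrib, Finset.sum_sub_distrib, mul_assoc, ← Finset.mul_sum,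
    mul_comm (centred b _ : ℂ)]
  ring

lemma prod_factorial_mul_expTerm {ι : Type*} [Fintype ι] (x y : ι → ℂ) (l : ι →₀ ℕ) :
    (∏ k, ((l k).factorial : ℂ)) * (expTerm x l * (starRingEnd ℂ) (expTerm y l))
      = expTerm (fun k => x k * (starRingEnd ℂ) (y k)) l := by
  simp only [expTerm, map_prod, map_div₀, map_pow, map_natCast, ← Finset.prod_mul_distrib]
  refine Finset.prod_congr rfl fun k _ => ?_
  have : ((l k).factorial : ℂ) ≠ 0 := Nat.cast_ne_zero.2 (Nat.factorial_ne_zero _)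
  rw [mul_pow]
  field_simp

lemma memLp_limitPoly (l : NZ q →₀ ℕ) : MemLp (limitPoly l) 2 (gauss q) := by
  have h := expGrowth_limitPoly l
  rw [memLp_two_iff_integrable_sq_norm h.1.aestronglyMeasurable]
  refine (h.mul h).integrable.norm.congr (.of_forall fun x => ?_)
  simp only [norm_mul, sq]

/-- The trigonometric functions in `L²`. -/
def trigLp (a : NZ q → ℝ) : Lp ℂ 2 (gauss q) := (memLp_trig (gauss q) a).toLp (trig a)

/-- The normalized limit polynomials in `L²`. -/
def limitVec (l : NZ q →₀ ℕ) : Lp ℂ 2 (gauss q) :=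
  (Real.sqrt (∏ k, ((l k).factorial : ℝ)) : ℂ) • (memLp_limitPoly l).toLp (limitPoly l)

lemma inner_mul_inner_limitVec (f g : Lp ℂ 2 (gauss q)) (l : NZ q →₀ ℕ) :
    inner ℂ f (limitVec l) * inner ℂ (limitVec l) g
      = (∏ k, ((l k).factorial : ℂ)) * (inner ℂ f ((memLp_limitPoly l).toLp (limitPoly l))
        * inner ℂ ((memLp_limitPoly l).toLp (limitPoly l)) g) := by
  have h : (Real.sqrt (∏ k, ((l k).factorial : ℝ)) : ℂ) * Real.sqrt (∏ k, ((l k).factorial : ℝ))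
      = ∏ k, ((l k).factorial : ℂ) := by
    rw [← Complex.ofReal_mul, Real.mul_self_sqrt (by positivity)]
    push_cast
    rfl
  rw [limitVec, inner_smul_right, inner_smul_left, Complex.conj_ofReal, ← h]
  ring

lemma inner_trigLp_limitPoly (a : NZ q → ℝ) (l : NZ q →₀ ℕ) :
    inner ℂ (trigLp a) ((memLp_limitPoly l).toLp (limitPoly l))
      = Complex.exp (-(trigVar a : ℂ) / 2)
        * expTerm (fun k : NZ q => Complex.I * centredCoeff (-a) k.1) l := by
  rw [trigLp, inner_toLp]
  simp_rw [conj_trig]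
  rw [integral_trig_mul_limitPoly, trigVar_neg]

/-- This is the term of `limitTransform` at `(-a, b)` without its killing factor; the sign comes
from the conjugation in the inner product. -/
lemma inner_trigLp_mul_inner (a b : NZ q → ℝ) (l : NZ q →₀ ℕ) :
    inner ℂ (trigLp a) (limitVec l) * inner ℂ (limitVec l) (trigLp b)
      = Complex.exp (-(trigVar a : ℂ) / 2) * Complex.exp (-(trigVar b : ℂ) / 2)
        * expTerm (pairCoeff (-a) b) l := by
  have hr (c : NZ q → ℝ) : (starRingEnd ℂ) (Complex.exp (-(trigVar c : ℂ) / 2))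
      = Complex.exp (-(trigVar c : ℂ) / 2) := by
    rw [← Complex.exp_conj]; simp [Complex.conj_ofNat]
  have hp : (fun k : NZ q => Complex.I * centredCoeff (-a) k.1
      * (starRingEnd ℂ) (Complex.I * centredCoeff (-b) k.1)) = pairCoeff (-a) b := by
    funext k
    simp only [pairCoeff, centredCoeff_neg, map_mul, map_neg, Complex.conj_I]
    linear_combination (-(centredCoeff a k.1 * (starRingEnd ℂ) (centredCoeff b k.1))) * Complex.I_sq
  rw [inner_mul_inner_limitVec, ← inner_conj_symm _ (trigLp b), inner_trigLp_limitPoly,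
    inner_trigLp_limitPoly, map_mul, hr, ← hp, ← prod_factorial_mul_expTerm]
  ring

lemma inner_trigLp (a b : NZ q → ℝ) :
    inner ℂ (trigLp a) (trigLp b) = Complex.exp (-(trigVar (b - a) : ℂ) / 2) := by
  rw [trigLp, trigLp, inner_toLp, ← integral_gauss_trig]
  refine integral_congr_ae (.of_forall fun x => ?_)
  beta_reduce
  rw [conj_trig, trig, trig, trig, ← Complex.exp_add, ← add_mul, ← Complex.ofReal_add,
    ← Finset.sum_add_distrib]
  congr 3
  exact Finset.sum_congr rfl fun k _ => by simp only [Pi.neg_apply, Pi.sub_apply]; ring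

/-- The exponential series sums to the exponential of the cross term, which is just what separates
the variance of `b - a` from the sum of the two variances. -/
lemma hasSum_inner_trigLp (a b : NZ q → ℝ) :
    HasSum (fun l => inner ℂ (trigLp a) (limitVec l) * inner ℂ (limitVec l) (trigLp b))
      (inner ℂ (trigLp a) (trigLp b)) := by
  simp_rw [inner_trigLp_mul_inner]
  have hs : Complex.exp (-(trigVar (b - a) : ℂ) / 2)
      = Complex.exp (-(trigVar a : ℂ) / 2) * Complex.exp (-(trigVar b : ℂ) / 2)
        * Complex.exp (∑ k, pairCoeff (-a) b k) := by
    have : ∑ k, pairCoeff (-a) b k = -∑ k, pairCoeff a b k := by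
      simp [pairCoeff, centredCoeff_neg]
    rw [← Complex.exp_add, ← Complex.exp_add, this, trigVar_sub]
    ring_nf
  rw [inner_trigLp, hs]
  exact (hasSum_expTerm _).mul_left _

lemma hasSum_limitTransform {α : ℝ} (hα0 : 0 ≤ α) (hα1 : α < 1) {κ : (NZ q →₀ ℕ) → ℂ}
    (hκ : ∀ l, ‖κ l‖ ≤ 1) (a b : NZ q → ℝ) :
    HasSum (fun l => killed α (κ l) * (Complex.exp (-(trigVar a : ℂ) / 2)
      * Complex.exp (-(trigVar b : ℂ) / 2) * expTerm (pairCoeff a b) l))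
      (limitTransform α κ a b) := by
  refine (Summable.of_norm_bounded ((summable_norm_expTerm (pairCoeff a b)).mul_left
    ‖Complex.exp (-(trigVar a : ℂ) / 2) * Complex.exp (-(trigVar b : ℂ) / 2)‖)
    fun l => ?_).hasSum
  rw [norm_mul, norm_mul _ (expTerm _ _)]
  exact mul_le_of_le_one_left (by positivity) (norm_killed_le hα0 hα1 (hκ l))

/-- The limit series is the kernel of a law whose transform is `limitTransform`. -/
lemma hasSum_integral_mul {α : ℝ} (hα0 : 0 ≤ α) (hα1 : α < 1) {κ : (NZ q →₀ ℕ) → ℂ}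
    (hκ : ∀ l, ‖κ l‖ ≤ 1) (hκ0 : κ 0 = 1) {Γ : Measure ((NZ q → ℝ) × (NZ q → ℝ))}
    [IsProbabilityMeasure Γ]
    (hΓ : ∀ a b, ∫ z, trig a z.1 * trig b z.2 ∂Γ = limitTransform α κ a b)
    {f g : (NZ q → ℝ) → ℂ} (hf : MemLp f 2 (gauss q)) (hg : MemLp g 2 (gauss q)) :
    Integrable (fun z => f z.1 * g z.2) Γ ∧
      HasSum (fun l => limitCoeff α κ l * (∫ x, f x * limitPoly l x ∂(gauss q))
        * (∫ x, g x * (starRingEnd ℂ) (limitPoly l x) ∂(gauss q))) (∫ z, f z.1 * g z.2 ∂Γ) := by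
  have ht (x : NZ q → ℝ) : trig 0 x = 1 := by simp [trig]
  -- At zero frequency in the other variable only the term `l = 0` survives, with killing factor
  -- `1`; what is left is the transform of the normal law.
  have h1 : MeasurePreserving Prod.fst Γ (gauss q) := by
    have := Measure.isProbabilityMeasure_map (μ := Γ) measurable_fst.aemeasurable
    refine ⟨measurable_fst, ext_of_integral_trig fun a => ?_⟩
    rw [integral_map measurable_fst.aemeasurable (continuous_trig a).aestronglyMeasurable,
      integral_gauss_trig, ← limitTransform_zero_right hκ0 (α := α), ← hΓ]
    simp_rw [ht, mul_one]
  have h2 : MeasurePreserving Prod.snd Γ (gauss q) := by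
    have := Measure.isProbabilityMeasure_map (μ := Γ) measurable_snd.aemeasurable
    refine ⟨measurable_snd, ext_of_integral_trig fun a => ?_⟩
    rw [integral_map measurable_snd.aemeasurable (continuous_trig a).aestronglyMeasurable,
      integral_gauss_trig, ← limitTransform_zero_left hκ0 (α := α), ← hΓ]
    simp_rw [ht, one_mul]
  refine ⟨(hf.comp_measurePreserving h1).integrable_mul (hg.comp_measurePreserving h2), ?_⟩
  -- Composition with the two projections is isometric into `L²(Γ)`, so integration against `Γ`
  -- becomes an inner product of bounded images.
  let A : Lp ℂ 2 (gauss q) →L[ℂ] Lp ℂ 2 Γ :=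
    (Lp.compMeasurePreservingₗᵢ ℂ Prod.fst h1).toContinuousLinearMap
  let B : Lp ℂ 2 (gauss q) →L[ℂ] Lp ℂ 2 Γ :=
    (Lp.compMeasurePreservingₗᵢ ℂ Prod.snd h2).toContinuousLinearMap
  have hAB {u v : (NZ q → ℝ) → ℂ} (hu : MemLp u 2 (gauss q)) (hv : MemLp v 2 (gauss q)) :
      inner ℂ (A (hu.toLp u)) (B (hv.toLp v)) = ∫ z, (starRingEnd ℂ) (u z.1) * v z.2 ∂Γ :=
    inner_toLp (hu.comp_measurePreserving h1) (hv.comp_measurePreserving h2)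
  -- The inner product conjugates its first argument, so the frame identity is applied to the
  -- conjugate of `f`.
  have hcf : MemLp (fun x => (starRingEnd ℂ) (f x)) 2 (gauss q) := hf.star
  have key := hasSum_inner_of_dense_span (S := Set.range (trigLp (q := q))) (e := limitVec)
    (dense_span_trig (gauss q)) (by
      rintro _ ⟨a, rfl⟩ _ ⟨b, rfl⟩
      exact hasSum_inner_trigLp a b) (k := fun l => killed α (κ l))
    (fun l => norm_killed_le hα0 hα1 (hκ l)) A B (by
      rintro _ ⟨a, rfl⟩ _ ⟨b, rfl⟩
      have h := hasSum_limitTransform hα0 hα1 hκ (-a) b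
      simp_rw [trigVar_neg, ← inner_trigLp_mul_inner, ← mul_assoc] at h
      rw [trigLp, trigLp, hAB]
      simp_rw [conj_trig, hΓ]
      exact h) (hcf.toLp _) (hg.toLp g)
  rw [hAB] at key
  simp_rw [Complex.conj_conj, mul_assoc, inner_mul_inner_limitVec, inner_toLp,
    Complex.conj_conj, mul_comm ((starRingEnd ℂ) (limitPoly _ _))] at key
  refine key.congr_fun fun l => ?_
  rw [limitCoeff]
  ring

end LimitKernel

end GreenLimit

end

/-! ### Expansion, termwise limit and weak limit combined -/

theorem mainTheorem10 (q : ℕ) [NeZero q] (hq : 2 ≤ q) (α : ℝ) (hα0 : 0 ≤ α) (hα1 : α < 1)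
    (ν : (d : ℕ) → PMF (Fin d → ZMod q)) (hν : ∀ d, GreenLimit.Exchangeable (ν d))
    (κ : (GreenLimit.NZ q →₀ ℕ) → ℂ)
    (hκ : ∀ l, Tendsto (fun d => GreenLimit.kappa (ν d) l) atTop (𝓝 (κ l))) :
    -- the scaled Green function is its Krawtchouk expansion
    (∀ d : ℕ, ∀ m ∈ GreenLimit.countVectors q d, ∀ n ∈ GreenLimit.countVectors q d,
      ((GreenLimit.scaledGreen α (ν d) m n : ℝ) : ℂ)
        = ∑ l ∈ GreenLimit.indices q d, GreenLimit.term α (ν d) l m n) ∧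
    -- each term converges pointwise to the corresponding term of the limit series
    (∀ (mp np : GreenLimit.NZ q → ℝ) (m n : ℕ → ZMod q → ℕ),
      (∀ d, m d ∈ GreenLimit.countVectors q d) → (∀ d, n d ∈ GreenLimit.countVectors q d) →
      Tendsto (fun d => GreenLimit.scaledPoint d (m d)) atTop (𝓝 mp) →
      Tendsto (fun d => GreenLimit.scaledPoint d (n d)) atTop (𝓝 np) →
      ∀ l, Tendsto (fun d => GreenLimit.term α (ν d) l (m d) (n d)) atTop
        (𝓝 (GreenLimit.limitTerm α κ l mp np))) ∧
    -- the scaled Green function converges weakly to the law `Γ` with the limit series as its kernel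
    (∃ Γ : Measure ((GreenLimit.NZ q → ℝ) × (GreenLimit.NZ q → ℝ)), IsProbabilityMeasure Γ ∧
      (∀ F : ((GreenLimit.NZ q → ℝ) × (GreenLimit.NZ q → ℝ)) →ᵇ ℝ,
        Tendsto (fun d : ℕ => ((d : ℝ) ^ (q - 1))⁻¹ *
            ∑ m ∈ GreenLimit.countVectors q d, ∑ n ∈ GreenLimit.countVectors q d,
              F (GreenLimit.scaledPoint d m, GreenLimit.scaledPoint d n)
                * GreenLimit.scaledGreen α (ν d) m n)
          atTop (𝓝 (∫ z, F z ∂Γ))) ∧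
      (∀ f g : (GreenLimit.NZ q → ℝ) → ℂ,
        MemLp f 2 (GreenLimit.gauss q) → MemLp g 2 (GreenLimit.gauss q) →
        Integrable (fun z => f z.1 * g z.2) Γ ∧
        HasSum (fun l => GreenLimit.limitCoeff α κ l
            * (∫ mp, f mp * GreenLimit.limitPoly l mp ∂(GreenLimit.gauss q))
            * (∫ np, g np * (starRingEnd ℂ) (GreenLimit.limitPoly l np) ∂(GreenLimit.gauss q)))
          (∫ z, f z.1 * g z.2 ∂Γ))) := by
  have hκ1 (l : GreenLimit.NZ q →₀ ℕ) : ‖κ l‖ ≤ 1 :=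
    le_of_tendsto (hκ l).norm (.of_forall fun d => GreenLimit.norm_kappa_le _ _)
  have hκ0 : κ 0 = 1 := by
    refine tendsto_nhds_unique (hκ 0) ?_
    simp_rw [GreenLimit.kappa_zero]
    exact tendsto_const_nhds
  refine ⟨fun d m hm n hn => ?_, fun mp np m n hm hn hmp hnp l => ?_, ?_⟩
  · exact GreenLimit.scaledGreen_eq hα0 hα1 (hν d) (GreenLimit.mem_countVectors.1 hm)
      (GreenLimit.mem_countVectors.1 hn)
  · exact GreenLimit.tendsto_term hα0 hα1 ν hκ (fun d => GreenLimit.mem_countVectors.1 (hm d))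
      (fun d => GreenLimit.mem_countVectors.1 (hn d)) hmp hnp l
  · obtain ⟨Γ, hΓ, hF, hT⟩ := GreenLimit.exists_limit_law hα0 hα1 hν hκ
    exact ⟨Γ, hΓ, hF, fun f g hf hg => GreenLimit.hasSum_integral_mul hα0 hα1 hκ1 hκ0 hT hf hg⟩
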